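/- Let $(S,g)$ and $(\tilde S,\tilde g)$ be closed (compact, boundaryless) connected smooth Riemannian surfaces with geodesic distances $d$, $\tilde d$. A Jordan domain $D\subset S$ is a nonempty connected open set whose boundary is nonempty and has finitely many connected components, each of them a smoothly embedded circle with $D$ locally on exactly one side of it. Given a real number $\gamma_C$ for each boundary component $C$ of $D$, a hydrodynamical Green function of $D$ with circulations $\gamma=(\gamma_C)$ is a real function $G(s,s_o)$ of distinct points $s,s_o\in D$ which is symmetric, $G(s,s_o)=G(s_o,s)$, and such that for every $s_o\in D$ the function $\psi=G(\cdot,s_o)$ is harmonic on $D\setminus\{s_o\}$ for the Laplace–Beltrami operator of $g$; $\psi(s)-\frac{1}{2\pi}\log d(s,s_o)$ has a finite limit as $s\to s_o$; $\psi$ extends continuously to $\overline D\setminus\{s_o\}$ and is constant on each boundary component of $D$; and the circulation of the velocity field $\mathrm{sgrad}\,\psi$ around each boundary component $C$ is $\gamma_C$, that is, $\oint\partial_n\psi\,ds=\gamma_C$ along the circles of every annular collar of $C$ in $D\setminus\{s_o\}$, with $n$ the unit normal pointing out of $D$, towards $C$. The regularized Green function is $r_G(s_o)=\lim_{s\to s_o}\bigl(G(s,s_o)-\frac{1}{2\pi}\log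 d(s,s_o)\bigr)$. **Proposition.** Let $D\subset S$ and $\tilde D\subset\tilde S$ be Jordan domains and let $f:D\to\tilde D$ be a conformal map, i.e. a smooth bijection with $\tilde g(df(s)u,df(s)v)=h(s)^2g(u,v)$ for all $s\in D$ and $u,v\in T_sS$, where $h>0$. Then there is a bijection $C\mapsto\sigma(C)$ from the boundary components of $D$ to those of $\tilde D$ such that $f(s)$ tends to $\sigma(C)$ as $s\in D$ tends to $C$, and for all circulations $\gamma$ on the boundary components of $D$, with $\tilde\gamma_{\sigma(C)}=\gamma_C$, the following holds. 1. A function $\tilde G$ is a hydrodynamical Green function of $\tilde D$ with circulations $\tilde\gamma$ if and only if $(s,s_o)\mapsto\tilde G(f(s),f(s_o))$ is a hydrodynamical Green function of $D$ with circulations $\gamma$. 2. Let $G_D$ and $\tilde G_{\tilde D}$ be hydrodynamical Green functions of $D$ and $\tilde D$ with circulations $\gamma$ and $\tilde\gamma$, with the same normalization of the additive constant: for some $s_1\in D$ and some boundary component $C$ of $D$, the value of $G_D(\cdot,s_1)$ on $C$ equals the value of $\tilde G_{\tilde D}(\cdot,f(s_1))$ on $\sigma(C)$ (for instance, both are $0$).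 Then $$\tilde G_{\tilde D}(f(s),f(s_o))=G_D(s,s_o)\quad\text{for all distinct } s,s_o\in D,$$ and $$r_{\tilde G_{\tilde D}}(f(s_o))=r_{G_D}(s_o)-\frac{\log h(s_o)}{2\pi}\quad\text{for all } s_o\in D.$$ -/

import Mathlib

open Set Filter Topology MeasureTheory Bundle
open scoped Manifold ContDiff Bundle

noncomputable section

section Surface

variable {S : Type*} [MetricSpace S] [ChartedSpace (EuclideanSpace ℝ (Fin 2)) S]
  [RiemannianBundle (fun x : S => TangentSpace (𝓡 2) x)]

/-- The Gram matrix `g_ij` of the metric in the preferred chart at `x`, at the coordinates `y`. -/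
def gramMatrix (x : S) (y : EuclideanSpace ℝ (Fin 2)) : Matrix (Fin 2) (Fin 2) ℝ :=
  fun i j =>
    inner ℝ
      (mfderiv 𝓘(ℝ, EuclideanSpace ℝ (Fin 2)) (𝓡 2) (extChartAt (𝓡 2) x).symm y
        (EuclideanSpace.single i (1 : ℝ)))
      (mfderiv 𝓘(ℝ, EuclideanSpace ℝ (Fin 2)) (𝓡 2) (extChartAt (𝓡 2) x).symm y
        (EuclideanSpace.single j (1 : ℝ)))

/-- The Laplace-Beltrami operator `Δ u = div grad u`, computed at `x` in the preferred chart at `x`: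
`(det g)^(-1/2) ∑ i, ∂_i ((det g)^(1/2) ∑ j, g^ij ∂_j u)`. -/
def laplaceBeltrami (u : S → ℝ) (x : S) : ℝ :=
  (Real.sqrt (gramMatrix x (extChartAt (𝓡 2) x x)).det)⁻¹ *
    ∑ i : Fin 2,
      fderiv ℝ
        (fun y : EuclideanSpace ℝ (Fin 2) =>
          Real.sqrt (gramMatrix x y).det *
            ∑ j : Fin 2, (gramMatrix x y)⁻¹ i j *
              fderiv ℝ (u ∘ (extChartAt (𝓡 2) x).symm) y (EuclideanSpace.single j (1 : ℝ)))
        (extChartAt (𝓡 2) x x) (EuclideanSpace.single i (1 : ℝ))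

/-- `u` is harmonic on the (open) set `U`. -/
def IsHarmonicOn (u : S → ℝ) (U : Set S) : Prop :=
  ContMDiffOn (𝓡 2) 𝓘(ℝ, ℝ) 2 u U ∧ ∀ x ∈ U, laplaceBeltrami u x = 0

/-- The open annulus `a < |z| < b` in the complex plane. -/
def annulus (a b : ℝ) : Set ℂ := {z | a < ‖z‖ ∧ ‖z‖ < b}

/-- `Φ` is a smooth injective immersion (that is, by equality of dimensions, a diffeomorphism onto
an open set) of the annulus `a < |z| < b` into `S`. -/
structure IsAnnularChart (Φ : ℂ → S) (a b : ℝ) : Prop where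
  smooth : ContMDiffOn 𝓘(ℝ, ℂ) (𝓡 2) ∞ Φ (annulus a b)
  inj : InjOn Φ (annulus a b)
  immersion : ∀ z ∈ annulus a b, Function.Injective (mfderiv 𝓘(ℝ, ℂ) (𝓡 2) Φ z)

/-- The connected components of the boundary of `D`. -/
def boundaryComponents (D : Set S) : Set (Set S) :=
  {C | ∃ x ∈ frontier D, C = connectedComponentIn (frontier D) x}

/-- A Jordan domain: a region (nonempty connected open set) whose boundary is nonempty and has
finitely many connected components, each of them a smooth circle which has `D` on exactly
one side: it has a neighbourhood diffeomorphic to the annulus `1/2 < |z| < 2`, in which the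
component is `|z| = 1` and `D` is `1 < |z|`. -/
structure IsJordanDomain (D : Set S) : Prop where
  isOpen : IsOpen D
  isConnected : IsConnected D
  frontier_nonempty : (frontier D).Nonempty
  finite : (boundaryComponents D).Finite
  circle : ∀ C ∈ boundaryComponents D, ∃ Φ : ℂ → S, IsAnnularChart Φ (1 / 2) 2 ∧
    Φ '' Metric.sphere (0 : ℂ) 1 = C ∧ ∀ z ∈ annulus (1 / 2) 2, (Φ z ∈ D ↔ 1 < ‖z‖)

/-- `Φ` parametrizes by the annulus `1 < |z| < R` a one-sided collar in `D` of the boundary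
component `C`: the sets `Φ {1 < |z| < r}`, `r > 1`, form a basis of the neighbourhoods of `C`
within `D`. No regularity of `Φ` at `C` itself is required. -/
structure IsCollar (D C : Set S) (Φ : ℂ → S) (R : ℝ) : Prop where
  one_lt : 1 < R
  chart : IsAnnularChart Φ 1 R
  mapsTo : MapsTo Φ (annulus 1 R) D
  map_end : Filter.map Φ (Filter.comap (fun z : ℂ => ‖z‖) (𝓝[>] 1)) = 𝓝ˢ C ⊓ 𝓟 D

end Surface

/-- For independent vectors `a`, `b` of a Euclidean plane: the unit vector orthogonal to `a` that
is on the same side of `a` as `b`. -/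
def unitNormal {V : Type*} [NormedAddCommGroup V] [InnerProductSpace ℝ V] (a b : V) : V :=
  ‖b - (inner ℝ a b / inner ℝ a a) • a‖⁻¹ • (b - (inner ℝ a b / inner ℝ a a) • a)

section Green

variable {S : Type*} [MetricSpace S] [ChartedSpace (EuclideanSpace ℝ (Fin 2)) S]
  [RiemannianBundle (fun x : S => TangentSpace (𝓡 2) x)]

/-- The derivative `dψ v` of `ψ` at `p` in the direction of the tangent vector `v`. -/
def directionalDeriv (ψ : S → ℝ) (p : S) (v : TangentSpace (𝓡 2) p) : ℝ :=
  mfderiv (𝓡 2) 𝓘(ℝ, ℝ) ψ p v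

/-- The circulation `∮ ⟨v, t⟩ ds` of the velocity field `v = sgrad ψ = J grad ψ` around the curve
`Φ (|z| = r)` of a collar. The unit normal `n` points out of the domain, towards `|z| = 1`, and
the unit tangent is `t = J n`, so that `⟨v, t⟩ = ⟨grad ψ, n⟩ = dψ n`. The tangent vector of
`θ ↦ Φ (r exp (i θ))` is `dΦ (i z)`, so that `ds = ‖dΦ (i z)‖ dθ`. -/
def circulation (ψ : S → ℝ) (Φ : ℂ → S) (r : ℝ) : ℝ :=
  ∫ θ in (0 : ℝ)..(2 * Real.pi),
    directionalDeriv ψ (Φ (circleMap 0 r θ))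
      (unitNormal
        (mfderiv 𝓘(ℝ, ℂ) (𝓡 2) Φ (circleMap 0 r θ) (Complex.I * circleMap 0 r θ))
        (mfderiv 𝓘(ℝ, ℂ) (𝓡 2) Φ (circleMap 0 r θ) (-circleMap 0 r θ))) *
      ‖mfderiv 𝓘(ℝ, ℂ) (𝓡 2) Φ (circleMap 0 r θ) (Complex.I * circleMap 0 r θ)‖

/-- `ψ` (defined on `D`) extends continuously to `C` with the constant value `b`. -/
def HasBoundaryValue (D : Set S) (ψ : S → ℝ) (C : Set S) (b : ℝ) : Prop :=
  ∀ x ∈ C, Tendsto ψ (𝓝[D] x) (𝓝 b)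

/-- `G s s₀ - log d(s, s₀) / 2π`, the function of `s` that is left when the singularity at `s₀` is
subtracted; `d` is the geodesic distance. -/
def subtractedGreen (G : S → S → ℝ) (s₀ s : S) : ℝ :=
  G s s₀ - Real.log (dist s s₀) / (2 * Real.pi)

/-- The regularized Green function `s₀ ↦ lim_{s → s₀} (G s s₀ - log d(s, s₀) / 2π)`. -/
def regularizedGreen (G : S → S → ℝ) (s₀ : S) : ℝ :=
  limUnder (𝓝[≠] s₀) (subtractedGreen G s₀)

/-- `G` is a hydrodynamical Green function of `D` with circulation `γ C` around the boundary
component `C` (oriented as boundary of `D`). Only the values of `G` on `D × D` off the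
diagonal matter. Together, `harmonic` and `boundary` say that `G · s₀` is continuous on the closure
of `D`, except at `s₀`, and constant on each boundary component. -/
structure IsHydrodynamicalGreen (D : Set S) (γ : boundaryComponents D → ℝ) (G : S → S → ℝ) :
    Prop where
  harmonic : ∀ s₀ ∈ D, IsHarmonicOn (fun s => G s s₀) (D \ {s₀})
  singularity : ∀ s₀ ∈ D, ∃ ρ : ℝ, Tendsto (subtractedGreen G s₀) (𝓝[≠] s₀) (𝓝 ρ)
  symmetric : ∀ s ∈ D, ∀ s₀ ∈ D, s ≠ s₀ → G s s₀ = G s₀ s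
  boundary : ∀ s₀ ∈ D, ∀ C : boundaryComponents D,
    ∃ b : ℝ, HasBoundaryValue D (fun s => G s s₀) C b
  circulation_eq : ∀ s₀ ∈ D, ∀ (C : boundaryComponents D) (Φ : ℂ → S) (R : ℝ),
    IsCollar D C Φ R → s₀ ∉ Φ '' annulus 1 R →
      ∀ r : ℝ, 1 < r → r < R → circulation (fun s => G s s₀) Φ r = γ C

end Green

/-- `f` is a conformal map of the open set `D` onto the open set `D'`, with conformal factor `h`. -/
structure IsConformalBetween {S S' : Type*}
    [MetricSpace S] [ChartedSpace (EuclideanSpace ℝ (Fin 2)) S]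
    [RiemannianBundle (fun x : S => TangentSpace (𝓡 2) x)]
    [MetricSpace S'] [ChartedSpace (EuclideanSpace ℝ (Fin 2)) S']
    [RiemannianBundle (fun x : S' => TangentSpace (𝓡 2) x)]
    (f : S → S') (D : Set S) (D' : Set S') (h : S → ℝ) : Prop where
  smooth : ContMDiffOn (𝓡 2) (𝓡 2) ∞ f D
  bijOn : BijOn f D D'
  factor_pos : ∀ s ∈ D, 0 < h s
  conformal : ∀ s ∈ D, ∀ u v : TangentSpace (𝓡 2) s,
    inner ℝ (mfderiv (𝓡 2) (𝓡 2) f s u) (mfderiv (𝓡 2) (𝓡 2) f s v) = h s ^ 2 * inner ℝ u v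

end

/-!
Everything in the definition of a hydrodynamical Green function is conformally invariant, except
that the distance in the logarithmic singularity is replaced by a distance that is asymptotic to
`h s₀` times the first one. So a conformal map pulls Green functions back to Green functions
(`IsHydrodynamicalGreen.comp_conformal`), with `log (h s₀) / 2π` added to the limit at the
singularity. The ingredients are as follows.

* The Laplace-Beltrami operator is the divergence of the vector density
  `(det g)^(1/2) g^ij ∂_j u`, which in dimension two does not change when `g` is multiplied by a
  positive function (`gradDensity_comp`, `lapDensity_comp`, `IsHarmonicOn.comp_conformal`).
* Normal derivatives and arc lengths scale inversely (`IsConformalBetween.circulation_comp`).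
* Nearly shortest paths between nearby points stay close to these points, where `f` stretches
  lengths by nearly `h s₀` (`IsConformalBetween.tendsto_dist_div_dist`).
* A homeomorphism of Jordan domains induces a bijection of the boundary components, because the
  boundary components have connected neighbourhoods within the domain, disjoint for different
  components (`IsJordanDomain.exists_boundary_equiv`). No boundary regularity of `f` is needed.

The converse implication is the same statement for the inverse map, which is conformal with the
factor `1 / h`.

The second part is a uniqueness theorem, `IsHydrodynamicalGreen.exists_sub_eq_const`: Green
functions with the same circulations differ by a constant. Fix `s₀` and let `u` be the difference
of the two Green functions with pole at `s₀`; it has a finite limit at `s₀` and at each boundary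
component. Neither removability of the singularity nor regularity at the boundary is used.
Instead, if `u` takes two different values, choose a smooth nondecreasing step `η` between these
values whose transition interval avoids the finitely many limits. Then `w = η ∘ u - η a`, where
`a` is the limit at `s₀`, is constant near each boundary component and zero near `s₀`, so that
Green's formula (`IsJordanDomain.integral_gradInner_eq`) gives the integral of `⟨grad w, grad G⟩`
for either Green function `G` as the sum over the boundary components of the value of `w` times
the circulation. Subtracting, `∫ η'(u) |grad u|² = 0`, hence `grad w = 0` and `w` is constant,
which contradicts the choice of `η`. The constant does not depend on `s₀` by the symmetry of Green
functions.

Green's formula needs no integration over boundary curves: `w` minus a combination of cutoff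
functions of collars is a test function, whose gradient is orthogonal to the gradient of a harmonic
function (`IsAreaMeasure.integral_gradInner_eq_zero`), and for a cutoff function that depends only
on the radius of a collar, integration in polar coordinates produces the circulation
(`IsAreaMeasure.setIntegral_gradInner_eq`).
-/

noncomputable section

set_option linter.unusedSectionVars false

/-! ### Injective immersions between manifolds of the same dimension -/

section InverseFunction

variable {E F : Type*} [NormedAddCommGroup E] [NormedSpace ℝ E] [FiniteDimensional ℝ E]
  [NormedAddCommGroup F] [NormedSpace ℝ F] [FiniteDimensional ℝ F]
  {M : Type*} [TopologicalSpace M] [ChartedSpace E M] [IsManifold 𝓘(ℝ, E) ∞ M]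
  {N : Type*} [TopologicalSpace N] [ChartedSpace F N] [IsManifold 𝓘(ℝ, F) ∞ N]

/-- The inverse function theorem for smooth maps between manifolds of the same dimension. -/
theorem ContMDiffAt.exists_local_inverse {f : M → N} {x : M}
    (hf : ContMDiffAt 𝓘(ℝ, E) 𝓘(ℝ, F) ∞ f x)
    (hinj : Function.Injective (mfderiv 𝓘(ℝ, E) 𝓘(ℝ, F) f x))
    (hdim : Module.finrank ℝ E = Module.finrank ℝ F) :
    ∃ g : N → M, ContMDiffAt 𝓘(ℝ, F) 𝓘(ℝ, E) ∞ g (f x) ∧ g (f x) = x ∧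
      (∀ᶠ y in 𝓝 x, g (f y) = y) ∧ ∀ᶠ z in 𝓝 (f x), f (g z) = z := by
  set a := extChartAt 𝓘(ℝ, E) x with ha
  set b := extChartAt 𝓘(ℝ, F) (f x) with hb
  set F' := writtenInExtChartAt 𝓘(ℝ, E) 𝓘(ℝ, F) x f with hF'
  have hFs : ContDiffAt ℝ ∞ F' (a x) := by
    have := (contMDiffAt_iff.1 hf).2
    rwa [ModelWithCorners.range_eq_univ, contDiffWithinAt_univ] at this
  have hmd : mfderiv 𝓘(ℝ, E) 𝓘(ℝ, F) f x = fderiv ℝ F' (a x) := by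
    rw [(hf.mdifferentiableAt (by simp)).mfderiv, ModelWithCorners.range_eq_univ,
      fderivWithin_univ]
  have hinj' : Function.Injective (fderiv ℝ F' (a x)) := by
    rw [hmd] at hinj; exact hinj
  let L : E ≃L[ℝ] F := (LinearMap.linearEquivOfInjective
    (fderiv ℝ F' (a x)).toLinearMap hinj' hdim).toContinuousLinearEquiv
  have hL : HasFDerivAt F' (L : E →L[ℝ] F) (a x) := by
    have h1 : (L : E →L[ℝ] F) = fderiv ℝ F' (a x) := by
      ext v; simp [L]
    rw [h1]; exact (hFs.differentiableAt (by simp)).hasFDerivAt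
  let G := hFs.localInverse hL (by simp)
  have hG : ContDiffAt ℝ ∞ G (F' (a x)) := hFs.to_localInverse hL (by simp)
  have hstr : HasStrictFDerivAt F' (L : E →L[ℝ] F) (a x) :=
    hFs.hasStrictFDerivAt' hL (by simp)
  have hleft : ∀ᶠ y in 𝓝 (a x), G (F' y) = y := hstr.eventually_left_inverse
  have hright : ∀ᶠ z in 𝓝 (F' (a x)), F' (G z) = z := hstr.eventually_right_inverse
  have hFa : F' (a x) = b (f x) := by simp [F', writtenInExtChartAt, a, b]
  have hGb : G (b (f x)) = a x := by rw [← hFa]; exact hleft.self_of_nhds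
  have hGc : ContinuousAt G (b (f x)) := by rw [← hFa]; exact hG.continuousAt
  have hfc := hf.continuousAt
  have hac : ContinuousAt a x := continuousAt_extChartAt x
  have hbc : ContinuousAt b (f x) := continuousAt_extChartAt (f x)
  have hxs : a.source ∈ 𝓝 x := extChartAt_source_mem_nhds x
  have hfs : b.source ∈ 𝓝 (f x) := extChartAt_source_mem_nhds (f x)
  have hxt : a.target ∈ 𝓝 (a x) := extChartAt_target_mem_nhds x
  refine ⟨a.symm ∘ G ∘ b, ?_, by simp [hGb, a], ?_, ?_⟩
  · have h1 : ContMDiffAt 𝓘(ℝ, F) 𝓘(ℝ, F) ∞ b (f x) := contMDiffAt_extChartAt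
    have h2 : ContMDiffAt 𝓘(ℝ, F) 𝓘(ℝ, E) ∞ G (b (f x)) := by
      rw [← hFa]; exact hG.contMDiffAt
    have h3 : ContMDiffAt 𝓘(ℝ, E) 𝓘(ℝ, E) ∞ a.symm (G (b (f x))) := by
      rw [hGb]
      exact (contMDiffOn_extChartAt_symm x).contMDiffAt hxt
    exact h3.comp (f x) (h2.comp (f x) h1)
  · filter_upwards [hac.eventually hleft, hxs, hfc.preimage_mem_nhds hfs] with y h1 h2 h3
    have : F' (a y) = b (f y) := by
      change b (f (a.symm (a y))) = _
      rw [a.left_inv h2]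
    simp only [Function.comp]
    rw [← this, h1, a.left_inv h2]
  · have hsymm : ContinuousAt a.symm (a x) := continuousAt_extChartAt_symm x
    have hGb' : Tendsto (fun z => G (b z)) (𝓝 (f x)) (𝓝 (a x)) := by
      have := hGc.comp hbc
      simpa [ContinuousAt, hGb, Function.comp_def] using this
    have h5 : Tendsto (fun z => f (a.symm (G (b z)))) (𝓝 (f x)) (𝓝 (f x)) := by
      have h6 : Tendsto (fun z => a.symm (G (b z))) (𝓝 (f x)) (𝓝 x) := by
        have := hsymm.tendsto.comp hGb'
        rwa [extChartAt_to_inv] at this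
      exact hfc.tendsto.comp h6
    rw [hFa] at hright
    filter_upwards [hbc.eventually hright, hfs, hGb' hxt, h5 hfs] with z h1 h2 h3 h4
    have h3' : F' (G (b z)) = b (f (a.symm (G (b z)))) := rfl
    rw [h3'] at h1
    exact b.injOn h4 h2 h1

/-- `f` restricts to a diffeomorphism of the open set `U` onto an open set, for manifolds of the
same dimension: it is a smooth injective immersion on `U`. -/
structure IsOpenSmoothEmbeddingOn (E F : Type*) [NormedAddCommGroup E] [NormedSpace ℝ E]
    [NormedAddCommGroup F] [NormedSpace ℝ F] {M : Type*} [TopologicalSpace M] [ChartedSpace E M]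
    {N : Type*} [TopologicalSpace N] [ChartedSpace F N] (f : M → N) (U : Set M) : Prop where
  isOpen : IsOpen U
  smooth : ContMDiffOn 𝓘(ℝ, E) 𝓘(ℝ, F) ∞ f U
  inj : InjOn f U
  immersion : ∀ x ∈ U, Function.Injective (mfderiv 𝓘(ℝ, E) 𝓘(ℝ, F) f x)
  finrank_eq : Module.finrank ℝ E = Module.finrank ℝ F

namespace IsOpenSmoothEmbeddingOn

variable {f : M → N} {U V : Set M} {x : M}

theorem mono (hf : IsOpenSmoothEmbeddingOn E F f U) (hV : IsOpen V) (h : V ⊆ U) :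
    IsOpenSmoothEmbeddingOn E F f V :=
  ⟨hV, hf.smooth.mono h, hf.inj.mono h, fun x hx => hf.immersion x (h hx), hf.finrank_eq⟩

theorem contMDiffAt (hf : IsOpenSmoothEmbeddingOn E F f U) (hx : x ∈ U) :
    ContMDiffAt 𝓘(ℝ, E) 𝓘(ℝ, F) ∞ f x :=
  hf.smooth.contMDiffAt (hf.isOpen.mem_nhds hx)

theorem mdifferentiableAt (hf : IsOpenSmoothEmbeddingOn E F f U) (hx : x ∈ U) :
    MDifferentiableAt 𝓘(ℝ, E) 𝓘(ℝ, F) f x :=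
  (hf.contMDiffAt hx).mdifferentiableAt (by simp)

theorem map_nhds_eq (hf : IsOpenSmoothEmbeddingOn E F f U) (hx : x ∈ U) :
    Filter.map f (𝓝 x) = 𝓝 (f x) := by
  refine le_antisymm (hf.contMDiffAt hx).continuousAt ?_
  obtain ⟨g, hg, hgx, -, hr⟩ :=
    (hf.contMDiffAt hx).exists_local_inverse (hf.immersion x hx) hf.finrank_eq
  have hgc : Tendsto g (𝓝 (f x)) (𝓝 x) := by
    have := hg.continuousAt.tendsto; rwa [hgx] at this
  calc 𝓝 (f x) = Filter.map (fun z => f (g z)) (𝓝 (f x)) := by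
        rw [Filter.map_congr (m₂ := id) hr, Filter.map_id]
    _ = Filter.map f (Filter.map g (𝓝 (f x))) := rfl
    _ ≤ Filter.map f (𝓝 x) := Filter.map_mono hgc

theorem isOpen_image (hf : IsOpenSmoothEmbeddingOn E F f U) (hV : IsOpen V) (h : V ⊆ U) :
    IsOpen (f '' V) := by
  rw [isOpen_iff_mem_nhds]
  rintro _ ⟨x, hx, rfl⟩
  rw [← hf.map_nhds_eq (h hx)]
  exact Filter.image_mem_map (hV.mem_nhds hx)

/-- A left inverse of an open smooth embedding is smooth, whatever its values off the image: near
`f x` it agrees with the local inverse. -/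
theorem contMDiffAt_of_leftInvOn (hf : IsOpenSmoothEmbeddingOn E F f U) {g : N → M}
    (hg : LeftInvOn g f U) (hx : x ∈ U) : ContMDiffAt 𝓘(ℝ, F) 𝓘(ℝ, E) ∞ g (f x) := by
  obtain ⟨g', hg', hgx, -, hr⟩ :=
    (hf.contMDiffAt hx).exists_local_inverse (hf.immersion x hx) hf.finrank_eq
  refine hg'.congr_of_eventuallyEq ?_
  have h1 : g' ⁻¹' U ∈ 𝓝 (f x) :=
    hg'.continuousAt.preimage_mem_nhds (by rw [hgx]; exact hf.isOpen.mem_nhds hx)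
  filter_upwards [hr, h1] with z hz h1z
  conv_lhs => rw [← hz]
  exact hg h1z

/-- The inverse of an open smooth embedding is one as well. -/
theorem of_leftInvOn (hf : IsOpenSmoothEmbeddingOn E F f U) {g : N → M}
    (hg : LeftInvOn g f U) : IsOpenSmoothEmbeddingOn F E g (f '' U) := by
  refine ⟨hf.isOpen_image hf.isOpen subset_rfl, ?_, ?_, ?_, hf.finrank_eq.symm⟩
  · rintro _ ⟨x, hx, rfl⟩
    exact (hf.contMDiffAt_of_leftInvOn hg hx).contMDiffWithinAt
  · rintro _ ⟨x, hx, rfl⟩ _ ⟨y, hy, rfl⟩ h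
    rw [hg hx, hg hy] at h; rw [h]
  · rintro _ ⟨x, hx, rfl⟩
    have hgd := (hf.contMDiffAt_of_leftInvOn hg hx).mdifferentiableAt (by simp)
    have hgx : g (f x) = x := hg hx
    have h2 : (fun z => f (g z)) =ᶠ[𝓝 (f x)] id := by
      filter_upwards [(hf.isOpen_image hf.isOpen subset_rfl).mem_nhds (mem_image_of_mem f hx)]
      rintro _ ⟨y, hy, rfl⟩
      simp [hg hy]
    have hfd : MDifferentiableAt 𝓘(ℝ, E) 𝓘(ℝ, F) f (g (f x)) := by
      rw [hgx]; exact hf.mdifferentiableAt hx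
    have h3 := mfderiv_comp (f x) hfd hgd
    have h4 : mfderiv 𝓘(ℝ, F) 𝓘(ℝ, F) (f ∘ g) (f x) = mfderiv 𝓘(ℝ, F) 𝓘(ℝ, F) id (f x) :=
      Filter.EventuallyEq.mfderiv_eq h2
    intro u v huv
    have h5 : ∀ w, mfderiv 𝓘(ℝ, F) 𝓘(ℝ, F) (f ∘ g) (f x) w = w := by
      intro w; rw [h4, mfderiv_id]; rfl
    have h6 := h5 u
    have h7 := h5 v
    rw [h3] at h6 h7
    rw [← h6, ← h7]
    simp only [ContinuousLinearMap.comp_apply]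
    exact congrArg _ huv

variable {G : Type*} [NormedAddCommGroup G] [NormedSpace ℝ G] [FiniteDimensional ℝ G]
  {P : Type*} [TopologicalSpace P] [ChartedSpace G P] [IsManifold 𝓘(ℝ, G) ∞ P]

theorem comp {g : N → P} {W : Set N} (hg : IsOpenSmoothEmbeddingOn F G g W)
    (hf : IsOpenSmoothEmbeddingOn E F f U) (h : MapsTo f U W) :
    IsOpenSmoothEmbeddingOn E G (g ∘ f) U := by
  refine ⟨hf.isOpen, hg.smooth.comp hf.smooth h, hg.inj.comp hf.inj h, ?_,
    hf.finrank_eq.trans hg.finrank_eq⟩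
  intro x hx
  rw [mfderiv_comp x (hg.mdifferentiableAt (h hx)) (hf.mdifferentiableAt hx)]
  exact (hg.immersion _ (h hx)).comp (hf.immersion x hx)

end IsOpenSmoothEmbeddingOn

theorem isOpenSmoothEmbeddingOn_extChartAt_symm (x : M) :
    IsOpenSmoothEmbeddingOn E E (extChartAt 𝓘(ℝ, E) x).symm
      (extChartAt 𝓘(ℝ, E) x).target := by
  refine ⟨isOpen_extChartAt_target x, contMDiffOn_extChartAt_symm x,
    (extChartAt 𝓘(ℝ, E) x).symm.injOn, ?_, rfl⟩
  intro y hy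
  have h1 := mfderiv_extChartAt_comp_mfderivWithin_extChartAt_symm (I := 𝓘(ℝ, E)) hy
  rw [ModelWithCorners.range_eq_univ, mfderivWithin_univ] at h1
  exact Function.LeftInverse.injective (g := mfderiv 𝓘(ℝ, E) 𝓘(ℝ, E) (extChartAt 𝓘(ℝ, E) x)
    ((extChartAt 𝓘(ℝ, E) x).symm y)) fun v => DFunLike.congr_fun h1 v

end InverseFunction

/-! ### Divergence-form operators in the plane and their change of coordinates -/

section Planar

/-- The coordinate plane. -/
abbrev Plane : Type := EuclideanSpace ℝ (Fin 2)

/-- The standard basis vectors of the plane. -/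
abbrev stdVec (i : Fin 2) : Plane := EuclideanSpace.single i (1 : ℝ)

/-- The components `(det G)^(1/2) ∑ j, G^ij ∂_j v` of the gradient density of `v` with respect to
the metric `G`. -/
def gradDensity (G : Plane → Matrix (Fin 2) (Fin 2) ℝ) (v : Plane → ℝ) (y : Plane) (i : Fin 2) :
    ℝ :=
  Real.sqrt (G y).det * ∑ j : Fin 2, (G y)⁻¹ i j * fderiv ℝ v y (stdVec j)

/-- The divergence of the gradient density: the Laplace-Beltrami operator in coordinates, without
the factor `(det G)^(-1/2)`. -/
def lapDensity (G : Plane → Matrix (Fin 2) (Fin 2) ℝ) (v : Plane → ℝ) (y : Plane) : ℝ :=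
  ∑ i : Fin 2, fderiv ℝ (fun z => gradDensity G v z i) y (stdVec i)

/-- The Jacobian matrix of a map of the plane. -/
def jacobianMatrix (τ : Plane → Plane) (y : Plane) : Matrix (Fin 2) (Fin 2) ℝ :=
  fun k i => fderiv ℝ τ y (stdVec i) k

variable {G : Plane → Matrix (Fin 2) (Fin 2) ℝ} {v : Plane → ℝ} {y : Plane}

theorem inv_fin_two_apply {A : Matrix (Fin 2) (Fin 2) ℝ} :
    A⁻¹ = !![A 1 1 / A.det, -A 0 1 / A.det; -A 1 0 / A.det, A 0 0 / A.det] := by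
  rw [Matrix.inv_def, Matrix.adjugate_fin_two, Ring.inverse_eq_inv']
  ext i j
  fin_cases i <;> fin_cases j <;> simp [div_eq_inv_mul]

/-- The first component of the gradient density, with the inverse matrix written out. -/
theorem gradDensity_zero (hdet : 0 < (G y).det) :
    gradDensity G v y 0 =
      (G y 1 1 * fderiv ℝ v y (stdVec 0) - G y 0 1 * fderiv ℝ v y (stdVec 1)) /
        Real.sqrt (G y).det := by
  have h1 : Real.sqrt (G y).det ≠ 0 := (Real.sqrt_pos.2 hdet).ne'
  have h2 : Real.sqrt (G y).det ^ 2 = (G y).det := Real.sq_sqrt hdet.le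
  rw [gradDensity, inv_fin_two_apply]
  simp only [Fin.sum_univ_two, Matrix.of_apply, Matrix.cons_val_zero, Matrix.cons_val_one,
    Matrix.cons_val', Matrix.cons_val_fin_one]
  field_simp
  rw [h2]; ring

/-- The second component of the gradient density, with the inverse matrix written out. -/
theorem gradDensity_one (hdet : 0 < (G y).det) :
    gradDensity G v y 1 =
      (G y 0 0 * fderiv ℝ v y (stdVec 1) - G y 1 0 * fderiv ℝ v y (stdVec 0)) /
        Real.sqrt (G y).det := by
  have h1 : Real.sqrt (G y).det ≠ 0 := (Real.sqrt_pos.2 hdet).ne'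
  have h2 : Real.sqrt (G y).det ^ 2 = (G y).det := Real.sq_sqrt hdet.le
  rw [gradDensity, inv_fin_two_apply]
  simp only [Fin.sum_univ_two, Matrix.of_apply, Matrix.cons_val_zero, Matrix.cons_val_one,
    Matrix.cons_val', Matrix.cons_val_fin_one]
  field_simp
  rw [h2]; ring

theorem fderiv_comp_stdVec {τ : Plane → Plane} (hτ : DifferentiableAt ℝ τ y)
    (hv : DifferentiableAt ℝ v (τ y)) (i : Fin 2) :
    fderiv ℝ (v ∘ τ) y (stdVec i) =
      jacobianMatrix τ y 0 i * fderiv ℝ v (τ y) (stdVec 0) +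
        jacobianMatrix τ y 1 i * fderiv ℝ v (τ y) (stdVec 1) := by
  rw [fderiv_comp y hv hτ, ContinuousLinearMap.comp_apply]
  have h : fderiv ℝ τ y (stdVec i) =
      jacobianMatrix τ y 0 i • stdVec 0 + jacobianMatrix τ y 1 i • stdVec 1 := by
    ext k; fin_cases k <;> simp [jacobianMatrix]
  rw [h]; simp

/-- The determinant of a metric that is a conformal multiple of a pulled back metric. -/
theorem det_conformal (T A : Matrix (Fin 2) (Fin 2) ℝ) (c : ℝ) :
    (c • (T.transpose * A * T)).det = (c * T.det) ^ 2 * A.det := by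
  rw [Matrix.det_smul, Matrix.det_mul, Matrix.det_mul, Matrix.det_transpose]
  simp; ring

/-- The gradient density is a conformally invariant vector density: under a change of coordinates
it is multiplied by the cofactor matrix of the Jacobian matrix. -/
theorem gradDensity_comp {G₁ G₂ : Plane → Matrix (Fin 2) (Fin 2) ℝ} {v₁ v₂ : Plane → ℝ}
    {τ : Plane → Plane} {c : ℝ} (hc : 0 < c)
    (hG : G₁ y = c • ((jacobianMatrix τ y).transpose * G₂ (τ y) * jacobianMatrix τ y))
    (hsymm : G₂ (τ y) 1 0 = G₂ (τ y) 0 1) (hdet : 0 < (G₂ (τ y)).det)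
    (hJ : (jacobianMatrix τ y).det ≠ 0)
    (hτ : DifferentiableAt ℝ τ y) (hv₂ : DifferentiableAt ℝ v₂ (τ y))
    (hv : v₁ =ᶠ[𝓝 y] v₂ ∘ τ) :
    gradDensity G₁ v₁ y 0 = SignType.sign (jacobianMatrix τ y).det *
        (jacobianMatrix τ y 1 1 * gradDensity G₂ v₂ (τ y) 0 -
          jacobianMatrix τ y 0 1 * gradDensity G₂ v₂ (τ y) 1) ∧
    gradDensity G₁ v₁ y 1 = SignType.sign (jacobianMatrix τ y).det *
        (jacobianMatrix τ y 0 0 * gradDensity G₂ v₂ (τ y) 1 -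
          jacobianMatrix τ y 1 0 * gradDensity G₂ v₂ (τ y) 0) := by
  have hd : (G₁ y).det = (c * (jacobianMatrix τ y).det) ^ 2 * (G₂ (τ y)).det := by
    rw [hG, det_conformal]
  have hd0 : 0 < (G₁ y).det := by
    rw [hd]; have := mul_ne_zero hc.ne' hJ; positivity
  have hs : Real.sqrt (G₁ y).det =
      c * |(jacobianMatrix τ y).det| * Real.sqrt (G₂ (τ y)).det := by
    rw [hd, Real.sqrt_mul (sq_nonneg _), Real.sqrt_sq_eq_abs, abs_mul, abs_of_pos hc]
  have hs2 : Real.sqrt (G₂ (τ y)).det ≠ 0 := (Real.sqrt_pos.2 hdet).ne'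
  rw [gradDensity_zero hd0, gradDensity_one hd0, gradDensity_zero hdet, gradDensity_one hdet,
    hv.fderiv_eq, fderiv_comp_stdVec hτ hv₂, fderiv_comp_stdVec hτ hv₂, hs, hG, hsymm]
  set J := jacobianMatrix τ y
  have hJe : J.det = J 0 0 * J 1 1 - J 0 1 * J 1 0 := Matrix.det_fin_two J
  have key : (SignType.sign J.det : ℝ) * |J.det| = J.det := sign_mul_abs _
  have hk : (SignType.sign J.det : ℝ) * (SignType.sign J.det : ℝ) = 1 := by
    rcases lt_or_gt_of_ne hJ with h | h
    · simp [sign_neg h]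
    · simp [sign_pos h]
  have habs : |J.det| = SignType.sign J.det * J.det := by
    calc |J.det| = SignType.sign J.det * (SignType.sign J.det * |J.det|) := by
          rw [← mul_assoc, hk, one_mul]
      _ = _ := by rw [key]
  have habs' : |J.det| ≠ 0 := abs_ne_zero.2 hJ
  have hs0 : (SignType.sign J.det : ℝ) ≠ 0 := fun h => by rw [h] at hk; simp at hk
  simp only [Matrix.smul_apply, Matrix.mul_apply, Fin.sum_univ_two, Matrix.transpose_apply,
    smul_eq_mul, hsymm]
  rw [habs]
  constructor
  · rw [div_eq_iff (by positivity)]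
    field_simp
    rw [sq, hk, hJe]; ring
  · rw [div_eq_iff (by positivity)]
    field_simp
    rw [sq, hk, hJe]; ring

theorem differentiableAt_jacobianMatrix {τ : Plane → Plane} (hτ : ContDiffAt ℝ 2 τ y)
    (k i : Fin 2) : DifferentiableAt ℝ (fun z => jacobianMatrix τ z k i) y := by
  have h1 : DifferentiableAt ℝ (fderiv ℝ τ) y :=
    (hτ.fderiv_right (m := 1) (by norm_num)).differentiableAt (by simp)
  have h2 : DifferentiableAt ℝ (fun z => fderiv ℝ τ z (stdVec i)) y :=
    h1.clm_apply (differentiableAt_const _)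
  exact ((EuclideanSpace.proj k : Plane →L[ℝ] ℝ).differentiableAt).comp y h2

theorem fderiv_jacobianMatrix_symm {τ : Plane → Plane} (hτ : ContDiffAt ℝ 2 τ y)
    (k i j : Fin 2) :
    fderiv ℝ (fun z => jacobianMatrix τ z k i) y (stdVec j) =
      fderiv ℝ (fun z => jacobianMatrix τ z k j) y (stdVec i) := by
  have h1 : DifferentiableAt ℝ (fderiv ℝ τ) y :=
    (hτ.fderiv_right (m := 1) (by norm_num)).differentiableAt (by simp)
  have h3 : ∀ i j : Fin 2, fderiv ℝ (fun z => jacobianMatrix τ z k i) y (stdVec j) =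
      (fderiv ℝ (fderiv ℝ τ) y (stdVec j) (stdVec i)) k := by
    intro i j
    have h2 : HasFDerivAt (fun z => fderiv ℝ τ z (stdVec i))
        ((fderiv ℝ (fderiv ℝ τ) y).flip (stdVec i)) y := by
      simpa using h1.hasFDerivAt.clm_apply (hasFDerivAt_const (stdVec i) y)
    have h4 := ((EuclideanSpace.proj k : Plane →L[ℝ] ℝ).hasFDerivAt).comp y h2
    have h5 : (fun z => jacobianMatrix τ z k i) =
        (EuclideanSpace.proj k : Plane →L[ℝ] ℝ) ∘
          (fun z => fderiv ℝ τ z (stdVec i)) := rfl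
    rw [h5, h4.fderiv]; rfl
  have h6 : IsSymmSndFDerivAt ℝ τ y := hτ.isSymmSndFDerivAt (by simp)
  rw [h3, h3, h6.eq]

/-- Change of coordinates for the Laplace-Beltrami operator, which is moreover invariant under
conformal changes of the metric of a surface. The second derivatives of `τ` cancel because they are
symmetric. -/
theorem lapDensity_comp {G₁ G₂ : Plane → Matrix (Fin 2) (Fin 2) ℝ} {v₁ v₂ : Plane → ℝ}
    {τ : Plane → Plane} {c : Plane → ℝ} (hc : ∀ᶠ z in 𝓝 y, 0 < c z)
    (hG : ∀ᶠ z in 𝓝 y,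
      G₁ z = c z • ((jacobianMatrix τ z).transpose * G₂ (τ z) * jacobianMatrix τ z))
    (hsymm : ∀ᶠ z in 𝓝 (τ y), G₂ z 1 0 = G₂ z 0 1) (hdet : ∀ᶠ z in 𝓝 (τ y), 0 < (G₂ z).det)
    (hJ : (jacobianMatrix τ y).det ≠ 0) (hτ : ContDiffAt ℝ 2 τ y)
    (hv₂ : ∀ᶠ z in 𝓝 (τ y), DifferentiableAt ℝ v₂ z)
    (hF : ∀ i, DifferentiableAt ℝ (fun z => gradDensity G₂ v₂ z i) (τ y))
    (hv : v₁ =ᶠ[𝓝 y] v₂ ∘ τ) :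
    lapDensity G₁ v₁ y = |(jacobianMatrix τ y).det| * lapDensity G₂ v₂ (τ y) := by
  have hτc := hτ.continuousAt
  have hτd : DifferentiableAt ℝ τ y := hτ.differentiableAt (by simp)
  have hT := differentiableAt_jacobianMatrix hτ
  have hdetc : ContinuousAt (fun z => (jacobianMatrix τ z).det) y := by
    simp_rw [Matrix.det_fin_two]
    exact ((hT 0 0).continuousAt.mul (hT 1 1).continuousAt).sub
      ((hT 0 1).continuousAt.mul (hT 1 0).continuousAt)
  have hsign : ∀ᶠ z in 𝓝 y, SignType.sign (jacobianMatrix τ z).det =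
      SignType.sign (jacobianMatrix τ y).det := by
    rcases lt_or_gt_of_ne hJ with h | h
    · filter_upwards [hdetc.eventually_lt_const h] with z hz
      rw [sign_neg h, sign_neg hz]
    · filter_upwards [hdetc.eventually_const_lt h] with z hz
      rw [sign_pos h, sign_pos hz]
  -- the sign in the transformation formula is locally constant, so that it is not differentiated
  have hev : ∀ᶠ z in 𝓝 y,
      gradDensity G₁ v₁ z 0 = SignType.sign (jacobianMatrix τ y).det *
        (jacobianMatrix τ z 1 1 * gradDensity G₂ v₂ (τ z) 0 -
          jacobianMatrix τ z 0 1 * gradDensity G₂ v₂ (τ z) 1) ∧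
      gradDensity G₁ v₁ z 1 = SignType.sign (jacobianMatrix τ y).det *
        (jacobianMatrix τ z 0 0 * gradDensity G₂ v₂ (τ z) 1 -
          jacobianMatrix τ z 1 0 * gradDensity G₂ v₂ (τ z) 0) := by
    filter_upwards [hc, hG, hτc.eventually hsymm, hτc.eventually hdet, hdetc.eventually_ne hJ,
      (hτ.eventually (by simp)), hτc.eventually hv₂, hv.eventuallyEq_nhds, hsign]
      with z h1 h2 h3 h4 h5 h6 h7 h8 h9
    have := gradDensity_comp h1 h2 h3 h4 h5 (h6.differentiableAt (by simp)) h7 h8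
    rw [h9] at this
    exact this
  have hFc : ∀ i, DifferentiableAt ℝ (fun z => gradDensity G₂ v₂ (τ z) i) y := fun i =>
    (hF i).comp y hτd
  have hFd : ∀ i j, fderiv ℝ (fun z => gradDensity G₂ v₂ (τ z) i) y (stdVec j) =
      jacobianMatrix τ y 0 j * fderiv ℝ (fun z => gradDensity G₂ v₂ z i) (τ y) (stdVec 0) +
      jacobianMatrix τ y 1 j * fderiv ℝ (fun z => gradDensity G₂ v₂ z i) (τ y) (stdVec 1) :=
    fun i j => fderiv_comp_stdVec (v := fun z => gradDensity G₂ v₂ z i) hτd (hF i) j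
  have h0 : (fun z => gradDensity G₁ v₁ z 0) =ᶠ[𝓝 y] _ := hev.mono fun _ hz => hz.1
  have h1 : (fun z => gradDensity G₁ v₁ z 1) =ᶠ[𝓝 y] _ := hev.mono fun _ hz => hz.2
  have d0 := ((((hT 1 1).hasFDerivAt.mul (hFc 0).hasFDerivAt).sub
    ((hT 0 1).hasFDerivAt.mul (hFc 1).hasFDerivAt)).const_mul
      (SignType.sign (jacobianMatrix τ y).det : ℝ)).congr_of_eventuallyEq h0
  have d1 := ((((hT 0 0).hasFDerivAt.mul (hFc 1).hasFDerivAt).sub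
    ((hT 1 0).hasFDerivAt.mul (hFc 0).hasFDerivAt)).const_mul
      (SignType.sign (jacobianMatrix τ y).det : ℝ)).congr_of_eventuallyEq h1
  rw [← sign_mul_self, lapDensity, lapDensity, Fin.sum_univ_two, Fin.sum_univ_two, d0.fderiv,
    d1.fderiv]
  simp only [_root_.smul_apply, _root_.sub_apply,
    _root_.add_apply, smul_eq_mul, hFd]
  rw [fderiv_jacobianMatrix_symm hτ 1 1 0, fderiv_jacobianMatrix_symm hτ 0 1 0,
    Matrix.det_fin_two (jacobianMatrix τ y)]
  ring

end Planar

/-! ### The metric and the Laplace-Beltrami operator in arbitrary coordinates -/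

section Coordinates

variable {S : Type*} [MetricSpace S] [ChartedSpace (EuclideanSpace ℝ (Fin 2)) S]
  [RiemannianBundle (fun x : S => TangentSpace (𝓡 2) x)]

/-- The Riemannian metric at `p`, on the model space `Plane`, to which all tangent spaces are
definitionally equal. This makes vectors at different expressions for the same point comparable. -/
def metricAt (p : S) (v w : Plane) : ℝ :=
  inner ℝ (show TangentSpace (𝓡 2) p from v) (show TangentSpace (𝓡 2) p from w)

/-- The derivative of a map from the plane, as a map between model spaces. -/
def coordDeriv (e : Plane → S) (y : Plane) : Plane →L[ℝ] Plane :=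
  mfderiv 𝓘(ℝ, Plane) (𝓡 2) e y

/-- The metric in the coordinates `e`. -/
def pullbackMetric (e : Plane → S) (y : Plane) : Matrix (Fin 2) (Fin 2) ℝ :=
  fun i j => metricAt (e y) (coordDeriv e y (stdVec i)) (coordDeriv e y (stdVec j))

theorem gramMatrix_eq (x : S) : gramMatrix x = pullbackMetric (extChartAt (𝓡 2) x).symm := rfl

theorem metricAt_comm (p : S) (v w : Plane) : metricAt p v w = metricAt p w v :=
  real_inner_comm _ _

theorem metricAt_add_left (p : S) (v v' w : Plane) :
    metricAt p (v + v') w = metricAt p v w + metricAt p v' w := inner_add_left _ _ _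

theorem metricAt_smul_left (p : S) (c : ℝ) (v w : Plane) :
    metricAt p (c • v) w = c * metricAt p v w := real_inner_smul_left _ _ _

theorem metricAt_add_right (p : S) (v w w' : Plane) :
    metricAt p v (w + w') = metricAt p v w + metricAt p v w' := inner_add_right _ _ _

theorem metricAt_smul_right (p : S) (c : ℝ) (v w : Plane) :
    metricAt p v (c • w) = c * metricAt p v w := real_inner_smul_right _ _ _

/-- The Gram determinant of two independent vectors is positive. -/
theorem gramDet_pos {V : Type*} [NormedAddCommGroup V] [InnerProductSpace ℝ V] {a b : V}
    (h : ∀ s t : ℝ, s • a + t • b = 0 → s = 0 ∧ t = 0) :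
    0 < inner ℝ a a * inner ℝ b b - inner ℝ a b * inner ℝ a b := by
  have hb : b ≠ 0 := fun hb => by simpa using (h 0 1 (by simp [hb])).2
  have hbb : 0 < inner ℝ b b := real_inner_self_pos.2 hb
  have hw : inner ℝ b b • a + (-inner ℝ a b) • b ≠ 0 := fun hw => hbb.ne' (h _ _ hw).1
  have h1 : 0 < inner ℝ (inner ℝ b b • a + (-inner ℝ a b) • b)
      (inner ℝ b b • a + (-inner ℝ a b) • b) := real_inner_self_pos.2 hw
  have h2 : inner ℝ (inner ℝ b b • a + (-inner ℝ a b) • b)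
      (inner ℝ b b • a + (-inner ℝ a b) • b) =
      inner ℝ b b * (inner ℝ a a * inner ℝ b b - inner ℝ a b * inner ℝ a b) := by
    simp only [inner_add_left, inner_add_right, real_inner_smul_left, real_inner_smul_right]
    rw [real_inner_comm a b]; ring
  rw [h2] at h1
  exact pos_of_mul_pos_right h1 hbb.le

theorem pullbackMetric_symm (e : Plane → S) (y : Plane) :
    pullbackMetric e y 1 0 = pullbackMetric e y 0 1 := metricAt_comm _ _ _

theorem pullbackMetric_det_pos {e : Plane → S} {y : Plane}
    (hinj : Function.Injective (coordDeriv e y)) : 0 < (pullbackMetric e y).det := by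
  rw [Matrix.det_fin_two, pullbackMetric_symm]
  refine gramDet_pos (V := TangentSpace (𝓡 2) (e y)) fun s t hst => ?_
  have h1 : coordDeriv e y (s • stdVec 0 + t • stdVec 1) = coordDeriv e y 0 := by
    rw [map_add, map_smul, map_smul, map_zero]; exact hst
  have h2 := hinj h1
  have h3 := congrArg (fun v : Plane => v 0) h2
  have h4 := congrArg (fun v : Plane => v 1) h2
  simp at h3 h4
  exact ⟨h3, h4⟩

variable {S' : Type*} [MetricSpace S'] [ChartedSpace (EuclideanSpace ℝ (Fin 2)) S']
  [RiemannianBundle (fun x : S' => TangentSpace (𝓡 2) x)]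

/-- Transformation of the metric under a conformal map `f`, read in coordinates. -/
theorem pullbackMetric_conformal {e₁ : Plane → S} {e₂ : Plane → S'} {f : S → S'}
    {τ : Plane → Plane} {y : Plane} {c : ℝ}
    (he : f ∘ e₁ =ᶠ[𝓝 y] e₂ ∘ τ) (h₁ : MDifferentiableAt 𝓘(ℝ, Plane) (𝓡 2) e₁ y)
    (hf : MDifferentiableAt (𝓡 2) (𝓡 2) f (e₁ y))
    (h₂ : MDifferentiableAt 𝓘(ℝ, Plane) (𝓡 2) e₂ (τ y)) (hτ : DifferentiableAt ℝ τ y)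
    (hconf : ∀ u v : TangentSpace (𝓡 2) (e₁ y),
      inner ℝ (mfderiv (𝓡 2) (𝓡 2) f (e₁ y) u) (mfderiv (𝓡 2) (𝓡 2) f (e₁ y) v) =
        c * inner ℝ u v) :
    c • pullbackMetric e₁ y =
      (jacobianMatrix τ y).transpose * pullbackMetric e₂ (τ y) * jacobianMatrix τ y := by
  have hcd : coordDeriv (f ∘ e₁) y = coordDeriv (e₂ ∘ τ) y := he.mfderiv_eq
  have hpt : f (e₁ y) = e₂ (τ y) := he.eq_of_nhds
  have hc2 : ∀ i, coordDeriv (e₂ ∘ τ) y (stdVec i) =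
      jacobianMatrix τ y 0 i • coordDeriv e₂ (τ y) (stdVec 0) +
      jacobianMatrix τ y 1 i • coordDeriv e₂ (τ y) (stdVec 1) := by
    intro i
    have h : fderiv ℝ τ y (stdVec i) =
        jacobianMatrix τ y 0 i • stdVec 0 + jacobianMatrix τ y 1 i • stdVec 1 := by
      ext k; fin_cases k <;> simp [jacobianMatrix]
    rw [← map_smul, ← map_smul, ← map_add, ← h]
    have h3 := mfderiv_comp y h₂ hτ.mdifferentiableAt
    rw [mfderiv_eq_fderiv] at h3
    exact DFunLike.congr_fun h3 (stdVec i)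
  have hc1 : ∀ v, coordDeriv (f ∘ e₁) y v =
      mfderiv (𝓡 2) (𝓡 2) f (e₁ y) (coordDeriv e₁ y v) := fun v =>
    DFunLike.congr_fun (mfderiv_comp y hf h₁) v
  ext i j
  have h5 : c * pullbackMetric e₁ y i j = metricAt (f (e₁ y))
      (coordDeriv (f ∘ e₁) y (stdVec i)) (coordDeriv (f ∘ e₁) y (stdVec j)) := by
    rw [hc1, hc1]; exact (hconf _ _).symm
  rw [Matrix.smul_apply, smul_eq_mul, h5, hcd, hpt, hc2, hc2]
  simp only [metricAt_add_left, metricAt_add_right, metricAt_smul_left, metricAt_smul_right,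
    Matrix.mul_apply, Fin.sum_univ_two, Matrix.transpose_apply, pullbackMetric]
  ring

variable [IsManifold (𝓡 2) ∞ S] [IsContMDiffRiemannianBundle (𝓡 2) ∞ (EuclideanSpace ℝ (Fin 2))
  (fun x : S => TangentSpace (𝓡 2) x)]

theorem contDiffOn_pullbackMetric {e : Plane → S} {U : Set Plane} (hU : IsOpen U)
    (he : ContMDiffOn 𝓘(ℝ, Plane) (𝓡 2) ∞ e U) (i j : Fin 2) :
    ContDiffOn ℝ ∞ (fun y => pullbackMetric e y i j) U := by
  have hsec : ∀ v : Plane, ContMDiffOn 𝓘(ℝ, Plane) (𝓡 2).tangent ∞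
      (fun y => (⟨e y, mfderiv 𝓘(ℝ, Plane) (𝓡 2) e y v⟩ :
        TotalSpace Plane (fun x : S => TangentSpace (𝓡 2) x))) U := by
    intro v
    have h1 := he.contMDiffOn_tangentMapWithin (m := ∞) (by simp) hU.uniqueMDiffOn
    have h2 : ContMDiffOn 𝓘(ℝ, Plane) 𝓘(ℝ, Plane).tangent ∞
        (fun y : Plane => (⟨y, v⟩ : TangentBundle 𝓘(ℝ, Plane) Plane)) U := by
      intro y hy
      rw [contMDiffWithinAt_vectorSpace_iff_contDiffWithinAt (V := fun _ => v)]
      exact contDiffWithinAt_const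
    refine (h1.comp h2 fun y hy => hy).congr fun y hy => ?_
    simp only [Function.comp, tangentMapWithin, mfderivWithin_of_isOpen hU hy]
  have h := (hsec (stdVec i)).inner_bundle (hsec (stdVec j))
  exact contMDiffOn_iff_contDiffOn.1 h

end Coordinates

/-! ### Conformal invariance of harmonicity -/

theorem two_le_infty : (2 : WithTop ℕ∞) ≤ ∞ := WithTop.coe_le_coe.2 (le_top (a := (2 : ℕ∞)))

section Laplace

variable {S : Type*} [MetricSpace S] [ChartedSpace (EuclideanSpace ℝ (Fin 2)) S]
  [RiemannianBundle (fun x : S => TangentSpace (𝓡 2) x)] [IsManifold (𝓡 2) ∞ S]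
  [IsContMDiffRiemannianBundle (𝓡 2) ∞ (EuclideanSpace ℝ (Fin 2))
    (fun x : S => TangentSpace (𝓡 2) x)]
  {S' : Type*} [MetricSpace S'] [ChartedSpace (EuclideanSpace ℝ (Fin 2)) S']
  [RiemannianBundle (fun x : S' => TangentSpace (𝓡 2) x)] [IsManifold (𝓡 2) ∞ S']
  [IsContMDiffRiemannianBundle (𝓡 2) ∞ (EuclideanSpace ℝ (Fin 2))
    (fun x : S' => TangentSpace (𝓡 2) x)]

theorem jacobianMatrix_det_ne_zero {τ : Plane → Plane} {y : Plane}
    (h : Function.Injective (fderiv ℝ τ y)) : (jacobianMatrix τ y).det ≠ 0 := by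
  intro h0
  obtain ⟨v, hv, hv0⟩ := Matrix.exists_mulVec_eq_zero_iff.2 h0
  have h1 : fderiv ℝ τ y (WithLp.toLp 2 v) = fderiv ℝ τ y 0 := by
    have h2 : (WithLp.toLp 2 v : Plane) = v 0 • stdVec 0 + v 1 • stdVec 1 := by
      ext k; fin_cases k <;> simp
    rw [h2, map_add, map_smul, map_smul, map_zero]
    ext k
    have := congrFun hv0 k
    simp only [Matrix.mulVec, dotProduct, Fin.sum_univ_two, jacobianMatrix] at this
    simpa [mul_comm] using this
  apply hv
  have h2 := h h1
  ext k
  exact congrArg (fun w : Plane => w k) h2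

/-- A change of coordinates `τ` with `f ∘ e₁ = e₂ ∘ τ`. -/
theorem exists_transition {e₁ : Plane → S} {U₁ : Set Plane} {e₂ : Plane → S'} {U₂ : Set Plane}
    {f : S → S'} {D : Set S} (h₁ : IsOpenSmoothEmbeddingOn Plane Plane e₁ U₁)
    (h₂ : IsOpenSmoothEmbeddingOn Plane Plane e₂ U₂)
    (hf : IsOpenSmoothEmbeddingOn Plane Plane f D) :
    ∃ τ : Plane → Plane,
      IsOpenSmoothEmbeddingOn Plane Plane τ (U₁ ∩ e₁ ⁻¹' (D ∩ f ⁻¹' (e₂ '' U₂))) ∧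
      (∀ y ∈ U₁ ∩ e₁ ⁻¹' (D ∩ f ⁻¹' (e₂ '' U₂)), τ y ∈ U₂ ∧ e₂ (τ y) = f (e₁ y)) := by
  have hD : IsOpen (D ∩ f ⁻¹' (e₂ '' U₂)) :=
    hf.smooth.continuousOn.isOpen_inter_preimage hf.isOpen
      (h₂.isOpen_image h₂.isOpen subset_rfl)
  have hV : IsOpen (U₁ ∩ e₁ ⁻¹' (D ∩ f ⁻¹' (e₂ '' U₂))) :=
    h₁.smooth.continuousOn.isOpen_inter_preimage h₁.isOpen hD
  have hinv : LeftInvOn (Function.invFunOn e₂ U₂) e₂ U₂ := h₂.inj.leftInvOn_invFunOn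
  refine ⟨Function.invFunOn e₂ U₂ ∘ (f ∘ e₁), ?_, ?_⟩
  · have h3 := h₂.of_leftInvOn hinv
    have h4 : IsOpenSmoothEmbeddingOn Plane Plane (f ∘ e₁)
        (U₁ ∩ e₁ ⁻¹' (D ∩ f ⁻¹' (e₂ '' U₂))) :=
      hf.comp (h₁.mono hV inter_subset_left) fun y hy => hy.2.1
    exact h3.comp h4 fun y hy => hy.2.2
  · rintro y ⟨-, -, z, hz, hzy⟩
    have : Function.invFunOn e₂ U₂ (f (e₁ y)) = z := by rw [← hzy]; exact hinv hz
    simp only [Function.comp, this]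
    exact ⟨hz, hzy⟩

namespace IsOpenSmoothEmbeddingOn

variable {e : Plane → S} {U : Set Plane} {y : Plane}

theorem pullbackMetric_det_pos (he : IsOpenSmoothEmbeddingOn Plane Plane e U) (hy : y ∈ U) :
    0 < (pullbackMetric e y).det :=
  _root_.pullbackMetric_det_pos (he.immersion y hy)

theorem contDiffOn_comp {n : WithTop ℕ∞} (hn : n ≤ ∞) {W : Set S} {u : S → ℝ}
    (he : IsOpenSmoothEmbeddingOn Plane Plane e U) (hu : ContMDiffOn (𝓡 2) 𝓘(ℝ, ℝ) n u W) :
    ContDiffOn ℝ n (u ∘ e) (U ∩ e ⁻¹' W) :=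
  contMDiffOn_iff_contDiffOn.1
    (hu.comp ((he.smooth.mono inter_subset_left).of_le hn) fun _ hz => hz.2)

theorem isOpen_inter_preimage {W : Set S}
    (he : IsOpenSmoothEmbeddingOn Plane Plane e U) (hW : IsOpen W) : IsOpen (U ∩ e ⁻¹' W) :=
  he.smooth.continuousOn.isOpen_inter_preimage he.isOpen hW

theorem contDiffOn_gradDensity {W : Set S} {u : S → ℝ}
    (he : IsOpenSmoothEmbeddingOn Plane Plane e U) (hW : IsOpen W)
    (hu : ContMDiffOn (𝓡 2) 𝓘(ℝ, ℝ) 2 u W) (i : Fin 2) :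
    ContDiffOn ℝ 1 (fun z => gradDensity (pullbackMetric e) (u ∘ e) z i) (U ∩ e ⁻¹' W) := by
  have hO := he.isOpen_inter_preimage hW
  have hG : ∀ i j, ContDiffOn ℝ 1 (fun z => pullbackMetric e z i j) (U ∩ e ⁻¹' W) := fun i j =>
    ((contDiffOn_pullbackMetric he.isOpen he.smooth i j).mono inter_subset_left).of_le (by simp)
  have hv := he.contDiffOn_comp two_le_infty hu
  have hdv : ∀ j, ContDiffOn ℝ 1 (fun z => fderiv ℝ (u ∘ e) z (stdVec j)) (U ∩ e ⁻¹' W) :=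
    fun j => (hv.fderiv_of_isOpen hO (by norm_num)).clm_apply contDiffOn_const
  have hdet : ContDiffOn ℝ 1 (fun z => (pullbackMetric e z).det) (U ∩ e ⁻¹' W) := by
    simp_rw [Matrix.det_fin_two]
    exact ((hG 0 0).mul (hG 1 1)).sub ((hG 0 1).mul (hG 1 0))
  have hsq : ContDiffOn ℝ 1 (fun z => Real.sqrt (pullbackMetric e z).det) (U ∩ e ⁻¹' W) :=
    hdet.sqrt fun z hz => (he.pullbackMetric_det_pos hz.1).ne'
  have hsq0 : ∀ z ∈ U ∩ e ⁻¹' W, Real.sqrt (pullbackMetric e z).det ≠ 0 := fun z hz =>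
    (Real.sqrt_pos.2 (he.pullbackMetric_det_pos hz.1)).ne'
  fin_cases i
  · refine ContDiffOn.congr ?_ fun z hz => gradDensity_zero (he.pullbackMetric_det_pos hz.1)
    exact (((hG 1 1).mul (hdv 0)).sub ((hG 0 1).mul (hdv 1))).div hsq hsq0
  · refine ContDiffOn.congr ?_ fun z hz => gradDensity_one (he.pullbackMetric_det_pos hz.1)
    exact (((hG 0 0).mul (hdv 1)).sub ((hG 1 0).mul (hdv 0))).div hsq hsq0

end IsOpenSmoothEmbeddingOn

theorem laplaceBeltrami_eq (u : S → ℝ) (x : S) :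
    laplaceBeltrami u x = (Real.sqrt (gramMatrix x (extChartAt (𝓡 2) x x)).det)⁻¹ *
      lapDensity (gramMatrix x) (u ∘ (extChartAt (𝓡 2) x).symm) (extChartAt (𝓡 2) x x) := rfl

/-- The Laplace-Beltrami operator in arbitrary coordinates, composed with a conformal map whose
conformal factor has the square `c`. -/
theorem lapDensity_comp_conformal {e : Plane → S} {U : Set Plane} {f : S → S'} {D : Set S}
    {c : S → ℝ} {W : Set S'} {u : S' → ℝ} {y : Plane}
    (he : IsOpenSmoothEmbeddingOn Plane Plane e U)
    (hf : IsOpenSmoothEmbeddingOn Plane Plane f D) (hc : ∀ s ∈ D, 0 < c s)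
    (hconf : ∀ s ∈ D, ∀ u v : TangentSpace (𝓡 2) s,
      inner ℝ (mfderiv (𝓡 2) (𝓡 2) f s u) (mfderiv (𝓡 2) (𝓡 2) f s v) = c s * inner ℝ u v)
    (hW : IsOpen W) (hu : ContMDiffOn (𝓡 2) 𝓘(ℝ, ℝ) 2 u W) (hy : y ∈ U) (hyD : e y ∈ D)
    (hyW : f (e y) ∈ W) :
    lapDensity (pullbackMetric e) (u ∘ f ∘ e) y =
      c (e y) * Real.sqrt (pullbackMetric e y).det * laplaceBeltrami u (f (e y)) := by
  set p := f (e y) with hp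
  set e₂ := (extChartAt (𝓡 2) p).symm with he₂
  have h₂ : IsOpenSmoothEmbeddingOn Plane Plane e₂ (extChartAt (𝓡 2) p).target :=
    isOpenSmoothEmbeddingOn_extChartAt_symm p
  have hp2 : e₂ (extChartAt (𝓡 2) p p) = p := extChartAt_to_inv p
  obtain ⟨τ, hτ, hτe⟩ := exists_transition he h₂ hf
  have hyV : y ∈ U ∩ e ⁻¹' (D ∩ f ⁻¹' (e₂ '' (extChartAt (𝓡 2) p).target)) :=
    ⟨hy, hyD, extChartAt (𝓡 2) p p, mem_extChartAt_target p, hp2⟩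
  have hτy : τ y = extChartAt (𝓡 2) p p := by
    apply h₂.inj (hτe y hyV).1 (mem_extChartAt_target p)
    rw [(hτe y hyV).2, hp2]
  have hVn := hτ.isOpen.mem_nhds hyV
  have hG : ∀ z ∈ U ∩ e ⁻¹' (D ∩ f ⁻¹' (e₂ '' (extChartAt (𝓡 2) p).target)),
      pullbackMetric e z = (c (e z))⁻¹ •
        ((jacobianMatrix τ z).transpose * pullbackMetric e₂ (τ z) * jacobianMatrix τ z) := by
    intro z hz
    have hev : f ∘ e =ᶠ[𝓝 z] e₂ ∘ τ := by
      filter_upwards [hτ.isOpen.mem_nhds hz] with w hw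
      exact (hτe w hw).2.symm
    rw [← pullbackMetric_conformal hev (he.mdifferentiableAt hz.1)
      (hf.mdifferentiableAt hz.2.1) (h₂.mdifferentiableAt (hτe z hz).1)
      (hτ.mdifferentiableAt hz).differentiableAt (hconf _ hz.2.1), smul_smul,
      inv_mul_cancel₀ (hc _ hz.2.1).ne', one_smul]
  have hJ : (jacobianMatrix τ y).det ≠ 0 := by
    apply jacobianMatrix_det_ne_zero
    have := hτ.immersion y hyV
    rwa [mfderiv_eq_fderiv] at this
  have hO := h₂.isOpen_inter_preimage hW
  have hτW : τ y ∈ (extChartAt (𝓡 2) p).target ∩ e₂ ⁻¹' W :=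
    ⟨(hτe y hyV).1, by rw [mem_preimage, (hτe y hyV).2]; exact hyW⟩
  have hfl := fun i => h₂.contDiffOn_gradDensity hW hu i
  have hv2 := h₂.contDiffOn_comp two_le_infty hu
  have key := lapDensity_comp (G₁ := pullbackMetric e) (G₂ := pullbackMetric e₂)
    (v₁ := u ∘ f ∘ e) (v₂ := u ∘ e₂) (τ := τ) (c := fun z => (c (e z))⁻¹) (y := y)
    (by filter_upwards [hVn] with z hz using inv_pos.2 (hc _ hz.2.1))
    (by filter_upwards [hVn] with z hz using hG z hz)
    (Eventually.of_forall fun z => pullbackMetric_symm _ _)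
    (by filter_upwards [h₂.isOpen.mem_nhds hτW.1] with z hz using h₂.pullbackMetric_det_pos hz)
    hJ (((hτ.contMDiffAt hyV).contDiffAt).of_le two_le_infty)
    (by
      filter_upwards [hO.mem_nhds hτW] with z hz
      exact (hv2.contDiffAt (hO.mem_nhds hz)).differentiableAt (by simp))
    (fun i => ((hfl i).contDiffAt (hO.mem_nhds hτW)).differentiableAt (by simp))
    (by
      filter_upwards [hVn] with z hz
      simp only [Function.comp, (hτe z hz).2])
  rw [key, laplaceBeltrami_eq, gramMatrix_eq, ← he₂, ← hτy, hG y hyV, det_conformal,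
    Real.sqrt_mul (sq_nonneg _), Real.sqrt_sq_eq_abs, abs_mul, abs_of_pos (inv_pos.2 (hc _ hyD))]
  have h3 : Real.sqrt (pullbackMetric e₂ (τ y)).det ≠ 0 :=
    (Real.sqrt_pos.2 (h₂.pullbackMetric_det_pos hτW.1)).ne'
  have h4 := (hc _ hyD).ne'
  field_simp

theorem isOpenSmoothEmbeddingOn_id : IsOpenSmoothEmbeddingOn Plane Plane (id : S → S) univ := by
  refine ⟨isOpen_univ, contMDiff_id.contMDiffOn, injOn_id _, fun x _ => ?_, rfl⟩
  rw [mfderiv_id]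
  exact Function.injective_id

/-- The Laplace-Beltrami operator in arbitrary coordinates. -/
theorem lapDensity_eq {e : Plane → S} {U : Set Plane} {W : Set S} {u : S → ℝ} {y : Plane}
    (he : IsOpenSmoothEmbeddingOn Plane Plane e U)
    (hW : IsOpen W) (hu : ContMDiffOn (𝓡 2) 𝓘(ℝ, ℝ) 2 u W) (hy : y ∈ U) (hyW : e y ∈ W) :
    lapDensity (pullbackMetric e) (u ∘ e) y =
      Real.sqrt (pullbackMetric e y).det * laplaceBeltrami u (e y) := by
  have := lapDensity_comp_conformal (f := id) (D := univ) (c := fun _ => 1) he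
    isOpenSmoothEmbeddingOn_id (fun _ _ => one_pos)
    (fun s _ u v => by rw [mfderiv_id, one_mul]; rfl) hW hu hy (mem_univ _) hyW
  simpa using this

/-- Harmonicity is conformally invariant in dimension two. -/
theorem IsHarmonicOn.comp_conformal {f : S → S'} {D : Set S}
    {c : S → ℝ} {W : Set S'} {u : S' → ℝ}
    (hf : IsOpenSmoothEmbeddingOn Plane Plane f D) (hc : ∀ s ∈ D, 0 < c s)
    (hconf : ∀ s ∈ D, ∀ u v : TangentSpace (𝓡 2) s,
      inner ℝ (mfderiv (𝓡 2) (𝓡 2) f s u) (mfderiv (𝓡 2) (𝓡 2) f s v) = c s * inner ℝ u v)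
    (hW : IsOpen W) (hu : IsHarmonicOn u W) : IsHarmonicOn (u ∘ f) (D ∩ f ⁻¹' W) := by
  refine ⟨hu.1.comp ((hf.smooth.mono inter_subset_left).of_le two_le_infty)
    fun s hs => hs.2, fun x hx => ?_⟩
  have hxx : (extChartAt (𝓡 2) x).symm (extChartAt (𝓡 2) x x) = x := extChartAt_to_inv x
  have h := lapDensity_comp_conformal (e := (extChartAt (𝓡 2) x).symm)
    (isOpenSmoothEmbeddingOn_extChartAt_symm x) hf hc hconf hW hu.1 (mem_extChartAt_target x)
    (by rw [hxx]; exact hx.1) (by rw [hxx]; exact hx.2)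
  rw [hxx, hu.2 _ hx.2, mul_zero] at h
  rw [laplaceBeltrami_eq]
  change _ * lapDensity (gramMatrix x) (u ∘ f ∘ (extChartAt (𝓡 2) x).symm) _ = 0
  rw [gramMatrix_eq, h, mul_zero]

theorem IsHarmonicOn.mdifferentiableAt {u : S → ℝ} {W : Set S} (hu : IsHarmonicOn u W)
    (hW : IsOpen W) {p : S} (hp : p ∈ W) : MDifferentiableAt (𝓡 2) 𝓘(ℝ, ℝ) u p :=
  (hu.1.contMDiffAt (hW.mem_nhds hp)).mdifferentiableAt (by simp)

/-- Surfaces have no isolated points. -/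
theorem neBot_nhdsNE (x : S) : (𝓝[≠] x).NeBot := by
  have he := isOpenSmoothEmbeddingOn_extChartAt_symm (E := Plane) (M := S) x
  have hx := mem_extChartAt_target (I := 𝓡 2) x
  have h1 : Tendsto (extChartAt (𝓡 2) x).symm (𝓝[≠] (extChartAt (𝓡 2) x x)) (𝓝[≠] x) := by
    refine tendsto_nhdsWithin_iff.2 ⟨?_, ?_⟩
    · have := (continuousAt_extChartAt_symm (I := 𝓡 2) x).tendsto
      rw [extChartAt_to_inv] at this
      exact this.mono_left nhdsWithin_le_nhds
    · filter_upwards [nhdsWithin_le_nhds (he.isOpen.mem_nhds hx), self_mem_nhdsWithin] with y hy hne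
      intro h
      exact hne (he.inj hy hx (h.trans (extChartAt_to_inv x).symm))
  exact h1.neBot

end Laplace

/-! ### Conformal maps: inverse, circulation, distances -/

section Conformal

variable {S : Type*} [MetricSpace S] [ChartedSpace (EuclideanSpace ℝ (Fin 2)) S]
  [RiemannianBundle (fun x : S => TangentSpace (𝓡 2) x)] [IsManifold (𝓡 2) ∞ S]
  [IsContMDiffRiemannianBundle (𝓡 2) ∞ (EuclideanSpace ℝ (Fin 2))
    (fun x : S => TangentSpace (𝓡 2) x)]
  {S' : Type*} [MetricSpace S'] [ChartedSpace (EuclideanSpace ℝ (Fin 2)) S']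
  [RiemannianBundle (fun x : S' => TangentSpace (𝓡 2) x)] [IsManifold (𝓡 2) ∞ S']
  [IsContMDiffRiemannianBundle (𝓡 2) ∞ (EuclideanSpace ℝ (Fin 2))
    (fun x : S' => TangentSpace (𝓡 2) x)]
  {f : S → S'} {D : Set S} {D' : Set S'} {h : S → ℝ}

namespace IsConformalBetween

theorem norm_mfderiv (hf : IsConformalBetween f D D' h) {s : S} (hs : s ∈ D)
    (u : TangentSpace (𝓡 2) s) :
    ‖mfderiv (𝓡 2) (𝓡 2) f s u‖ = h s * ‖u‖ := by
  rw [norm_eq_sqrt_real_inner, hf.conformal s hs, Real.sqrt_mul (sq_nonneg _),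
    Real.sqrt_sq (hf.factor_pos s hs).le, ← norm_eq_sqrt_real_inner]

theorem isOpenSmoothEmbeddingOn (hf : IsConformalBetween f D D' h) (hD : IsOpen D) :
    IsOpenSmoothEmbeddingOn Plane Plane f D := by
  refine ⟨hD, hf.smooth, hf.bijOn.injOn, fun s hs => ?_, rfl⟩
  rw [injective_iff_map_eq_zero]
  intro u hu
  have h1 := hf.norm_mfderiv hs u
  have h2 : ‖mfderiv (𝓡 2) (𝓡 2) f s u‖ = 0 := by
    have h3 : mfderiv (𝓡 2) (𝓡 2) f s u = (0 : TangentSpace (𝓡 2) (f s)) := hu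
    rw [h3]; exact norm_zero
  rw [h2] at h1
  have h4 : ‖u‖ = 0 := by
    rcases mul_eq_zero.1 h1.symm with h5 | h5
    · exact absurd h5 (hf.factor_pos s hs).ne'
    · exact h5
  exact norm_eq_zero.1 h4

theorem leftInvOn_mfderiv (hf : IsConformalBetween f D D' h) (hD : IsOpen D) {g : S' → S}
    (hg : LeftInvOn g f D) {s : S} (hs : s ∈ D) (v : Plane) :
    (mfderiv (𝓡 2) (𝓡 2) f s : Plane →L[ℝ] Plane)
      ((mfderiv (𝓡 2) (𝓡 2) g (f s) : Plane →L[ℝ] Plane) v) = v := by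
  have he := hf.isOpenSmoothEmbeddingOn hD
  have hgs : g (f s) = s := hg hs
  have h2 : f ∘ g =ᶠ[𝓝 (f s)] id := by
    filter_upwards [(he.isOpen_image hD subset_rfl).mem_nhds (mem_image_of_mem f hs)]
    rintro _ ⟨y, hy, rfl⟩
    simp [hg hy]
  have h3 := mfderiv_comp (I'' := 𝓡 2) (f s) (by rw [hgs]; exact he.mdifferentiableAt hs)
    ((he.contMDiffAt_of_leftInvOn hg hs).mdifferentiableAt (by simp))
  rw [h2.mfderiv_eq, mfderiv_id, hgs] at h3
  exact (DFunLike.congr_fun h3 v).symm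

/-- The inverse of a conformal map is conformal. -/
theorem inverse (hf : IsConformalBetween f D D' h) (hD : IsOpen D) {g : S' → S}
    (hg : LeftInvOn g f D) : IsConformalBetween g D' D (fun s' => (h (g s'))⁻¹) := by
  have he := hf.isOpenSmoothEmbeddingOn hD
  have hgi := he.of_leftInvOn hg
  rw [hf.bijOn.image_eq] at hgi
  have hgm : MapsTo g D' D := by
    intro s' hs'
    obtain ⟨s, hs, rfl⟩ := hf.bijOn.surjOn hs'
    rw [hg hs]; exact hs
  refine ⟨hgi.smooth, ⟨hgm, hgi.inj, fun s hs => ⟨f s, hf.bijOn.mapsTo hs, hg hs⟩⟩,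
    fun s' hs' => inv_pos.2 (hf.factor_pos _ (hgm hs')), fun s' hs' u v => ?_⟩
  obtain ⟨s, hs, rfl⟩ := hf.bijOn.surjOn hs'
  have h1 := hf.conformal s hs
    (show Plane from (mfderiv (𝓡 2) (𝓡 2) g (f s) : Plane →L[ℝ] Plane) u)
    (show Plane from (mfderiv (𝓡 2) (𝓡 2) g (f s) : Plane →L[ℝ] Plane) v)
  have hu : mfderiv (𝓡 2) (𝓡 2) f s
    (show Plane from (mfderiv (𝓡 2) (𝓡 2) g (f s) : Plane →L[ℝ] Plane) u) = u :=
    hf.leftInvOn_mfderiv hD hg hs u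
  have hv : mfderiv (𝓡 2) (𝓡 2) f s
    (show Plane from (mfderiv (𝓡 2) (𝓡 2) g (f s) : Plane →L[ℝ] Plane) v) = v :=
    hf.leftInvOn_mfderiv hD hg hs v
  rw [hu, hv] at h1
  have hgs : g (f s) = s := hg hs
  have hh := (hf.factor_pos s hs).ne'
  have h2 : ∀ p : S, p = s → metricAt p (mfderiv (𝓡 2) (𝓡 2) g (f s) u)
      (mfderiv (𝓡 2) (𝓡 2) g (f s) v) = ((h p)⁻¹) ^ 2 * inner ℝ u v := by
    rintro p rfl
    rw [h1]
    field_simp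
    rfl
  exact h2 _ hgs

/-- The circulation is conformally invariant: `f` maps the unit normal to `h` times the unit normal,
and multiplies arc lengths by `h`. -/
theorem circulation_comp (hf : IsConformalBetween f D D' h) (hD : IsOpen D) {W : Set S'}
    {u : S' → ℝ} (hu : ∀ p ∈ W, MDifferentiableAt (𝓡 2) 𝓘(ℝ, ℝ) u p) {Φ : ℂ → S} {r : ℝ}
    (hΦ : ∀ θ, MDifferentiableAt 𝓘(ℝ, ℂ) (𝓡 2) Φ (circleMap 0 r θ))
    (hΦD : ∀ θ, Φ (circleMap 0 r θ) ∈ D) (hΦW : ∀ θ, f (Φ (circleMap 0 r θ)) ∈ W) :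
    circulation (u ∘ f) Φ r = circulation u (f ∘ Φ) r := by
  unfold circulation
  congr 1
  ext θ
  set z := circleMap 0 r θ with hz
  have hfz := (hf.isOpenSmoothEmbeddingOn hD).mdifferentiableAt (hΦD θ)
  have h1 : mfderiv 𝓘(ℝ, ℂ) (𝓡 2) (f ∘ Φ) z =
      (mfderiv (𝓡 2) (𝓡 2) f (Φ z)).comp (mfderiv 𝓘(ℝ, ℂ) (𝓡 2) Φ z) :=
    mfderiv_comp z hfz (hΦ θ)
  have h2 : ∀ v : TangentSpace (𝓡 2) (Φ z), directionalDeriv (u ∘ f) (Φ z) v =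
      directionalDeriv u (f (Φ z)) (mfderiv (𝓡 2) (𝓡 2) f (Φ z) v) := fun v =>
    DFunLike.congr_fun (mfderiv_comp (Φ z) (hu _ (hΦW θ)) hfz) v
  have hh : 0 < h (Φ z) := hf.factor_pos _ (hΦD θ)
  rw [h2, h1]
  have h3 : ∀ a b : TangentSpace (𝓡 2) (Φ z),
      unitNormal (mfderiv (𝓡 2) (𝓡 2) f (Φ z) a) (mfderiv (𝓡 2) (𝓡 2) f (Φ z) b) =
      (h (Φ z))⁻¹ • mfderiv (𝓡 2) (𝓡 2) f (Φ z) (unitNormal a b) := by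
    intro a b
    unfold unitNormal
    rw [hf.conformal _ (hΦD θ), hf.conformal _ (hΦD θ),
      mul_div_mul_left _ _ (pow_ne_zero 2 hh.ne'), ← map_smul, ← map_sub, hf.norm_mfderiv (hΦD θ),
      map_smul, smul_smul, mul_inv]
  have h4 : ∀ a b : TangentSpace (𝓡 2) (Φ z),
      directionalDeriv u (f (Φ z)) (mfderiv (𝓡 2) (𝓡 2) f (Φ z) (unitNormal a b)) * ‖a‖ =
      directionalDeriv u (f (Φ z))
        (unitNormal (mfderiv (𝓡 2) (𝓡 2) f (Φ z) a) (mfderiv (𝓡 2) (𝓡 2) f (Φ z) b)) *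
        ‖mfderiv (𝓡 2) (𝓡 2) f (Φ z) a‖ := by
    intro a b
    rw [h3, hf.norm_mfderiv (hΦD θ)]
    unfold directionalDeriv
    rw [map_smul]
    have e : ∀ t : ℝ, t * ‖a‖ = ((h (Φ z))⁻¹ * t) * (h (Φ z) * ‖a‖) := fun t => by
      field_simp
    exact e (directionalDeriv u (f (Φ z)) (mfderiv (𝓡 2) (𝓡 2) f (Φ z) (unitNormal a b)))
  exact h4 (mfderiv 𝓘(ℝ, ℂ) (𝓡 2) Φ z (Complex.I * z)) (mfderiv 𝓘(ℝ, ℂ) (𝓡 2) Φ z (-z))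

/-- The conformal factor is continuous: its square is a quotient of coefficients of metrics. -/
theorem continuousAt_factor (hf : IsConformalBetween f D D' h) (hD : IsOpen D) {s : S}
    (hs : s ∈ D) : ContinuousAt h s := by
  have he := hf.isOpenSmoothEmbeddingOn hD
  have hch := isOpenSmoothEmbeddingOn_extChartAt_symm (E := Plane) (M := S) s
  set e := (extChartAt (𝓡 2) s).symm with hedef
  set y := extChartAt (𝓡 2) s s with hy
  have hes : e y = s := extChartAt_to_inv s
  have hyt : y ∈ (extChartAt (𝓡 2) s).target := mem_extChartAt_target s
  set V := (extChartAt (𝓡 2) s).target ∩ e ⁻¹' D with hV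
  have hVo : IsOpen V := hch.isOpen_inter_preimage hD
  have hyV : y ∈ V := ⟨hyt, by rw [mem_preimage, hes]; exact hs⟩
  have hfe : IsOpenSmoothEmbeddingOn Plane Plane (f ∘ e) V :=
    he.comp (hch.mono hVo inter_subset_left) fun z hz => hz.2
  have c1 := ((contDiffOn_pullbackMetric hVo hfe.smooth 0 0).continuousOn).continuousAt
    (hVo.mem_nhds hyV)
  have c2 := ((contDiffOn_pullbackMetric hVo (hch.smooth.mono inter_subset_left)
    0 0).continuousOn).continuousAt (hVo.mem_nhds hyV)
  have hpos : ∀ z ∈ V, 0 < pullbackMetric e z 0 0 := by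
    intro z hz
    refine real_inner_self_pos.2 fun h0 => ?_
    have h1 : coordDeriv e z (stdVec 0) = coordDeriv e z 0 := by rw [map_zero]; exact h0
    have h2 := congrArg (fun v : Plane => v 0) (hch.immersion z hz.1 h1)
    simp at h2
  have hq : ∀ z ∈ V, h (e z) =
      Real.sqrt (pullbackMetric (f ∘ e) z 0 0 / pullbackMetric e z 0 0) := by
    intro z hz
    have h1 : coordDeriv (f ∘ e) z (stdVec 0) =
        mfderiv (𝓡 2) (𝓡 2) f (e z) (coordDeriv e z (stdVec 0)) :=
      DFunLike.congr_fun (mfderiv_comp z (he.mdifferentiableAt hz.2)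
        (hch.mdifferentiableAt hz.1)) (stdVec 0)
    have h2 : pullbackMetric (f ∘ e) z 0 0 = h (e z) ^ 2 * pullbackMetric e z 0 0 := by
      unfold pullbackMetric
      rw [h1]; exact hf.conformal _ hz.2 _ _
    rw [h2, mul_div_cancel_right₀ _ (hpos z hz).ne', Real.sqrt_sq (hf.factor_pos _ hz.2).le]
  have c3 : ContinuousAt (fun z => h (e z)) y := by
    refine ContinuousAt.congr ?_ (by filter_upwards [hVo.mem_nhds hyV] with z hz
                                      using (hq z hz).symm)
    exact (c1.div c2 (hpos y hyV).ne').sqrt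
  have c4 : ContinuousAt (extChartAt (𝓡 2) s) s := continuousAt_extChartAt s
  have c5 : ContinuousAt (fun p => h (e (extChartAt (𝓡 2) s p))) s :=
    ContinuousAt.comp (g := fun z => h (e z)) c3 c4
  refine c5.congr ?_
  filter_upwards [extChartAt_source_mem_nhds (I := 𝓡 2) s] with p hp
  rw [hedef, (extChartAt (𝓡 2) s).left_inv hp]

variable [IsRiemannianManifold (𝓡 2) S] [IsRiemannianManifold (𝓡 2) S']

/-- A nearly shortest path from `s₀` to `s` stays close to `s₀`, where `f` stretches lengths by at
most a factor close to `h s₀`. -/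
theorem eventually_dist_le (hf : IsConformalBetween f D D' h) (hD : IsOpen D) {s₀ : S}
    (hs₀ : s₀ ∈ D) {C : ℝ} (hC : h s₀ < C) :
    ∀ᶠ s in 𝓝 s₀, dist (f s₀) (f s) ≤ C * dist s₀ s := by
  have he := hf.isOpenSmoothEmbeddingOn hD
  have h0 := hf.factor_pos s₀ hs₀
  -- `C / C'` leaves room for a path longer than the distance, `C'` bounds the stretching of lengths
  obtain ⟨C', hC', hC'C⟩ := exists_between hC
  have hC'0 : 0 < C' := h0.trans hC'
  have hC0 : 0 < C := hC'0.trans hC'C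
  obtain ⟨ρ, hρ, hball⟩ := Metric.mem_nhds_iff.1
    (Filter.inter_mem (hD.mem_nhds hs₀) ((hf.continuousAt_factor hD hs₀).eventually_lt_const hC'))
  filter_upwards [Metric.ball_mem_nhds s₀ (mul_pos hρ (div_pos hC'0 hC0))] with s hs
  rcases eq_or_ne s s₀ with rfl | hne
  · simp
  have hd : 0 < dist s₀ s := dist_pos.2 hne.symm
  have hr : dist s₀ s * (C / C') < ρ := by
    rw [Metric.mem_ball, dist_comm] at hs
    calc dist s₀ s * (C / C') < ρ * (C' / C) * (C / C') := by gcongr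
      _ = ρ := by field_simp
  have hr2 : dist s₀ s < dist s₀ s * (C / C') := by
    have : 1 < C / C' := (one_lt_div hC'0).2 hC'C
    nlinarith
  have hed : Manifold.riemannianEDist (𝓡 2) s₀ s < ENNReal.ofReal (dist s₀ s * (C / C')) := by
    rw [← IsRiemannianManifold.out (I := 𝓡 2) s₀ s, edist_dist]
    exact (ENNReal.ofReal_lt_ofReal_iff (by positivity)).2 hr2
  obtain ⟨γ, γ0, γ1, hγ, hlen, -, -⟩ :=
    Manifold.exists_lt_locally_constant_of_riemannianEDist_lt hed zero_lt_one
  have hmem : ∀ t ∈ Icc (0 : ℝ) 1, γ t ∈ Metric.ball s₀ ρ := by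
    intro t ht
    have h1 : edist s₀ (γ t) < ENNReal.ofReal ρ := by
      calc edist s₀ (γ t) = Manifold.riemannianEDist (𝓡 2) s₀ (γ t) :=
            IsRiemannianManifold.out _ _
        _ ≤ Manifold.pathELength (𝓡 2) γ 0 t :=
            Manifold.riemannianEDist_le_pathELength hγ.contMDiffOn γ0 rfl ht.1
        _ ≤ Manifold.pathELength (𝓡 2) γ 0 1 := Manifold.pathELength_mono le_rfl ht.2
        _ < ENNReal.ofReal (dist s₀ s * (C / C')) := hlen
        _ ≤ ENNReal.ofReal ρ := ENNReal.ofReal_le_ofReal hr.le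
    rw [Metric.mem_ball, dist_comm]
    rw [edist_dist] at h1
    exact (ENNReal.ofReal_lt_ofReal_iff hρ).1 h1
  have hle : Manifold.pathELength (𝓡 2) (f ∘ γ) 0 1 ≤
      ENNReal.ofReal C' * Manifold.pathELength (𝓡 2) γ 0 1 := by
    rw [Manifold.pathELength_eq_lintegral_mfderiv_Icc,
      Manifold.pathELength_eq_lintegral_mfderiv_Icc, ← lintegral_const_mul' _ _ (by simp)]
    refine setLIntegral_mono' measurableSet_Icc fun t ht => ?_
    have hb := hball (hmem t ht)
    have h1 : mfderiv 𝓘(ℝ, ℝ) (𝓡 2) (f ∘ γ) t =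
        (mfderiv (𝓡 2) (𝓡 2) f (γ t)).comp (mfderiv 𝓘(ℝ, ℝ) (𝓡 2) γ t) :=
      mfderiv_comp t (he.mdifferentiableAt hb.1) ((hγ t).mdifferentiableAt (by simp))
    rw [h1, ContinuousLinearMap.comp_apply]
    have h2 : ∀ v : TangentSpace (𝓡 2) (γ t), ‖mfderiv (𝓡 2) (𝓡 2) f (γ t) v‖ₑ ≤
        ENNReal.ofReal C' * ‖v‖ₑ := by
      intro v
      rw [← ofReal_norm, ← ofReal_norm, ← ENNReal.ofReal_mul hC'0.le, hf.norm_mfderiv hb.1]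
      exact ENNReal.ofReal_le_ofReal
        (mul_le_mul_of_nonneg_right (le_of_lt hb.2) (norm_nonneg _))
    exact h2 _
  have hfin : edist (f s₀) (f s) ≤ ENNReal.ofReal (C * dist s₀ s) := by
    calc edist (f s₀) (f s) = Manifold.riemannianEDist (𝓡 2) (f s₀) (f s) :=
          IsRiemannianManifold.out _ _
      _ ≤ Manifold.pathELength (𝓡 2) (f ∘ γ) 0 1 := by
          refine Manifold.riemannianEDist_le_pathELength ?_ (by simp [γ0]) (by simp [γ1])
            zero_le_one
          exact (hf.smooth.of_le (by simp)).comp hγ.contMDiffOn fun t ht => (hball (hmem t ht)).1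
      _ ≤ ENNReal.ofReal C' * Manifold.pathELength (𝓡 2) γ 0 1 := hle
      _ ≤ ENNReal.ofReal C' * ENNReal.ofReal (dist s₀ s * (C / C')) := by gcongr
      _ = ENNReal.ofReal (C * dist s₀ s) := by
          rw [← ENNReal.ofReal_mul hC'0.le]; congr 1; field_simp
  rw [edist_dist] at hfin
  exact (ENNReal.ofReal_le_ofReal_iff (by positivity)).1 hfin

/-- The conformal factor is the infinitesimal ratio of the geodesic distances. -/
theorem tendsto_dist_div_dist (hf : IsConformalBetween f D D' h) (hD : IsOpen D) {s₀ : S}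
    (hs₀ : s₀ ∈ D) :
    Tendsto (fun s => dist (f s) (f s₀) / dist s s₀) (𝓝[≠] s₀) (𝓝 (h s₀)) := by
  have he := hf.isOpenSmoothEmbeddingOn hD
  have h0 := hf.factor_pos s₀ hs₀
  have : Nonempty S := ⟨s₀⟩
  set g := Function.invFunOn f D
  have hg : LeftInvOn g f D := he.inj.leftInvOn_invFunOn
  have hD' : IsOpen D' := by
    rw [← hf.bijOn.image_eq]; exact he.isOpen_image hD subset_rfl
  have hgc := hf.inverse hD hg
  have hgs : g (f s₀) = s₀ := hg hs₀
  rw [tendsto_order]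
  constructor
  -- the lower bound is the upper bound for the inverse map
  · intro a ha
    obtain ⟨b, hab, hb⟩ := exists_between (max_lt ha h0)
    have hb0 : 0 < b := (le_max_right _ _).trans_lt hab
    have h1 : (h (g (f s₀)))⁻¹ < b⁻¹ := by
      rw [hgs]; exact inv_strictAnti₀ hb0 hb
    have h2 := hgc.eventually_dist_le hD' (hf.bijOn.mapsTo hs₀) h1
    have h3 := (he.contMDiffAt hs₀).continuousAt.eventually h2
    filter_upwards [h3.filter_mono nhdsWithin_le_nhds,
      (hD.eventually_mem hs₀).filter_mono nhdsWithin_le_nhds, self_mem_nhdsWithin] with s h4 h5 h6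
    have hd : 0 < dist s s₀ := dist_pos.2 h6
    rw [hgs, hg h5, dist_comm, dist_comm (f s₀)] at h4
    rw [lt_div_iff₀ hd]
    have h7 : b * dist s s₀ ≤ dist (f s) (f s₀) := by
      rwa [← div_eq_inv_mul, le_div_iff₀ hb0, mul_comm] at h4
    have h8 : a < b := (le_max_left _ _).trans_lt hab
    nlinarith
  · intro a ha
    obtain ⟨b, hb, hab⟩ := exists_between ha
    filter_upwards [(hf.eventually_dist_le hD hs₀ hb).filter_mono nhdsWithin_le_nhds,
      self_mem_nhdsWithin] with s h4 h6
    have hd : 0 < dist s s₀ := dist_pos.2 h6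
    rw [dist_comm, dist_comm s₀] at h4
    rw [div_lt_iff₀ hd]
    nlinarith

end IsConformalBetween

end Conformal

/-! ### The ends of a Jordan domain -/

section Ends

theorem isOpen_annulus (a b : ℝ) : IsOpen (annulus a b) :=
  (isOpen_lt continuous_const continuous_norm).inter (isOpen_lt continuous_norm continuous_const)

theorem isPreconnected_annulus {a b : ℝ} (ha : 0 ≤ a) : IsPreconnected (annulus a b) := by
  have h : annulus a b = (fun p : ℝ × ℝ => circleMap 0 p.1 p.2) '' (Ioo a b ×ˢ univ) := by
    ext z
    constructor
    · intro hz
      refine ⟨(‖z‖, z.arg), ⟨hz, mem_univ _⟩, ?_⟩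
      simp [circleMap]
    · rintro ⟨⟨r, θ⟩, ⟨hr, -⟩, rfl⟩
      simp only [annulus, mem_ofPred_eq, norm_circleMap_zero, abs_of_pos (ha.trans_lt hr.1)]
      exact hr
  rw [h]
  refine (isPreconnected_Ioo.prod isPreconnected_univ).image _ (Continuous.continuousOn ?_)
  simp only [circleMap]
  fun_prop

theorem circleMap_mem_annulus {a b r : ℝ} (ha : 0 ≤ a) (hr : a < r) (hrb : r < b) (θ : ℝ) :
    circleMap 0 r θ ∈ annulus a b := by
  simp [annulus, abs_of_pos (ha.trans_lt hr), hr, hrb]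

/-- The annuli `1 < ‖z‖ < r`, `r > 1`, are a basis of the neighbourhoods of the unit circle within
the exterior of the unit disc. -/
theorem comap_norm_nhdsGT_one :
    comap (fun z : ℂ => ‖z‖) (𝓝[>] 1) = 𝓝ˢ (Metric.sphere (0 : ℂ) 1) ⊓ 𝓟 {z | 1 < ‖z‖} := by
  have h1 : (fun z : ℂ => ‖z‖) ⁻¹' {1} = Metric.sphere (0 : ℂ) 1 := by
    ext z; simp
  have h2 : IsClosedMap (fun z : ℂ => ‖z‖) := by
    have : IsProperMap (fun z : ℂ => ‖z‖) :=
      isProperMap_iff_tendsto_cocompact.2 ⟨continuous_norm, by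
        rw [← Metric.cobounded_eq_cocompact]
        exact (tendsto_norm_cobounded_atTop (E := ℂ)).mono_right atTop_le_cocompact⟩
    exact this.isClosedMap
  rw [nhdsWithin, comap_inf, comap_principal,
    h2.comap_nhds_eq continuous_norm, h1]
  rfl

section Filters

variable {X : Type*} [TopologicalSpace X]

/-- The filter of neighbourhoods of `C` within `D`, for a boundary component `C` of `D` an end
of `D`. -/
def endFilter (D C : Set X) : Filter X := 𝓝ˢ C ⊓ 𝓟 D

variable {D C : Set X}

theorem mem_endFilter {O : Set X} :
    O ∈ endFilter D C ↔ ∀ x ∈ C, O ∈ 𝓝[D] x := by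
  rw [endFilter, mem_inf_principal, mem_nhdsSet_iff_forall]
  simp only [mem_nhdsWithin_iff_eventually]
  rfl

theorem mem_endFilter_self : D ∈ endFilter D C := mem_inf_of_right (mem_principal_self D)

end Filters

theorem hasBoundaryValue_iff {S : Type*} [MetricSpace S] {D C : Set S} {ψ : S → ℝ} {b : ℝ} :
    HasBoundaryValue D ψ C b ↔ Tendsto ψ (endFilter D C) (𝓝 b) := by
  constructor
  · intro h O hO
    exact mem_endFilter.2 fun x hx => h x hx hO
  · intro h x hx O hO
    exact mem_endFilter.1 (h hO) x hx

variable {S : Type*} [MetricSpace S] [ChartedSpace (EuclideanSpace ℝ (Fin 2)) S]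
  [IsManifold (𝓡 2) ∞ S] {D : Set S}

theorem boundaryComponent_subset {C : Set S} (hC : C ∈ boundaryComponents D) :
    C ⊆ frontier D := by
  obtain ⟨x, -, rfl⟩ := hC
  exact connectedComponentIn_subset _ _

theorem boundaryComponent_nonempty {C : Set S} (hC : C ∈ boundaryComponents D) : C.Nonempty := by
  obtain ⟨x, hx, rfl⟩ := hC
  exact ⟨x, mem_connectedComponentIn hx⟩

theorem boundaryComponents_eq_of_mem {C C' : Set S} (hC : C ∈ boundaryComponents D)
    (hC' : C' ∈ boundaryComponents D) {x : S} (hx : x ∈ C) (hx' : x ∈ C') : C = C' := by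
  obtain ⟨y, -, rfl⟩ := hC
  obtain ⟨y', -, rfl⟩ := hC'
  rw [connectedComponentIn_eq hx, connectedComponentIn_eq hx']

theorem exists_boundaryComponent {x : S} (hx : x ∈ frontier D) :
    ∃ C : boundaryComponents D, x ∈ (C : Set S) :=
  ⟨⟨_, x, hx, rfl⟩, mem_connectedComponentIn hx⟩

theorem endFilter_neBot {C : Set S} (hC : C ∈ boundaryComponents D) : (endFilter D C).NeBot := by
  obtain ⟨x, hx⟩ := boundaryComponent_nonempty hC
  have h1 : (𝓝[D] x).NeBot :=
    mem_closure_iff_nhdsWithin_neBot.1 (frontier_subset_closure (boundaryComponent_subset hC hx))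
  exact h1.mono fun O hO => mem_endFilter.1 hO x hx

theorem finrank_complex_plane : Module.finrank ℝ ℂ = Module.finrank ℝ Plane := by
  simp [Complex.finrank_real_complex]

theorem IsAnnularChart.isOpenSmoothEmbeddingOn {Φ : ℂ → S} {a b : ℝ} (h : IsAnnularChart Φ a b) :
    IsOpenSmoothEmbeddingOn ℂ Plane Φ (annulus a b) :=
  ⟨isOpen_annulus a b, h.smooth, h.inj, h.immersion, finrank_complex_plane⟩

theorem IsAnnularChart.mono {Φ : ℂ → S} {a b a' b' : ℝ} (h : IsAnnularChart Φ a b) (ha : a ≤ a')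
    (hb : b' ≤ b) : IsAnnularChart Φ a' b' := by
  have hs : annulus a' b' ⊆ annulus a b := fun z hz => ⟨ha.trans_lt hz.1, hz.2.trans_le hb⟩
  exact ⟨h.smooth.mono hs, h.inj.mono hs, fun z hz => h.immersion z (hs hz)⟩

/-- A two-sided annular neighbourhood of a boundary component contains one-sided collars. -/
theorem IsAnnularChart.isCollar {C : Set S} {Φ : ℂ → S} (h : IsAnnularChart Φ (1 / 2) 2)
    (hC : Φ '' Metric.sphere (0 : ℂ) 1 = C) (hD : ∀ z ∈ annulus (1 / 2) 2, (Φ z ∈ D ↔ 1 < ‖z‖))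
    {R : ℝ} (hR : 1 < R) (hR2 : R ≤ 2) : IsCollar D C Φ R := by
  refine ⟨hR, h.mono (by norm_num) hR2, fun z hz =>
    (hD z ⟨by linarith [hz.1], hz.2.trans_le hR2⟩).2 hz.1, ?_⟩
  have hsub : Metric.sphere (0 : ℂ) 1 ⊆ annulus (1 / 2) 2 := by
    intro z hz
    rw [mem_sphere_zero_iff_norm] at hz
    constructor <;> rw [hz] <;> norm_num
  have hmap : ∀ V : Set ℂ, V ∈ 𝓝ˢ (Metric.sphere (0 : ℂ) 1) → Φ '' V ∈ 𝓝ˢ C := by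
    intro V hV
    rw [mem_nhdsSet_iff_forall] at hV ⊢
    rw [← hC]
    rintro _ ⟨z, hz, rfl⟩
    rw [← h.isOpenSmoothEmbeddingOn.map_nhds_eq (hsub hz)]
    exact image_mem_map (hV z hz)
  have hann : annulus (1 / 2) 2 ∈ 𝓝ˢ (Metric.sphere (0 : ℂ) 1) :=
    (isOpen_annulus _ _).mem_nhdsSet.2 hsub
  rw [comap_norm_nhdsGT_one]
  refine le_antisymm (le_inf ?_ ?_) ?_
  · intro O hO
    refine mem_inf_of_left (mem_nhdsSet_iff_forall.2 fun z hz => ?_)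
    refine (h.isOpenSmoothEmbeddingOn.contMDiffAt (hsub hz)).continuousAt ?_
    rw [← hC] at hO
    exact mem_nhdsSet_iff_forall.1 hO _ (mem_image_of_mem Φ hz)
  · rw [le_principal_iff, mem_map, mem_inf_principal]
    filter_upwards [hann] with z hz h1 using (hD z hz).2 h1
  · intro V hV
    rw [mem_map, mem_inf_principal] at hV
    rw [mem_inf_principal]
    filter_upwards [hmap _ (inter_mem hV hann)]
    rintro _ ⟨z, ⟨hzV, hz⟩, rfl⟩ hzD
    exact hzV ((hD z hz).1 hzD)

/-- Every neighbourhood of a boundary component within `D` contains a connected one. -/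
theorem IsCollar.exists_preconnected {C : Set S} {Φ : ℂ → S} {R : ℝ} (h : IsCollar D C Φ R)
    {O : Set S} (hO : O ∈ endFilter D C) :
    ∃ Q ∈ endFilter D C, Q ⊆ O ∩ D ∧ IsPreconnected Q := by
  rw [endFilter, ← h.map_end, mem_map, ((nhdsGT_basis (1 : ℝ)).comap _).mem_iff] at hO
  obtain ⟨r, hr, hsub⟩ := hO
  have h1 : annulus 1 (min r R) ⊆ annulus 1 R := fun z hz =>
    ⟨hz.1, hz.2.trans_le (min_le_right _ _)⟩
  refine ⟨Φ '' annulus 1 (min r R), ?_, ?_, ?_⟩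
  · rw [endFilter, ← h.map_end]
    refine image_mem_map (((nhdsGT_basis (1 : ℝ)).comap _).mem_of_mem
      (i := min r R) (lt_min hr h.one_lt))
  · rintro _ ⟨z, hz, rfl⟩
    exact ⟨hsub ⟨hz.1, hz.2.trans_le (min_le_left _ _)⟩, h.mapsTo (h1 hz)⟩
  · exact (isPreconnected_annulus zero_le_one).image _ (h.chart.smooth.continuousOn.mono h1)

namespace IsJordanDomain

theorem exists_collar (hD : IsJordanDomain D) (C : boundaryComponents D) :
    ∃ (Φ : ℂ → S) (R : ℝ), IsCollar D C Φ R := by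
  obtain ⟨Φ, h1, h2, h3⟩ := hD.circle C C.2
  exact ⟨Φ, 2, h1.isCollar h2 h3 one_lt_two le_rfl⟩

theorem isCompact_boundaryComponent (hD : IsJordanDomain D) (C : boundaryComponents D) :
    IsCompact (C : Set S) := by
  obtain ⟨Φ, h1, h2, -⟩ := hD.circle C C.2
  rw [← h2]
  refine (isCompact_sphere _ _).image_of_continuousOn (h1.smooth.continuousOn.mono fun z hz => ?_)
  rw [mem_sphere_zero_iff_norm] at hz
  constructor <;> rw [hz] <;> norm_num

theorem disjoint_nhdsSet (hD : IsJordanDomain D) {C C' : boundaryComponents D} (h : C ≠ C') :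
    Disjoint (𝓝ˢ (C : Set S)) (𝓝ˢ (C' : Set S)) := by
  refine separatedNhds_iff_disjoint.1 (SeparatedNhds.of_isCompact_isCompact
    (hD.isCompact_boundaryComponent C) (hD.isCompact_boundaryComponent C') ?_)
  exact disjoint_left.2 fun x hx hx' =>
    h (Subtype.ext (boundaryComponents_eq_of_mem C.2 C'.2 hx hx'))

variable [CompactSpace S]

/-- A set that belongs to the filters of all the ends of `D` is co-compact in `D`. -/
theorem _root_.exists_isCompact_of_mem_endFilter {O : Set S}
    (hO : ∀ C : boundaryComponents D, O ∈ endFilter D (C : Set S)) :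
    ∃ K ⊆ D, IsCompact K ∧ D \ O ⊆ K := by
  have h1 : {x | x ∈ D → x ∈ O} ∈ 𝓝ˢ (frontier D) := by
    rw [mem_nhdsSet_iff_forall]
    intro x hx
    obtain ⟨C, hC⟩ := exists_boundaryComponent hx
    have := hO C
    rw [endFilter, mem_inf_principal, mem_nhdsSet_iff_forall] at this
    exact this x hC
  obtain ⟨N, hN, hfN, hNO⟩ := mem_nhdsSet_iff_exists.1 h1
  refine ⟨closure D \ N, ?_, (isClosed_closure.sdiff hN).isCompact, ?_⟩
  · rintro x ⟨hx, hxN⟩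
    by_contra hxD
    exact hxN (hfN ⟨hx, fun h => hxD (interior_subset h)⟩)
  · rintro x ⟨hx, hxO⟩
    exact ⟨subset_closure hx, fun hxN => hxO (hNO hxN hx)⟩

theorem compl_mem_endFilter (hD : IsJordanDomain D) {K : Set S} (hK : IsCompact K) (hKD : K ⊆ D)
    (C : boundaryComponents D) : Kᶜ ∈ endFilter D (C : Set S) := by
  refine mem_inf_of_left (hK.isClosed.isOpen_compl.mem_nhdsSet.2 fun x hx hxK => ?_)
  have := boundaryComponent_subset C.2 hx
  rw [hD.isOpen.frontier_eq] at this
  exact this.2 (hKD hxK)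

variable {S' : Type*} [MetricSpace S'] [ChartedSpace (EuclideanSpace ℝ (Fin 2)) S']
  [IsManifold (𝓡 2) ∞ S'] [CompactSpace S'] {D' : Set S'} {f : S → S'} {g : S' → S}

theorem eq_of_endFilter_le (hD : IsJordanDomain D) {C C' : boundaryComponents D}
    (h : endFilter D (C : Set S) ≤ endFilter D (C' : Set S)) : C = C' := by
  by_contra hne
  have := endFilter_neBot C.2
  have h1 : endFilter D (C : Set S) ≤ ⊥ := by
    rw [← (hD.disjoint_nhdsSet hne).eq_bot]
    exact le_inf inf_le_left (h.trans inf_le_left)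
  exact this.ne (le_bot_iff.1 h1)

/-- A homeomorphism of Jordan domains maps ends to ends, since the ends have connected
neighbourhoods. -/
theorem exists_tendsto_endFilter (hD : IsJordanDomain D) (hD' : IsJordanDomain D')
    (hf : ContinuousOn f D) (hg : ContinuousOn g D') (hfm : MapsTo f D D') (hgm : MapsTo g D' D)
    (hgf : LeftInvOn g f D) (C : boundaryComponents D) :
    ∃ C' : boundaryComponents D',
      Tendsto f (endFilter D (C : Set S)) (endFilter D' (C' : Set S')) := by
  have hproper : ∀ K ⊆ D', IsCompact K → ∀ᶠ s in endFilter D (C : Set S), f s ∉ K := by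
    intro K hK hKc
    have h1 : IsCompact (g '' K) := hKc.image_of_continuousOn (hg.mono hK)
    filter_upwards [hD.compl_mem_endFilter h1 ((hgm.mono_left hK).image_subset) C,
      mem_endFilter_self] with s hs hsD hsK
    exact hs ⟨f s, hsK, hgf hsD⟩
  have hfin : Finite (boundaryComponents D') := hD'.finite.to_subtype
  -- disjoint neighbourhoods of the boundary components of `D'`
  have hdis : Pairwise (Function.onFun Disjoint
      fun C' : boundaryComponents D' => 𝓝ˢ (C' : Set S')) :=
    fun C₁ C₂ h => hD'.disjoint_nhdsSet h
  obtain ⟨N, hN, hNd⟩ := hdis.exists_mem_filter_of_disjoint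
  have hM0 := fun C' : boundaryComponents D' => mem_nhdsSet_iff_exists.1 (hN C')
  choose M hM using hM0
  have hMn : ∀ C' : boundaryComponents D', M C' ∈ endFilter D' (C' : Set S') := fun C' =>
    mem_inf_of_left ((hM C').1.mem_nhdsSet.2 (hM C').2.1)
  have hMd : ∀ C₁ C₂ : boundaryComponents D', C₁ ≠ C₂ → Disjoint (M C₁) (M C₂) := fun C₁ C₂ h =>
    (hNd h).mono (hM C₁).2.2 (hM C₂).2.2
  obtain ⟨K, hK, hKc, hKM⟩ := exists_isCompact_of_mem_endFilter (O := ⋃ C', M C')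
    fun C' => mem_of_superset (hMn C') (subset_iUnion M C')
  -- near `C`, the values of `f` lie in the union of these neighbourhoods; a connected neighbourhood
  -- of `C` is mapped into a single one
  obtain ⟨Φ, R, hΦ⟩ := hD.exists_collar C
  obtain ⟨Q, hQ, hQK, hQc⟩ := hΦ.exists_preconnected (hproper K hK hKc)
  have hfQ : IsPreconnected (f '' Q) := hQc.image _ (hf.mono fun s hs => (hQK hs).2)
  have hfQM : f '' Q ⊆ ⋃ C', M C' := by
    rintro _ ⟨s, hs, rfl⟩
    by_contra hn
    exact (hQK hs).1 (hKM ⟨hfm (hQK hs).2, hn⟩)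
  have := endFilter_neBot C.2
  obtain ⟨q, hq⟩ := Filter.nonempty_of_mem hQ
  obtain ⟨C', hC'⟩ := mem_iUnion.1 (hfQM (mem_image_of_mem f hq))
  have hfQC : f '' Q ⊆ M C' := by
    refine hfQ.subset_left_of_subset_union (v := ⋃ C'' ∈ {C'' | C'' ≠ C'}, M C'') (hM C').1
      (isOpen_biUnion fun C'' _ => (hM C'').1) ?_ ?_ ⟨_, mem_image_of_mem f hq, hC'⟩
    · rw [disjoint_iUnion₂_right]
      exact fun C'' h => hMd _ _ (Ne.symm h)
    · intro x hx
      obtain ⟨C'', h⟩ := mem_iUnion.1 (hfQM hx)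
      by_cases hc : C'' = C'
      · left; rwa [← hc]
      · right; exact mem_biUnion hc h
  refine ⟨C', fun O hO => ?_⟩
  -- `f` tends to the corresponding end, since it is proper
  have hO' : ∀ C'' : boundaryComponents D',
      O ∪ ⋃ C'' ∈ {C'' | C'' ≠ C'}, M C'' ∈ endFilter D' (C'' : Set S') := by
    intro C''
    by_cases hc : C'' = C'
    · rw [hc]; exact mem_of_superset hO subset_union_left
    · exact mem_of_superset (hMn C'') fun x hx => Or.inr (mem_biUnion hc hx)
  obtain ⟨K', hK', hKc', hKM'⟩ := exists_isCompact_of_mem_endFilter hO'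
  rw [mem_map]
  filter_upwards [hQ, hproper K' hK' hKc', mem_endFilter_self] with s h1 h2 h3
  by_contra hn
  refine h2 (hKM' ⟨hfm h3, fun h => h.elim hn fun h4 => ?_⟩)
  obtain ⟨C'', hc, h5⟩ := mem_iUnion₂.1 h4
  exact disjoint_left.1 (hMd C'' C' hc) h5 (hfQC (mem_image_of_mem f h1))

/-- The correspondence of boundary components induced by a homeomorphism of Jordan domains. -/
theorem exists_boundary_equiv (hD : IsJordanDomain D) (hD' : IsJordanDomain D')
    (hf : ContinuousOn f D) (hg : ContinuousOn g D') (hfm : MapsTo f D D') (hgm : MapsTo g D' D)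
    (hgf : LeftInvOn g f D) (hfg : LeftInvOn f g D') :
    ∃ σ : boundaryComponents D ≃ boundaryComponents D',
      (∀ C : boundaryComponents D,
        Tendsto f (endFilter D (C : Set S)) (endFilter D' (σ C : Set S'))) ∧
      ∀ C' : boundaryComponents D',
        Tendsto g (endFilter D' (C' : Set S')) (endFilter D (σ.symm C' : Set S)) := by
  choose σ hσ using hD.exists_tendsto_endFilter hD' hf hg hfm hgm hgf
  choose σ' hσ' using hD'.exists_tendsto_endFilter hD hg hf hgm hfm hfg
  refine ⟨⟨σ, σ', fun C => (hD.eq_of_endFilter_le ?_).symm,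
    fun C' => (hD'.eq_of_endFilter_le ?_).symm⟩, hσ, hσ'⟩
  · have h1 := (hσ' (σ C)).comp (hσ C)
    have h2 : g ∘ f =ᶠ[endFilter D (C : Set S)] id := by
      filter_upwards [mem_endFilter_self] with s hs using hgf hs
    exact (tendsto_congr' h2).1 h1
  · have h1 := (hσ (σ' C')).comp (hσ' C')
    have h2 : f ∘ g =ᶠ[endFilter D' (C' : Set S')] id := by
      filter_upwards [mem_endFilter_self] with s hs using hfg hs
    exact (tendsto_congr' h2).1 h1

end IsJordanDomain

end Ends

/-! ### Pulling back hydrodynamical Green functions -/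

section Pullback

variable {S : Type*} [MetricSpace S] [ChartedSpace (EuclideanSpace ℝ (Fin 2)) S]
  [RiemannianBundle (fun x : S => TangentSpace (𝓡 2) x)] [IsManifold (𝓡 2) ∞ S]
  [IsContMDiffRiemannianBundle (𝓡 2) ∞ (EuclideanSpace ℝ (Fin 2))
    (fun x : S => TangentSpace (𝓡 2) x)] [IsRiemannianManifold (𝓡 2) S]
  {S' : Type*} [MetricSpace S'] [ChartedSpace (EuclideanSpace ℝ (Fin 2)) S']
  [RiemannianBundle (fun x : S' => TangentSpace (𝓡 2) x)] [IsManifold (𝓡 2) ∞ S']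
  [IsContMDiffRiemannianBundle (𝓡 2) ∞ (EuclideanSpace ℝ (Fin 2))
    (fun x : S' => TangentSpace (𝓡 2) x)] [IsRiemannianManifold (𝓡 2) S']
  {f : S → S'} {D : Set S} {D' : Set S'} {h : S → ℝ}

theorem IsConformalBetween.tendsto_punctured (hf : IsConformalBetween f D D' h) (hD : IsOpen D)
    {s₀ : S} (hs₀ : s₀ ∈ D) : Tendsto f (𝓝[≠] s₀) (𝓝[≠] (f s₀)) := by
  have he := hf.isOpenSmoothEmbeddingOn hD
  refine tendsto_nhdsWithin_iff.2
    ⟨(he.contMDiffAt hs₀).continuousAt.tendsto.mono_left nhdsWithin_le_nhds, ?_⟩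
  filter_upwards [nhdsWithin_le_nhds (hD.mem_nhds hs₀), self_mem_nhdsWithin] with s hs hne
  exact fun h => hne (hf.bijOn.injOn hs hs₀ h)

/-- The singularity of the pull-back of a Green function: the ratio of the two distances tends to
the conformal factor. -/
theorem IsConformalBetween.tendsto_subtractedGreen (hf : IsConformalBetween f D D' h)
    (hD : IsOpen D) {s₀ : S} (hs₀ : s₀ ∈ D) {G' : S' → S' → ℝ} {ρ : ℝ}
    (hρ : Tendsto (subtractedGreen G' (f s₀)) (𝓝[≠] (f s₀)) (𝓝 ρ)) :
    Tendsto (subtractedGreen (fun s s₀ => G' (f s) (f s₀)) s₀) (𝓝[≠] s₀)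
      (𝓝 (ρ + Real.log (h s₀) / (2 * Real.pi))) := by
  have h1 := hρ.comp (hf.tendsto_punctured hD hs₀)
  have h2 := ((hf.tendsto_dist_div_dist hD hs₀).log (hf.factor_pos s₀ hs₀).ne').div_const
    (2 * Real.pi)
  refine (h1.add h2).congr' ?_
  filter_upwards [nhdsWithin_le_nhds (hD.mem_nhds hs₀), self_mem_nhdsWithin] with s hs hne
  have h3 : dist s s₀ ≠ 0 := (dist_pos.2 hne).ne'
  have h4 : dist (f s) (f s₀) ≠ 0 :=
    (dist_pos.2 fun h => hne (hf.bijOn.injOn hs hs₀ h)).ne'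
  simp only [subtractedGreen, Function.comp, Real.log_div h4 h3]
  ring

/-- A diffeomorphism that carries the end `C` to the end `C'` carries collars to collars. -/
theorem IsCollar.comp {C : Set S} {C' : Set S'} {g : S' → S} {Φ : ℂ → S} {R : ℝ}
    (hΦ : IsCollar D C Φ R)
    (hf : IsOpenSmoothEmbeddingOn Plane Plane f D) (hfm : MapsTo f D D')
    (hfg : LeftInvOn f g D')
    (hfe : Tendsto f (endFilter D C) (endFilter D' C'))
    (hge : Tendsto g (endFilter D' C') (endFilter D C)) : IsCollar D' C' (f ∘ Φ) R := by
  have he := hf.comp hΦ.chart.isOpenSmoothEmbeddingOn hΦ.mapsTo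
  refine ⟨hΦ.one_lt, ⟨he.smooth, he.inj, he.immersion⟩, hfm.comp hΦ.mapsTo, ?_⟩
  rw [← Filter.map_map, hΦ.map_end]
  refine le_antisymm hfe ?_
  calc endFilter D' C' = Filter.map (fun x => f (g x)) (endFilter D' C') := by
        conv_lhs => rw [← Filter.map_id (f := endFilter D' C')]
        refine Filter.map_congr ?_
        filter_upwards [mem_endFilter_self] with x hx using (hfg hx).symm
    _ = Filter.map f (Filter.map g (endFilter D' C')) := rfl
    _ ≤ Filter.map f (endFilter D C) := Filter.map_mono hge

/-- Conformal maps pull back hydrodynamical Green functions. -/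
theorem IsHydrodynamicalGreen.comp_conformal (hf : IsConformalBetween f D D' h) (hD : IsOpen D)
    {g : S' → S} (hfg : LeftInvOn f g D') (σ : boundaryComponents D ≃ boundaryComponents D')
    (hσ : ∀ C : boundaryComponents D,
      Tendsto f (endFilter D (C : Set S)) (endFilter D' (σ C : Set S')))
    (hσ' : ∀ C' : boundaryComponents D',
      Tendsto g (endFilter D' (C' : Set S')) (endFilter D (σ.symm C' : Set S)))
    {γ' : boundaryComponents D' → ℝ} {G' : S' → S' → ℝ} (hG : IsHydrodynamicalGreen D' γ' G') :
    IsHydrodynamicalGreen D (fun C => γ' (σ C)) (fun s s₀ => G' (f s) (f s₀)) := by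
  have he := hf.isOpenSmoothEmbeddingOn hD
  have hfm := hf.bijOn.mapsTo
  have hD' : IsOpen D' := by
    rw [← hf.bijOn.image_eq]; exact he.isOpen_image hD subset_rfl
  have hW : ∀ p : S', IsOpen (D' \ {p}) := fun p => hD'.sdiff isClosed_singleton
  refine ⟨fun s₀ hs₀ => ?_, fun s₀ hs₀ => ?_, fun s hs s₀ hs₀ hne => ?_, fun s₀ hs₀ C => ?_,
    fun s₀ hs₀ C Φ R hΦ hns r hr hrR => ?_⟩
  · have h1 := (hG.harmonic _ (hfm hs₀)).comp_conformal he
      (fun s hs => pow_pos (hf.factor_pos s hs) 2) hf.conformal (hW _)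
    have h2 : D ∩ f ⁻¹' (D' \ {f s₀}) = D \ {s₀} := by
      ext s
      constructor
      · rintro ⟨h3, -, h4⟩
        exact ⟨h3, fun h5 => h4 (congrArg f h5)⟩
      · rintro ⟨h3, h4⟩
        exact ⟨h3, hfm h3, fun h5 => h4 (hf.bijOn.injOn h3 hs₀ h5)⟩
    rw [h2] at h1
    exact h1
  · obtain ⟨ρ, hρ⟩ := hG.singularity _ (hfm hs₀)
    exact ⟨_, hf.tendsto_subtractedGreen hD hs₀ hρ⟩
  · exact hG.symmetric _ (hfm hs) _ (hfm hs₀) fun h => hne (hf.bijOn.injOn hs hs₀ h)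
  · obtain ⟨b, hb⟩ := hG.boundary _ (hfm hs₀) (σ C)
    refine ⟨b, hasBoundaryValue_iff.2 ?_⟩
    exact (hasBoundaryValue_iff.1 hb).comp (hσ C)
  · have hσC := hσ' (σ C)
    rw [σ.symm_apply_apply] at hσC
    have hcol := hΦ.comp he hfm hfg (hσ C) hσC
    have hmem := fun θ => circleMap_mem_annulus zero_le_one hr hrR θ
    have hns' : f s₀ ∉ (f ∘ Φ) '' annulus 1 R := by
      rintro ⟨z, hz, hzs⟩
      exact hns ⟨z, hz, hf.bijOn.injOn (hΦ.mapsTo hz) hs₀ hzs⟩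
    rw [← hG.circulation_eq _ (hfm hs₀) (σ C) _ R hcol hns' r hr hrR]
    refine hf.circulation_comp hD (W := D' \ {f s₀}) (u := fun s => G' s (f s₀))
      (fun p hp => (hG.harmonic _ (hfm hs₀)).mdifferentiableAt (hW _) hp)
      (fun θ => hΦ.chart.isOpenSmoothEmbeddingOn.mdifferentiableAt (hmem θ))
      (fun θ => hΦ.mapsTo (hmem θ))
      (fun θ => ⟨hfm (hΦ.mapsTo (hmem θ)), fun h => hns' ⟨_, hmem θ, h⟩⟩)

theorem IsHarmonicOn.congr {u v : S → ℝ} {W : Set S} (hu : IsHarmonicOn u W) (hW : IsOpen W)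
    (h : EqOn v u W) : IsHarmonicOn v W := by
  refine ⟨hu.1.congr h, fun x hx => ?_⟩
  rw [← hu.2 x hx, laplaceBeltrami_eq, laplaceBeltrami_eq]
  congr 1
  have hch := isOpenSmoothEmbeddingOn_extChartAt_symm (E := Plane) (M := S) x
  have hO := hch.isOpen_inter_preimage hW
  have hxO : extChartAt (𝓡 2) x x ∈ (extChartAt (𝓡 2) x).target ∩
      (extChartAt (𝓡 2) x).symm ⁻¹' W :=
    ⟨mem_extChartAt_target x, by rw [mem_preimage, extChartAt_to_inv]; exact hx⟩
  have hev : v ∘ (extChartAt (𝓡 2) x).symm =ᶠ[𝓝 (extChartAt (𝓡 2) x x)]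
      u ∘ (extChartAt (𝓡 2) x).symm := by
    filter_upwards [hO.mem_nhds hxO] with y hy using h hy.2
  unfold lapDensity
  refine Finset.sum_congr rfl fun i _ => ?_
  have : (fun z => gradDensity (gramMatrix x) (v ∘ (extChartAt (𝓡 2) x).symm) z i)
      =ᶠ[𝓝 (extChartAt (𝓡 2) x x)]
      fun z => gradDensity (gramMatrix x) (u ∘ (extChartAt (𝓡 2) x).symm) z i := by
    filter_upwards [hev.eventuallyEq_nhds] with z hz
    simp only [gradDensity, hz.fderiv_eq]
  rw [this.fderiv_eq]

theorem circulation_congr {u v : S → ℝ} {Φ : ℂ → S} {R r : ℝ} {W : Set S}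
    (hW : IsOpen W) (h : EqOn v u W) (hr : 1 < r) (hrR : r < R)
    (hΦW : MapsTo Φ (annulus 1 R) W) : circulation v Φ r = circulation u Φ r := by
  unfold circulation directionalDeriv
  congr 1
  ext θ
  have hθ := hΦW (circleMap_mem_annulus zero_le_one hr hrR θ)
  have h1 : v =ᶠ[𝓝 (Φ (circleMap 0 r θ))] u := by
    filter_upwards [hW.mem_nhds hθ] with y hy using h hy
  rw [h1.mfderiv_eq]
  rfl

/-- Only the values of a Green function on `D × D` off the diagonal matter. -/
theorem IsHydrodynamicalGreen.congr (hD : IsOpen D) {γ : boundaryComponents D → ℝ}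
    {G₁ G₂ : S → S → ℝ} (hG : IsHydrodynamicalGreen D γ G₁)
    (h : ∀ s ∈ D, ∀ s₀ ∈ D, G₂ s s₀ = G₁ s s₀) : IsHydrodynamicalGreen D γ G₂ := by
  have hW : ∀ p : S, IsOpen (D \ {p}) := fun p => hD.sdiff isClosed_singleton
  have hEq : ∀ s₀ ∈ D, EqOn (fun s => G₂ s s₀) (fun s => G₁ s s₀) (D \ {s₀}) :=
    fun s₀ hs₀ s hs => h s hs.1 s₀ hs₀
  refine ⟨fun s₀ hs₀ => (hG.harmonic s₀ hs₀).congr (hW _) (hEq s₀ hs₀), fun s₀ hs₀ => ?_,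
    fun s hs s₀ hs₀ hne => ?_, fun s₀ hs₀ C => ?_, fun s₀ hs₀ C Φ R hΦ hns r hr hrR => ?_⟩
  · obtain ⟨ρ, hρ⟩ := hG.singularity s₀ hs₀
    refine ⟨ρ, hρ.congr' ?_⟩
    filter_upwards [nhdsWithin_le_nhds (hD.mem_nhds hs₀)] with s hs
    simp only [subtractedGreen, h s hs s₀ hs₀]
  · rw [h s hs s₀ hs₀, h s₀ hs₀ s hs]; exact hG.symmetric s hs s₀ hs₀ hne
  · obtain ⟨b, hb⟩ := hG.boundary s₀ hs₀ C
    refine ⟨b, fun x hx => (hb x hx).congr' ?_⟩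
    filter_upwards [self_mem_nhdsWithin] with s hs using (h s hs s₀ hs₀).symm
  · rw [← hG.circulation_eq s₀ hs₀ C Φ R hΦ hns r hr hrR]
    exact circulation_congr (hW s₀) (hEq s₀ hs₀) hr hrR fun z hz =>
      ⟨hΦ.mapsTo hz, fun hzs => hns ⟨z, hz, hzs⟩⟩

end Pullback

/-! ### The Riemannian area measure -/

section Area

variable {S : Type*} [MetricSpace S] [ChartedSpace (EuclideanSpace ℝ (Fin 2)) S]
  [RiemannianBundle (fun x : S => TangentSpace (𝓡 2) x)] [IsManifold (𝓡 2) ∞ S]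
  [IsContMDiffRiemannianBundle (𝓡 2) ∞ (EuclideanSpace ℝ (Fin 2))
    (fun x : S => TangentSpace (𝓡 2) x)]
  {e e₂ : Plane → S} {U U₂ : Set Plane} {y : Plane}

/-- The area density in the coordinates `e`. -/
def areaDensity (e : Plane → S) (y : Plane) : ℝ := Real.sqrt (pullbackMetric e y).det

theorem IsOpenSmoothEmbeddingOn.areaDensity_pos (he : IsOpenSmoothEmbeddingOn Plane Plane e U)
    (hy : y ∈ U) : 0 < areaDensity e y := Real.sqrt_pos.2 (he.pullbackMetric_det_pos hy)

theorem IsOpenSmoothEmbeddingOn.continuousOn_areaDensity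
    (he : IsOpenSmoothEmbeddingOn Plane Plane e U) :
    ContinuousOn (areaDensity e) U := by
  have hG := fun i j => (contDiffOn_pullbackMetric he.isOpen he.smooth i j).continuousOn
  unfold areaDensity
  simp_rw [Matrix.det_fin_two]
  exact (((hG 0 0).mul (hG 1 1)).sub ((hG 0 1).mul (hG 1 0))).sqrt

variable [MeasurableSpace S] [BorelSpace S]

/-- The area measure of the image of `U` under the coordinates `e`. -/
def coordArea (e : Plane → S) (U : Set Plane) : Measure S :=
  Measure.map e ((volume.restrict U).withDensity fun y => ENNReal.ofReal (areaDensity e y))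

/-- `μ` is the area measure of the Riemannian metric: in any coordinates it has the density
`(det g)^(1/2)`. -/
def IsAreaMeasure (μ : Measure S) : Prop :=
  ∀ (e : Plane → S) (U : Set Plane), IsOpenSmoothEmbeddingOn Plane Plane e U →
    μ.restrict (e '' U) = coordArea e U

theorem ContinuousOn.measurableSet_inter_preimage {X Y : Type*} [TopologicalSpace X]
    [MeasurableSpace X] [BorelSpace X] [TopologicalSpace Y] [MeasurableSpace Y] [BorelSpace Y]
    {e : X → Y} {U : Set X} {B : Set Y} (he : ContinuousOn e U) (hU : MeasurableSet U)
    (hB : MeasurableSet B) : MeasurableSet (U ∩ e ⁻¹' B) := by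
  have h := ((continuousOn_iff_continuous_domRestrict.1 he).measurable hB)
  have h2 := hU.subtype_image h
  convert h2 using 1
  ext x
  simp [and_comm]

theorem det_fderiv_eq (τ : Plane → Plane) (y : Plane) :
    (fderiv ℝ τ y).det = (jacobianMatrix τ y).det := by
  rw [ContinuousLinearMap.det,
    ← LinearMap.det_toMatrix (EuclideanSpace.basisFun (Fin 2) ℝ).toBasis]
  congr 1

namespace IsOpenSmoothEmbeddingOn

theorem aemeasurable_density (he : IsOpenSmoothEmbeddingOn Plane Plane e U) :
    AEMeasurable (fun y => ENNReal.ofReal (areaDensity e y)) (volume.restrict U) :=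
  (he.continuousOn_areaDensity.aemeasurable he.isOpen.measurableSet).ennreal_ofReal

theorem aemeasurable (he : IsOpenSmoothEmbeddingOn Plane Plane e U) :
    AEMeasurable e
      ((volume.restrict U).withDensity fun y => ENNReal.ofReal (areaDensity e y)) :=
  (he.smooth.continuousOn.aemeasurable he.isOpen.measurableSet).mono_ac
    (withDensity_absolutelyContinuous _ _)

theorem coordArea_apply (he : IsOpenSmoothEmbeddingOn Plane Plane e U) {B : Set S}
    (hB : MeasurableSet B) :
    coordArea e U B = ∫⁻ y in U ∩ e ⁻¹' B, ENNReal.ofReal (areaDensity e y) := by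
  rw [coordArea, Measure.map_apply_of_aemeasurable he.aemeasurable hB, withDensity_apply',
    Measure.restrict_restrict' he.isOpen.measurableSet, inter_comm]

/-- The area does not depend on the coordinates. -/
theorem coordArea_eq (he : IsOpenSmoothEmbeddingOn Plane Plane e U)
    (he₂ : IsOpenSmoothEmbeddingOn Plane Plane e₂ U₂) {B : Set S} (hB : MeasurableSet B)
    (h1 : B ⊆ e '' U) (h2 : B ⊆ e₂ '' U₂) : coordArea e U B = coordArea e₂ U₂ B := by
  obtain ⟨τ, hτ, hτe⟩ := exists_transition he he₂ (isOpenSmoothEmbeddingOn_id (S := S))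
  rw [he.coordArea_apply hB, he₂.coordArea_apply hB]
  set V := U ∩ e ⁻¹' (univ ∩ id ⁻¹' (e₂ '' U₂)) with hV
  have hsub : U ∩ e ⁻¹' B ⊆ V := fun y hy => ⟨hy.1, mem_univ _, h2 hy.2⟩
  have himage : U₂ ∩ e₂ ⁻¹' B = τ '' (U ∩ e ⁻¹' B) := by
    ext w
    constructor
    · rintro ⟨hw, hwB⟩
      obtain ⟨y, hy, hye⟩ := h1 hwB
      have hyB : y ∈ U ∩ e ⁻¹' B := ⟨hy, by rw [mem_preimage, hye]; exact hwB⟩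
      have h3 := hτe y (hsub hyB)
      exact ⟨y, hyB, he₂.inj h3.1 hw (h3.2.trans hye)⟩
    · rintro ⟨y, hy, rfl⟩
      have h3 := hτe y (hsub hy)
      exact ⟨h3.1, by rw [mem_preimage, h3.2]; exact hy.2⟩
  have hτd : ∀ y ∈ V, DifferentiableAt ℝ τ y := fun y hy =>
    (hτ.mdifferentiableAt hy).differentiableAt
  rw [himage, lintegral_image_eq_lintegral_abs_det_fderiv_mul volume
    (he.smooth.continuousOn.measurableSet_inter_preimage he.isOpen.measurableSet hB)
    (fun y hy => (hτd y (hsub hy)).hasFDerivAt.hasFDerivWithinAt) (hτ.inj.mono hsub)]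
  refine setLIntegral_congr_fun
    (he.smooth.continuousOn.measurableSet_inter_preimage he.isOpen.measurableSet hB)
    fun y hy => ?_
  have hyV := hsub hy
  have hev : id ∘ e =ᶠ[𝓝 y] e₂ ∘ τ := by
    filter_upwards [hτ.isOpen.mem_nhds hyV] with w hw
    exact (hτe w hw).2.symm
  have hG := pullbackMetric_conformal (c := 1) hev (he.mdifferentiableAt hy.1)
    mdifferentiableAt_id (he₂.mdifferentiableAt (hτe y hyV).1) (hτd y hyV)
    (fun u v => by rw [mfderiv_id, one_mul]; rfl)
  have hdet : (pullbackMetric e y).det =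
      (jacobianMatrix τ y).det ^ 2 * (pullbackMetric e₂ (τ y)).det := by
    have := det_conformal (jacobianMatrix τ y) (pullbackMetric e₂ (τ y)) 1
    rw [← hG] at this
    simpa using this
  simp only [areaDensity]
  rw [det_fderiv_eq, ← ENNReal.ofReal_mul (abs_nonneg _), hdet, Real.sqrt_mul (sq_nonneg _),
    Real.sqrt_sq_eq_abs]

end IsOpenSmoothEmbeddingOn

theorem extChartAt_symm_image (x : S) :
    (extChartAt (𝓡 2) x).symm '' (extChartAt (𝓡 2) x).target = (extChartAt (𝓡 2) x).source :=
  (extChartAt (𝓡 2) x).symm_image_target_eq_source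

/-- Existence of the area measure: the areas of the pieces of a partition into Borel sets, each
contained in the domain of a chart, are added up. -/
theorem exists_isAreaMeasure [CompactSpace S] [Nonempty S] : ∃ μ : Measure S, IsAreaMeasure μ := by
  obtain ⟨s, hs, hsu⟩ := TopologicalSpace.countable_cover_nhds
    fun x : S => extChartAt_source_mem_nhds (I := 𝓡 2) x
  have hsne : s.Nonempty := by
    by_contra h
    rw [not_nonempty_iff_eq_empty.1 h] at hsu
    simp at hsu
    exact empty_ne_univ hsu
  obtain ⟨x, hx⟩ := hs.exists_eq_range hsne
  set src : ℕ → Set S := fun n => (extChartAt (𝓡 2) (x n)).source with hsrc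
  set e : ℕ → Plane → S := fun n => (extChartAt (𝓡 2) (x n)).symm with he
  set U : ℕ → Set Plane := fun n => (extChartAt (𝓡 2) (x n)).target with hU
  have hemb : ∀ n, IsOpenSmoothEmbeddingOn Plane Plane (e n) (U n) := fun n =>
    isOpenSmoothEmbeddingOn_extChartAt_symm (x n)
  have hA : ∀ n, MeasurableSet (disjointed src n) := fun n =>
    MeasurableSet.disjointed (fun n => (isOpen_extChartAt_source (x n)).measurableSet) n
  have hAu : ⋃ n, disjointed src n = univ := by
    rw [iUnion_disjointed, ← hsu, hx, biUnion_range]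
  refine ⟨Measure.sum fun n => (coordArea (e n) (U n)).restrict (disjointed src n), ?_⟩
  intro e' U' he'
  ext B hB
  have hI : MeasurableSet (e' '' U') := (he'.isOpen_image he'.isOpen subset_rfl).measurableSet
  have hBI := hB.inter hI
  rw [Measure.restrict_apply hB, Measure.sum_apply _ hBI]
  have h1 : ∀ n, (coordArea (e n) (U n)).restrict (disjointed src n) (B ∩ e' '' U') =
      coordArea e' U' (B ∩ e' '' U' ∩ disjointed src n) := by
    intro n
    rw [Measure.restrict_apply hBI]
    refine (hemb n).coordArea_eq he' (hBI.inter (hA n)) ?_ fun z hz => hz.1.2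
    intro z hz
    rw [extChartAt_symm_image]
    exact disjointed_subset src n hz.2
  simp_rw [h1]
  rw [← measure_iUnion (fun i j hij => ((disjoint_disjointed src hij).mono
    inter_subset_right inter_subset_right)) fun n => hBI.inter (hA n), ← inter_iUnion, hAu,
    inter_univ, he'.coordArea_apply hBI, he'.coordArea_apply hB]
  congr 2
  ext y
  exact ⟨fun h => ⟨h.1, h.2.1⟩, fun h => ⟨h.1, h.2, mem_image_of_mem _ h.1⟩⟩

namespace IsAreaMeasure

variable {μ : Measure S}

theorem measure_image (hμ : IsAreaMeasure μ) (he : IsOpenSmoothEmbeddingOn Plane Plane e U) :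
    μ (e '' U) = ∫⁻ y in U, ENNReal.ofReal (areaDensity e y) := by
  rw [← Measure.restrict_apply_univ, hμ e U he, he.coordArea_apply MeasurableSet.univ,
    preimage_univ, inter_univ]

theorem setIntegral_image (hμ : IsAreaMeasure μ) (he : IsOpenSmoothEmbeddingOn Plane Plane e U)
    {F : S → ℝ} (hF : ContinuousOn F (e '' U)) :
    ∫ x in e '' U, F x ∂μ = ∫ y in U, areaDensity e y * F (e y) := by
  have hm : AEStronglyMeasurable F (coordArea e U) := by
    rw [← hμ e U he]
    exact hF.aestronglyMeasurable (he.isOpen_image he.isOpen subset_rfl).measurableSet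
  rw [hμ e U he, coordArea, integral_map he.aemeasurable hm,
    integral_withDensity_eq_integral_toReal_smul₀ he.aemeasurable_density (by simp)]
  refine integral_congr_ae (Eventually.of_forall fun y => ?_)
  simp only [smul_eq_mul]
  rw [ENNReal.toReal_ofReal (show 0 ≤ areaDensity e y from Real.sqrt_nonneg _)]

theorem isLocallyFiniteMeasure (hμ : IsAreaMeasure μ) : IsLocallyFiniteMeasure μ := by
  refine ⟨fun x => ?_⟩
  have hch := isOpenSmoothEmbeddingOn_extChartAt_symm (E := Plane) (M := S) x
  obtain ⟨r, hr, hball⟩ := Metric.nhds_basis_closedBall.mem_iff.1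
    (hch.isOpen.mem_nhds (mem_extChartAt_target (I := 𝓡 2) x))
  have hb := hch.mono Metric.isOpen_ball (Metric.ball_subset_closedBall.trans hball)
  refine ⟨_, (hb.isOpen_image hb.isOpen subset_rfl).mem_nhds
    ⟨_, Metric.mem_ball_self hr, extChartAt_to_inv x⟩, ?_⟩
  rw [hμ.measure_image hb]
  have h1 : IntegrableOn (areaDensity (extChartAt (𝓡 2) x).symm)
      (Metric.closedBall (extChartAt (𝓡 2) x x) r) :=
    (hch.continuousOn_areaDensity.mono hball).integrableOn_compact (isCompact_closedBall _ _)
  exact (h1.mono_set Metric.ball_subset_closedBall).lintegral_lt_top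

theorem isOpenPosMeasure (hμ : IsAreaMeasure μ) : μ.IsOpenPosMeasure := by
  refine ⟨fun O hO ⟨x, hx⟩ h0 => ?_⟩
  have hch := isOpenSmoothEmbeddingOn_extChartAt_symm (E := Plane) (M := S) x
  have hV := hch.isOpen_inter_preimage hO
  have hb := hch.mono hV inter_subset_left
  have h1 : μ ((extChartAt (𝓡 2) x).symm '' ((extChartAt (𝓡 2) x).target ∩
      (extChartAt (𝓡 2) x).symm ⁻¹' O)) = 0 :=
    measure_mono_null (by rintro _ ⟨y, hy, rfl⟩; exact hy.2) h0
  rw [hμ.measure_image hb, lintegral_eq_zero_iff' hb.aemeasurable_density] at h1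
  have h2 := (ae_restrict_iff' hV.measurableSet).1 h1
  have h3 : volume ((extChartAt (𝓡 2) x).target ∩ (extChartAt (𝓡 2) x).symm ⁻¹' O) = 0 := by
    refine measure_mono_null (fun y hy => ?_) h2
    intro h4
    exact (ENNReal.ofReal_pos.2 (hb.areaDensity_pos hy)).ne' (h4 hy)
  refine hV.measure_ne_zero volume ⟨extChartAt (𝓡 2) x x, mem_extChartAt_target x, ?_⟩ h3
  rw [mem_preimage, extChartAt_to_inv]; exact hx

end IsAreaMeasure

end Area

/-! ### The pairing of gradients and the weak form of harmonicity -/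

/-- The density `(det G)^(1/2) ∑ i j, G^ij ∂_i v ∂_j w` of the inner product of two gradients. -/
def gradInnerDensity (G : Plane → Matrix (Fin 2) (Fin 2) ℝ) (v w : Plane → ℝ) (y : Plane) : ℝ :=
  ∑ i : Fin 2, fderiv ℝ v y (stdVec i) * gradDensity G w y i

/-- Completing the square in the squared length of a gradient shows that it is positive definite. -/
theorem gradInnerDensity_self_mul {G : Plane → Matrix (Fin 2) (Fin 2) ℝ} {v : Plane → ℝ}
    {y : Plane} (hsymm : G y 1 0 = G y 0 1) (hdet : 0 < (G y).det) :
    G y 0 0 * (gradInnerDensity G v v y * Real.sqrt (G y).det) =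
      (G y).det * fderiv ℝ v y (stdVec 0) ^ 2 +
        (G y 0 1 * fderiv ℝ v y (stdVec 0) - G y 0 0 * fderiv ℝ v y (stdVec 1)) ^ 2 := by
  have h1 : Real.sqrt (G y).det ≠ 0 := (Real.sqrt_pos.2 hdet).ne'
  rw [gradInnerDensity, Fin.sum_univ_two, gradDensity_zero hdet, gradDensity_one hdet, hsymm]
  field_simp
  rw [Matrix.det_fin_two, hsymm]
  ring

section GradInner

variable {S : Type*} [MetricSpace S] [ChartedSpace (EuclideanSpace ℝ (Fin 2)) S]
  [RiemannianBundle (fun x : S => TangentSpace (𝓡 2) x)]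

/-- The inner product of the gradients of `φ` and `u` at `x`, in the preferred chart at `x`. -/
def gradInner (φ u : S → ℝ) (x : S) : ℝ :=
  (areaDensity (extChartAt (𝓡 2) x).symm (extChartAt (𝓡 2) x x))⁻¹ *
    gradInnerDensity (pullbackMetric (extChartAt (𝓡 2) x).symm)
      (φ ∘ (extChartAt (𝓡 2) x).symm) (u ∘ (extChartAt (𝓡 2) x).symm) (extChartAt (𝓡 2) x x)

variable [IsManifold (𝓡 2) ∞ S]
  [IsContMDiffRiemannianBundle (𝓡 2) ∞ (EuclideanSpace ℝ (Fin 2))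
    (fun x : S => TangentSpace (𝓡 2) x)]
  {e : Plane → S} {U : Set Plane} {y : Plane} {φ ψ u : S → ℝ} {x : S} {W : Set S}

theorem IsOpenSmoothEmbeddingOn.differentiableAt_comp
    (he : IsOpenSmoothEmbeddingOn Plane Plane e U)
    (hy : y ∈ U) (hφ : MDifferentiableAt (𝓡 2) 𝓘(ℝ, ℝ) φ (e y)) :
    DifferentiableAt ℝ (φ ∘ e) y :=
  (hφ.comp y (he.mdifferentiableAt hy)).differentiableAt

theorem differentiableAt_comp_chart (hφ : MDifferentiableAt (𝓡 2) 𝓘(ℝ, ℝ) φ x) :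
    DifferentiableAt ℝ (φ ∘ (extChartAt (𝓡 2) x).symm) (extChartAt (𝓡 2) x x) :=
  (isOpenSmoothEmbeddingOn_extChartAt_symm (E := Plane) (M := S) x).differentiableAt_comp
    (mem_extChartAt_target x) (by rwa [extChartAt_to_inv])

/-- The inner product of gradients in arbitrary coordinates. -/
theorem IsOpenSmoothEmbeddingOn.areaDensity_mul_gradInner
    (he : IsOpenSmoothEmbeddingOn Plane Plane e U)
    (hy : y ∈ U) (hφ : MDifferentiableAt (𝓡 2) 𝓘(ℝ, ℝ) φ (e y))
    (hu : MDifferentiableAt (𝓡 2) 𝓘(ℝ, ℝ) u (e y)) :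
    areaDensity e y * gradInner φ u (e y) =
      gradInnerDensity (pullbackMetric e) (φ ∘ e) (u ∘ e) y := by
  set p := e y with hp
  set e₂ := (extChartAt (𝓡 2) p).symm with he₂
  have h₂ : IsOpenSmoothEmbeddingOn Plane Plane e₂ (extChartAt (𝓡 2) p).target :=
    isOpenSmoothEmbeddingOn_extChartAt_symm p
  have hp2 : e₂ (extChartAt (𝓡 2) p p) = p := extChartAt_to_inv p
  obtain ⟨τ, hτ, hτe⟩ := exists_transition he h₂ (isOpenSmoothEmbeddingOn_id (S := S))
  have hyV : y ∈ U ∩ e ⁻¹' (univ ∩ id ⁻¹' (e₂ '' (extChartAt (𝓡 2) p).target)) :=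
    ⟨hy, mem_univ _, extChartAt (𝓡 2) p p, mem_extChartAt_target p, hp2⟩
  have hτy : τ y = extChartAt (𝓡 2) p p := by
    apply h₂.inj (hτe y hyV).1 (mem_extChartAt_target p)
    rw [(hτe y hyV).2, hp2]; rfl
  have hτyt := (hτe y hyV).1
  have hev : id ∘ e =ᶠ[𝓝 y] e₂ ∘ τ := by
    filter_upwards [hτ.isOpen.mem_nhds hyV] with w hw
    exact (hτe w hw).2.symm
  have hτd : DifferentiableAt ℝ τ y := (hτ.mdifferentiableAt hyV).differentiableAt
  have hG := pullbackMetric_conformal (c := 1) hev (he.mdifferentiableAt hy)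
    mdifferentiableAt_id (h₂.mdifferentiableAt hτyt) hτd
    (fun u v => by rw [mfderiv_id, one_mul]; rfl)
  rw [one_smul] at hG
  have hdet : (pullbackMetric e y).det =
      (jacobianMatrix τ y).det ^ 2 * (pullbackMetric e₂ (τ y)).det := by
    have := det_conformal (jacobianMatrix τ y) (pullbackMetric e₂ (τ y)) 1
    rw [← hG] at this
    simpa using this
  have hJ : (jacobianMatrix τ y).det ≠ 0 := by
    apply jacobianMatrix_det_ne_zero
    have := hτ.immersion y hyV
    rwa [mfderiv_eq_fderiv] at this
  have hpτ : e₂ (τ y) = p := by rw [hτy, hp2]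
  have hφ2 : DifferentiableAt ℝ (φ ∘ e₂) (τ y) :=
    h₂.differentiableAt_comp hτyt (by rw [hpτ]; exact hφ)
  have hu2 : DifferentiableAt ℝ (u ∘ e₂) (τ y) :=
    h₂.differentiableAt_comp hτyt (by rw [hpτ]; exact hu)
  have hφe : φ ∘ e =ᶠ[𝓝 y] (φ ∘ e₂) ∘ τ := hev.fun_comp φ
  have hue : u ∘ e =ᶠ[𝓝 y] (u ∘ e₂) ∘ τ := hev.fun_comp u
  obtain ⟨h0, h1⟩ := gradDensity_comp (c := 1) one_pos
    (show pullbackMetric e y = _ by rw [one_smul]; exact hG)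
    (pullbackMetric_symm _ _) (h₂.pullbackMetric_det_pos hτyt) hJ hτd hu2 hue
  rw [gradInner, ← he₂, ← hτy, gradInnerDensity, gradInnerDensity, Fin.sum_univ_two,
    Fin.sum_univ_two, h0, h1, hφe.fderiv_eq, fderiv_comp_stdVec hτd hφ2,
    fderiv_comp_stdVec hτd hφ2, areaDensity, areaDensity, hdet, Real.sqrt_mul (sq_nonneg _),
    Real.sqrt_sq_eq_abs, ← sign_mul_self, Matrix.det_fin_two (jacobianMatrix τ y)]
  have h3 : Real.sqrt (pullbackMetric e₂ (τ y)).det ≠ 0 :=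
    (Real.sqrt_pos.2 (h₂.pullbackMetric_det_pos hτyt)).ne'
  field_simp
  ring

theorem gradInner_congr {φ' u' : S → ℝ} (h : φ =ᶠ[𝓝 x] φ') (h' : u =ᶠ[𝓝 x] u') :
    gradInner φ u x = gradInner φ' u' x := by
  have hc : Tendsto (extChartAt (𝓡 2) x).symm (𝓝 (extChartAt (𝓡 2) x x)) (𝓝 x) := by
    have := (continuousAt_extChartAt_symm (I := 𝓡 2) x).tendsto
    rwa [extChartAt_to_inv] at this
  have h1 : φ ∘ (extChartAt (𝓡 2) x).symm =ᶠ[𝓝 (extChartAt (𝓡 2) x x)]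
      φ' ∘ (extChartAt (𝓡 2) x).symm := hc.eventually h
  have h2 : u ∘ (extChartAt (𝓡 2) x).symm =ᶠ[𝓝 (extChartAt (𝓡 2) x x)]
      u' ∘ (extChartAt (𝓡 2) x).symm := hc.eventually h'
  simp only [gradInner, gradInnerDensity, gradDensity, h1.fderiv_eq, h2.fderiv_eq]

theorem gradInner_const_left (c : ℝ) : gradInner (fun _ => c) u x = 0 := by
  have : ((fun _ : S => c) ∘ (extChartAt (𝓡 2) x).symm) = fun _ => c := rfl
  simp only [gradInner, gradInnerDensity, this, fderiv_fun_const]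
  simp

theorem gradInner_of_eventually_const {c : ℝ} (h : ∀ᶠ z in 𝓝 x, φ z = c) :
    gradInner φ u x = 0 := by
  rw [gradInner_congr (φ' := fun _ => c) h EventuallyEq.rfl, gradInner_const_left]

theorem gradInner_add_left (hφ : MDifferentiableAt (𝓡 2) 𝓘(ℝ, ℝ) φ x)
    (hψ : MDifferentiableAt (𝓡 2) 𝓘(ℝ, ℝ) ψ x) :
    gradInner (fun z => φ z + ψ z) u x = gradInner φ u x + gradInner ψ u x := by
  have h1 := differentiableAt_comp_chart hφ
  have h2 := differentiableAt_comp_chart hψ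
  have h3 : (fun z => φ z + ψ z) ∘ (extChartAt (𝓡 2) x).symm =
      (φ ∘ (extChartAt (𝓡 2) x).symm) + (ψ ∘ (extChartAt (𝓡 2) x).symm) := rfl
  simp only [gradInner, gradInnerDensity, h3, fderiv_add h1 h2, Fin.sum_univ_two,
    _root_.add_apply]
  ring

theorem gradInner_const_mul_left (c : ℝ) (hφ : MDifferentiableAt (𝓡 2) 𝓘(ℝ, ℝ) φ x) :
    gradInner (fun z => c * φ z) u x = c * gradInner φ u x := by
  have h1 := differentiableAt_comp_chart hφ
  have h3 : (fun z => c * φ z) ∘ (extChartAt (𝓡 2) x).symm =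
      fun y => c * (φ ∘ (extChartAt (𝓡 2) x).symm) y := rfl
  simp only [gradInner, gradInnerDensity, h3, fderiv_const_mul h1, Fin.sum_univ_two,
    _root_.smul_apply, smul_eq_mul]
  ring

theorem gradInner_sum_left {ι : Type*} (s : Finset ι) {φ : ι → S → ℝ}
    (hφ : ∀ i ∈ s, MDifferentiableAt (𝓡 2) 𝓘(ℝ, ℝ) (φ i) x) :
    gradInner (fun z => ∑ i ∈ s, φ i z) u x = ∑ i ∈ s, gradInner (φ i) u x := by
  have h1 := fun i hi => differentiableAt_comp_chart (hφ i hi)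
  have h3 : (fun z => ∑ i ∈ s, φ i z) ∘ (extChartAt (𝓡 2) x).symm =
      fun y => ∑ i ∈ s, (φ i ∘ (extChartAt (𝓡 2) x).symm) y := rfl
  simp only [gradInner, gradInnerDensity, h3, fderiv_fun_sum h1, Fin.sum_univ_two,
    _root_.sum_apply, ← Finset.mul_sum, Finset.sum_mul, Finset.sum_add_distrib]

theorem gradInner_sub_right {v : S → ℝ} (hu : MDifferentiableAt (𝓡 2) 𝓘(ℝ, ℝ) u x)
    (hv : MDifferentiableAt (𝓡 2) 𝓘(ℝ, ℝ) v x) :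
    gradInner φ (fun z => u z - v z) x = gradInner φ u x - gradInner φ v x := by
  have h1 := differentiableAt_comp_chart hu
  have h2 := differentiableAt_comp_chart hv
  have h3 : (fun z => u z - v z) ∘ (extChartAt (𝓡 2) x).symm =
      (u ∘ (extChartAt (𝓡 2) x).symm) - (v ∘ (extChartAt (𝓡 2) x).symm) := rfl
  simp only [gradInner, gradInnerDensity, gradDensity, h3, fderiv_sub h1 h2, Fin.sum_univ_two,
    _root_.sub_apply]
  ring

/-- The chain rule for the gradient of `η ∘ u`. -/
theorem gradInner_comp_left {η : ℝ → ℝ} {η' : ℝ} (hη : HasDerivAt η η' (u x))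
    (hu : MDifferentiableAt (𝓡 2) 𝓘(ℝ, ℝ) u x) :
    gradInner (fun z => η (u z)) ψ x = η' * gradInner u ψ x := by
  have h1 := differentiableAt_comp_chart hu
  have h3 : HasFDerivAt ((fun z => η (u z)) ∘ (extChartAt (𝓡 2) x).symm)
      (η' • fderiv ℝ (u ∘ (extChartAt (𝓡 2) x).symm) (extChartAt (𝓡 2) x x))
      (extChartAt (𝓡 2) x x) := by
    refine HasDerivAt.comp_hasFDerivAt (h₂ := η) _ ?_ h1.hasFDerivAt
    rw [extChartAt_to_inv]; exact hη
  simp only [gradInner, gradInnerDensity, h3.fderiv, Fin.sum_univ_two,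
    _root_.smul_apply, smul_eq_mul]
  ring

theorem pullbackMetric_zero_zero_pos (he : IsOpenSmoothEmbeddingOn Plane Plane e U) (hy : y ∈ U) :
    0 < pullbackMetric e y 0 0 := by
  refine real_inner_self_pos.2 fun h0 => ?_
  have h1 : coordDeriv e y (stdVec 0) = coordDeriv e y 0 := by rw [map_zero]; exact h0
  have h2 := congrArg (fun v : Plane => v 0) (he.immersion y hy h1)
  simp at h2

theorem gradInner_self_nonneg (u : S → ℝ) (x : S) : 0 ≤ gradInner u u x := by
  have he := isOpenSmoothEmbeddingOn_extChartAt_symm (E := Plane) (M := S) x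
  have hx := mem_extChartAt_target (I := 𝓡 2) x
  have h1 := gradInnerDensity_self_mul (v := u ∘ (extChartAt (𝓡 2) x).symm)
    (pullbackMetric_symm _ _) (he.pullbackMetric_det_pos hx)
  have h2 := pullbackMetric_zero_zero_pos he hx
  have h3 := he.pullbackMetric_det_pos hx
  have h4 := he.areaDensity_pos hx
  refine mul_nonneg (inv_nonneg.2 h4.le) ?_
  refine nonneg_of_mul_nonneg_left (b := Real.sqrt _) ?_ (Real.sqrt_pos.2 h3)
  refine nonneg_of_mul_nonneg_right ?_ h2
  rw [h1]
  positivity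

theorem fderiv_eq_zero_of_gradInner_self (h : gradInner u u x = 0) :
    fderiv ℝ (u ∘ (extChartAt (𝓡 2) x).symm) (extChartAt (𝓡 2) x x) = 0 := by
  have he := isOpenSmoothEmbeddingOn_extChartAt_symm (E := Plane) (M := S) x
  have hx := mem_extChartAt_target (I := 𝓡 2) x
  have h1 := gradInnerDensity_self_mul (v := u ∘ (extChartAt (𝓡 2) x).symm)
    (pullbackMetric_symm _ _) (he.pullbackMetric_det_pos hx)
  have h2 := pullbackMetric_zero_zero_pos he hx
  have h3 := he.pullbackMetric_det_pos hx
  have h4 := he.areaDensity_pos hx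
  have h5 := (mul_eq_zero.1 h).resolve_left (inv_ne_zero h4.ne')
  rw [h5, zero_mul, mul_zero] at h1
  set a := fderiv ℝ (u ∘ (extChartAt (𝓡 2) x).symm) (extChartAt (𝓡 2) x x) (stdVec 0) with ha
  set b := fderiv ℝ (u ∘ (extChartAt (𝓡 2) x).symm) (extChartAt (𝓡 2) x x) (stdVec 1) with hb
  have h6 := sq_nonneg (pullbackMetric (extChartAt (𝓡 2) x).symm (extChartAt (𝓡 2) x x) 0 1 * a -
    pullbackMetric (extChartAt (𝓡 2) x).symm (extChartAt (𝓡 2) x x) 0 0 * b)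
  have h7 : a = 0 := by
    have := mul_nonneg h3.le (sq_nonneg a)
    have h8 : (pullbackMetric (extChartAt (𝓡 2) x).symm (extChartAt (𝓡 2) x x)).det * a ^ 2 = 0 :=
      by linarith
    exact pow_eq_zero_iff two_ne_zero |>.1 ((mul_eq_zero.1 h8).resolve_left h3.ne')
  rw [h7] at h1
  have h9 : b = 0 := by
    simp only [mul_zero, zero_sub, ne_eq, OfNat.ofNat_ne_zero, not_false_eq_true, zero_pow,
      zero_add] at h1
    have := pow_eq_zero_iff two_ne_zero |>.1 h1.symm
    exact (mul_eq_zero.1 (neg_eq_zero.1 this)).resolve_left h2.ne'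
  ext v
  have h : v = v 0 • stdVec 0 + v 1 • stdVec 1 := by
    ext k; fin_cases k <;> simp
  rw [h, map_add, map_smul, map_smul, ← ha, ← hb, h7, h9]
  simp

theorem continuousOn_gradInnerDensity (he : IsOpenSmoothEmbeddingOn Plane Plane e U)
    (hW : IsOpen W) (hφ : ContMDiffOn (𝓡 2) 𝓘(ℝ, ℝ) 1 φ W)
    (hu : ContMDiffOn (𝓡 2) 𝓘(ℝ, ℝ) 2 u W) :
    ContinuousOn (gradInnerDensity (pullbackMetric e) (φ ∘ e) (u ∘ e)) (U ∩ e ⁻¹' W) := by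
  have hO := he.isOpen_inter_preimage hW
  have h1 := (he.contDiffOn_comp (by simp) hφ).continuousOn_fderiv_of_isOpen hO le_rfl
  exact continuousOn_finsetSum _ fun i _ => (h1.clm_apply continuousOn_const).mul
    (he.contDiffOn_gradDensity hW hu i).continuousOn

theorem continuousOn_gradInner (hW : IsOpen W) (hφ : ContMDiffOn (𝓡 2) 𝓘(ℝ, ℝ) 1 φ W)
    (hu : ContMDiffOn (𝓡 2) 𝓘(ℝ, ℝ) 2 u W) : ContinuousOn (gradInner φ u) W := by
  intro x hx
  have he := isOpenSmoothEmbeddingOn_extChartAt_symm (E := Plane) (M := S) x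
  set e := (extChartAt (𝓡 2) x).symm with hedef
  have hex : e (extChartAt (𝓡 2) x x) = x := extChartAt_to_inv x
  have hO := he.isOpen_inter_preimage hW
  have hxO : extChartAt (𝓡 2) x x ∈ (extChartAt (𝓡 2) x).target ∩ e ⁻¹' W :=
    ⟨mem_extChartAt_target x, by rw [mem_preimage, hex]; exact hx⟩
  have h1 : ContinuousOn (fun y => (areaDensity e y)⁻¹ *
      gradInnerDensity (pullbackMetric e) (φ ∘ e) (u ∘ e) y)
      ((extChartAt (𝓡 2) x).target ∩ e ⁻¹' W) :=
    ((he.continuousOn_areaDensity.mono inter_subset_left).inv₀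
      fun y hy => (he.areaDensity_pos hy.1).ne').mul (continuousOn_gradInnerDensity he hW hφ hu)
  have h2 := (h1.continuousAt (hO.mem_nhds hxO))
  have h3 : ContinuousAt (fun p => (areaDensity e (extChartAt (𝓡 2) x p))⁻¹ *
      gradInnerDensity (pullbackMetric e) (φ ∘ e) (u ∘ e) (extChartAt (𝓡 2) x p)) x :=
    ContinuousAt.comp (g := fun y => (areaDensity e y)⁻¹ *
      gradInnerDensity (pullbackMetric e) (φ ∘ e) (u ∘ e) y) h2 (continuousAt_extChartAt x)
  refine (h3.congr ?_).continuousWithinAt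
  filter_upwards [extChartAt_source_mem_nhds (I := 𝓡 2) x, hW.mem_nhds hx] with p hp hpW
  have hpt := (extChartAt (𝓡 2) x).map_source hp
  have hep : e (extChartAt (𝓡 2) x p) = p := (extChartAt (𝓡 2) x).left_inv hp
  rw [← he.areaDensity_mul_gradInner hpt
    (by rw [hep]; exact (hφ.contMDiffAt (hW.mem_nhds hpW)).mdifferentiableAt (by simp))
    (by rw [hep]; exact (hu.contMDiffAt (hW.mem_nhds hpW)).mdifferentiableAt (by simp)), hep,
    inv_mul_cancel_left₀ (he.areaDensity_pos hpt).ne']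

end GradInner

section WeakHarmonic

/-- The integral of a directional derivative of a function with compact support vanishes. -/
theorem integral_fderiv_eq_zero {Q : Plane → ℝ} (hQ : ContDiff ℝ 1 Q) (hc : HasCompactSupport Q)
    (v : Plane) : ∫ y, fderiv ℝ Q y v = 0 := by
  have h1 : Continuous fun y => fderiv ℝ Q y v :=
    (hQ.continuous_fderiv (by simp)).clm_apply continuous_const
  have h2 : HasCompactSupport fun y => fderiv ℝ Q y v := hc.fderiv_apply ℝ v
  have h := integral_smul_fderiv_eq_neg_fderiv_smul_of_integrable (μ := (volume : Measure Plane))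
    (f := fun _ : Plane => (1 : ℝ)) (g := Q) (v := v) (by simp)
    (by simpa using h1.integrable_of_hasCompactSupport h2)
    (by simpa using hQ.continuous.integrable_of_hasCompactSupport hc)
    (fun x _ => differentiableAt_const _) (fun x _ => hQ.differentiable (by simp) x)
  simpa using h

/-- The divergence theorem for a vector field of the form `q P`, where `q` has compact support in
the open set `V`. -/
theorem setIntegral_grad_mul_eq_neg {V : Set Plane} (hV : IsOpen V) {q : Plane → ℝ}
    {P : Plane → Fin 2 → ℝ} (hq : ContDiffOn ℝ 1 q V)
    (hP : ∀ i, ContDiffOn ℝ 1 (fun y => P y i) V) {K : Set Plane} (hK : IsCompact K) (hKV : K ⊆ V)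
    (hqK : ∀ y ∈ V, y ∉ K → q y = 0) :
    ∫ y in V, ((∑ i, fderiv ℝ q y (stdVec i) * P y i) +
      q y * ∑ i, fderiv ℝ (fun z => P z i) y (stdVec i)) = 0 := by
  set Q : Fin 2 → Plane → ℝ := fun i => V.indicator fun y => q y * P y i with hQdef
  have hQV : ∀ i, ∀ y ∈ V, Q i =ᶠ[𝓝 y] fun y => q y * P y i := fun i y hy => by
    filter_upwards [hV.mem_nhds hy] with z hz using indicator_of_mem hz _
  have hQK : ∀ i, ∀ y ∉ K, Q i y = 0 := by
    intro i y hy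
    by_cases h : y ∈ V
    · rw [hQdef]; simp only [indicator_of_mem h, hqK y h hy, zero_mul]
    · exact indicator_of_notMem h _
  have hQK' : ∀ i, ∀ y ∉ K, Q i =ᶠ[𝓝 y] fun _ => 0 := fun i y hy => by
    filter_upwards [hK.isClosed.isOpen_compl.mem_nhds hy] with z hz using hQK i z hz
  have hQ1 : ∀ i, ContDiff ℝ 1 (Q i) := by
    intro i
    rw [contDiff_iff_contDiffAt]
    intro y
    by_cases h : y ∈ V
    · exact (((hq.mul (hP i)).contDiffAt (hV.mem_nhds h))).congr_of_eventuallyEq (hQV i y h)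
    · exact contDiffAt_const.congr_of_eventuallyEq (hQK' i y fun hyK => h (hKV hyK))
  have hQc : ∀ i, HasCompactSupport (Q i) := fun i => HasCompactSupport.intro hK (hQK i)
  have hder : ∀ y ∈ V, (∑ i, fderiv ℝ q y (stdVec i) * P y i) +
      q y * ∑ i, fderiv ℝ (fun z => P z i) y (stdVec i) =
      ∑ i, fderiv ℝ (Q i) y (stdVec i) := by
    intro y hy
    rw [Finset.mul_sum, ← Finset.sum_add_distrib]
    refine Finset.sum_congr rfl fun i _ => ?_
    have h1 : DifferentiableAt ℝ q y := (hq.contDiffAt (hV.mem_nhds hy)).differentiableAt (by simp)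
    have h2 : DifferentiableAt ℝ (fun z => P z i) y :=
      ((hP i).contDiffAt (hV.mem_nhds hy)).differentiableAt (by simp)
    rw [(hQV i y hy).fderiv_eq, fderiv_fun_mul h1 h2]
    simp only [_root_.add_apply, _root_.smul_apply, smul_eq_mul]
    ring
  rw [setIntegral_congr_fun hV.measurableSet hder,
    setIntegral_eq_integral_of_forall_compl_eq_zero fun y hy => ?_, integral_finsetSum]
  · exact Finset.sum_eq_zero fun i _ => integral_fderiv_eq_zero (hQ1 i) (hQc i) _
  · intro i _
    exact (((hQ1 i).continuous_fderiv (by simp)).clm_apply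
      continuous_const).integrable_of_hasCompactSupport ((hQc i).fderiv_apply ℝ _)
  · refine Finset.sum_eq_zero fun i _ => ?_
    rw [(hQK' i y fun h => hy (hKV h)).fderiv_eq]
    simp

theorem ContinuousOn.continuous_of_eq_zero {X : Type*} [TopologicalSpace X] {F : X → ℝ}
    {A K : Set X} (hF : ContinuousOn F A) (hA : IsOpen A) (hK : IsClosed K) (hKA : K ⊆ A)
    (h : ∀ x ∉ K, F x = 0) : Continuous F := by
  rw [continuous_iff_continuousAt]
  intro x
  by_cases hx : x ∈ A
  · exact hF.continuousAt (hA.mem_nhds hx)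
  · refine continuousAt_const.congr (f := fun _ => 0) ?_
    filter_upwards [hK.isOpen_compl.mem_nhds fun hxK => hx (hKA hxK)] with z hz using (h z hz).symm

variable {S : Type*} [MetricSpace S] [CompactSpace S] [ChartedSpace (EuclideanSpace ℝ (Fin 2)) S]
  [RiemannianBundle (fun x : S => TangentSpace (𝓡 2) x)] [IsManifold (𝓡 2) ∞ S]
  [IsContMDiffRiemannianBundle (𝓡 2) ∞ (EuclideanSpace ℝ (Fin 2))
    (fun x : S => TangentSpace (𝓡 2) x)] [MeasurableSpace S] [BorelSpace S]
  {φ u : S → ℝ} {W : Set S} {μ : Measure S}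

theorem gradInner_eq_zero_of_notMem_tsupport {x : S} (hx : x ∉ tsupport φ) :
    gradInner φ u x = 0 :=
  gradInner_of_eventually_const (c := 0) (notMem_tsupport_iff_eventuallyEq.1 hx)

theorem continuous_gradInner (hW : IsOpen W) (hu : ContMDiffOn (𝓡 2) 𝓘(ℝ, ℝ) 2 u W)
    (hφ : ContMDiff (𝓡 2) 𝓘(ℝ, ℝ) 1 φ) (hsupp : tsupport φ ⊆ W) :
    Continuous (gradInner φ u) :=
  (continuousOn_gradInner hW hφ.contMDiffOn hu).continuous_of_eq_zero hW (isClosed_tsupport φ)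
    hsupp fun _ hx => gradInner_eq_zero_of_notMem_tsupport hx

/-- The weak form of harmonicity, for a test function with support in a chart. -/
theorem IsAreaMeasure.integral_gradInner_of_tsupport_subset_source (hμ : IsAreaMeasure μ)
    (hW : IsOpen W) (hu : IsHarmonicOn u W) (hφ : ContMDiff (𝓡 2) 𝓘(ℝ, ℝ) 1 φ) {x : S}
    (hsupp : tsupport φ ⊆ W ∩ (extChartAt (𝓡 2) x).source) :
    ∫ p, gradInner φ u p ∂μ = 0 := by
  have he := isOpenSmoothEmbeddingOn_extChartAt_symm (E := Plane) (M := S) x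
  set e := (extChartAt (𝓡 2) x).symm with hedef
  set V := (extChartAt (𝓡 2) x).target ∩ e ⁻¹' W with hVdef
  have hV : IsOpen V := he.isOpen_inter_preimage hW
  have heV := he.mono hV inter_subset_left
  have hcont := continuous_gradInner hW hu.1 hφ (hsupp.trans inter_subset_left)
  have hzero : ∀ p ∉ e '' V, gradInner φ u p = 0 := by
    intro p hp
    refine gradInner_eq_zero_of_notMem_tsupport fun hps => hp ?_
    have h1 := hsupp hps
    refine ⟨extChartAt (𝓡 2) x p, ⟨(extChartAt (𝓡 2) x).map_source h1.2, ?_⟩,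
      (extChartAt (𝓡 2) x).left_inv h1.2⟩
    rw [mem_preimage, hedef, (extChartAt (𝓡 2) x).left_inv h1.2]; exact h1.1
  rw [← setIntegral_eq_integral_of_forall_compl_eq_zero hzero,
    hμ.setIntegral_image heV hcont.continuousOn]
  have hφe : ContDiffOn ℝ 1 (φ ∘ e) V :=
    he.contDiffOn_comp (by simp) (hφ.contMDiffOn (s := W))
  have hP := fun i => he.contDiffOn_gradDensity hW hu.1 i
  have hK : IsCompact (extChartAt (𝓡 2) x '' tsupport φ) :=
    (isClosed_tsupport φ).isCompact.image_of_continuousOn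
      ((continuousOn_extChartAt x).mono (hsupp.trans inter_subset_right))
  rw [← setIntegral_grad_mul_eq_neg hV hφe hP hK ?_ ?_]
  · refine setIntegral_congr_fun hV.measurableSet fun y hy => ?_
    have hmφ : MDifferentiableAt (𝓡 2) 𝓘(ℝ, ℝ) φ (e y) :=
      (hφ (e y)).mdifferentiableAt (by simp)
    have hmu : MDifferentiableAt (𝓡 2) 𝓘(ℝ, ℝ) u (e y) :=
      (hu.1.contMDiffAt (hW.mem_nhds hy.2)).mdifferentiableAt (by simp)
    have hlap : ∑ i, fderiv ℝ (fun z => gradDensity (pullbackMetric e) (u ∘ e) z i) y (stdVec i)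
        = 0 := by
      have := lapDensity_eq he hW hu.1 hy.1 hy.2
      rwa [hu.2 _ hy.2, mul_zero] at this
    simp only [hlap, mul_zero, add_zero]
    exact he.areaDensity_mul_gradInner hy.1 hmφ hmu
  · rintro _ ⟨p, hp, rfl⟩
    have h1 := hsupp hp
    refine ⟨(extChartAt (𝓡 2) x).map_source h1.2, ?_⟩
    rw [mem_preimage, hedef, (extChartAt (𝓡 2) x).left_inv h1.2]; exact h1.1
  · intro y hy hyK
    refine (image_eq_zero_of_notMem_tsupport fun h => hyK ⟨e y, h, ?_⟩ : φ (e y) = 0)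
    exact (extChartAt (𝓡 2) x).right_inv hy.1

/-- The weak form of harmonicity: gradients of harmonic functions are orthogonal to gradients of
test functions. -/
theorem IsAreaMeasure.integral_gradInner_eq_zero (hμ : IsAreaMeasure μ)
    (hW : IsOpen W) (hu : IsHarmonicOn u W) (hφ : ContMDiff (𝓡 2) 𝓘(ℝ, ℝ) 1 φ)
    (hsupp : tsupport φ ⊆ W) : ∫ p, gradInner φ u p ∂μ = 0 := by
  have hfin := hμ.isLocallyFiniteMeasure
  have hK : IsCompact (tsupport φ) := (isClosed_tsupport φ).isCompact
  obtain ⟨t, -, ht⟩ := hK.elim_nhds_subcover (fun x => (extChartAt (𝓡 2) x).source)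
    fun x _ => extChartAt_source_mem_nhds x
  obtain ⟨ρ, hρ⟩ := SmoothPartitionOfUnity.exists_isSubordinate (𝓡 2) (isClosed_tsupport φ)
    (fun x : t => (extChartAt (𝓡 2) (x : S)).source)
    (fun x => isOpen_extChartAt_source _) (by
      intro p hp
      obtain ⟨x, hx, hpx⟩ := mem_iUnion₂.1 (ht hp)
      exact mem_iUnion.2 ⟨⟨x, hx⟩, hpx⟩)
  have hρφ : ∀ i, ContMDiff (𝓡 2) 𝓘(ℝ, ℝ) 1 fun z => ρ i z * φ z := fun i =>
    ((ρ i).contMDiff.of_le (by simp)).mul hφ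
  have hsum : φ = fun z => ∑ i, ρ i z * φ z := by
    ext z
    rw [← Finset.sum_mul]
    by_cases hz : z ∈ tsupport φ
    · have := ρ.sum_eq_one hz
      rw [finsum_eq_sum_of_fintype] at this
      rw [this, one_mul]
    · rw [image_eq_zero_of_notMem_tsupport hz, mul_zero]
  have hs1 : ∀ i, tsupport (fun z => ρ i z * φ z) ⊆ tsupport φ := fun i =>
    tsupport_mul_subset_right
  have hs2 : ∀ i, tsupport (fun z => ρ i z * φ z) ⊆ (extChartAt (𝓡 2) (i : S)).source := fun i =>
    (tsupport_mul_subset_left (f := ρ i) (g := φ)).trans (hρ i)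
  have hgrad : gradInner φ u = fun p => ∑ i, gradInner (fun z => ρ i z * φ z) u p := by
    ext p
    conv_lhs => rw [hsum]
    exact gradInner_sum_left _ fun i _ => (hρφ i p).mdifferentiableAt (by simp)
  rw [hgrad, integral_finsetSum]
  · exact Finset.sum_eq_zero fun i _ =>
      hμ.integral_gradInner_of_tsupport_subset_source hW hu (hρφ i)
        (subset_inter ((hs1 i).trans hsupp) (hs2 i))
  · intro i _
    have hc := continuous_gradInner hW hu.1 (hρφ i) ((hs1 i).trans hsupp)
    exact hc.integrable_of_hasCompactSupport (HasCompactSupport.of_compactSpace _)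

end WeakHarmonic

/-! ### Circulation as the flux of the gradient through a collar -/

section Flux

/-- The normal derivative in terms of the Gram matrix of the tangent `a` and a transversal
vector `b`. -/
theorem apply_unitNormal_mul_norm {V : Type*} [NormedAddCommGroup V] [InnerProductSpace ℝ V]
    {a b : V} (hab : 0 < inner ℝ a a * inner ℝ b b - inner ℝ a b * inner ℝ a b) (l : V →ₗ[ℝ] ℝ) :
    l (unitNormal a b) * ‖a‖ = (inner ℝ a a * l b - inner ℝ a b * l a) /
      Real.sqrt (inner ℝ a a * inner ℝ b b - inner ℝ a b * inner ℝ a b) := by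
  have ha : inner ℝ a a ≠ 0 := by
    intro h
    have h0 : a = 0 := inner_self_eq_zero.1 h
    simp [h0] at hab
  have ha' : 0 < ‖a‖ := norm_pos_iff.2 fun h0 => ha (by simp [h0])
  set w := b - (inner ℝ a b / inner ℝ a a) • a with hw
  have h1 : inner ℝ w w = inner ℝ b b - inner ℝ a b * inner ℝ a b / inner ℝ a a := by
    rw [hw]
    simp only [inner_sub_left, inner_sub_right, real_inner_smul_left, real_inner_smul_right]
    rw [real_inner_comm a b]
    field_simp
    ring
  have h2 : Real.sqrt (inner ℝ a a * inner ℝ b b - inner ℝ a b * inner ℝ a b) = ‖a‖ * ‖w‖ := by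
    rw [Real.sqrt_eq_iff_mul_self_eq hab.le (by positivity)]
    symm
    calc ‖a‖ * ‖w‖ * (‖a‖ * ‖w‖) = (‖a‖ * ‖a‖) * (‖w‖ * ‖w‖) := by ring
      _ = inner ℝ a a * inner ℝ w w := by
        rw [real_inner_self_eq_norm_mul_norm, real_inner_self_eq_norm_mul_norm]
      _ = _ := by rw [h1, mul_sub, mul_div_cancel₀ _ ha]
  have h3 : ‖w‖ ≠ 0 := by
    intro h
    rw [h, mul_zero] at h2
    exact (Real.sqrt_pos.2 hab).ne' h2
  have h4 : unitNormal a b = ‖w‖⁻¹ • w := rfl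
  rw [h2, h4, map_smul, hw, map_sub, map_smul, ← hw, smul_eq_mul, smul_eq_mul]
  have h5 : inner ℝ a a = ‖a‖ ^ 2 := real_inner_self_eq_norm_sq a
  rw [h5]
  field_simp

/-- The plane, identified with the complex numbers. -/
def planeToComplex : Plane ≃ₗᵢ[ℝ] ℂ := Complex.orthonormalBasisOneI.repr.symm

theorem planeToComplex_apply (y : Plane) : planeToComplex y = y 0 + y 1 * Complex.I :=
  Complex.orthonormalBasisOneI_repr_symm_apply y

theorem isOpenSmoothEmbeddingOn_planeToComplex (A : Set ℂ) (hA : IsOpen A) :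
    IsOpenSmoothEmbeddingOn Plane ℂ planeToComplex (planeToComplex ⁻¹' A) := by
  refine ⟨hA.preimage planeToComplex.continuous,
    planeToComplex.contDiff.contMDiff.contMDiffOn, planeToComplex.injective.injOn, fun y _ => ?_,
    finrank_complex_plane.symm⟩
  rw [mfderiv_eq_fderiv]
  have : fderiv ℝ planeToComplex y = (planeToComplex : Plane →L[ℝ] ℂ) :=
    planeToComplex.toContinuousLinearEquiv.hasFDerivAt.fderiv
  rw [this]
  exact planeToComplex.injective

/-- The partial derivatives of a function of the radius. -/
theorem fderiv_comp_norm {b : ℝ → ℝ} {b' : ℝ} {y : Plane} (hy : y ≠ 0)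
    (hb : HasDerivAt b b' ‖y‖) (i : Fin 2) :
    fderiv ℝ (fun z : Plane => b ‖z‖) y (stdVec i) = b' * (y i / ‖y‖) := by
  have hn : 0 < ‖y‖ := norm_pos_iff.2 hy
  have h1 := ((hasStrictFDerivAt_norm_sq y).hasFDerivAt).sqrt (by positivity)
  have h2 : (fun z : Plane => Real.sqrt (‖z‖ ^ 2)) = fun z => ‖z‖ := by
    ext z; exact Real.sqrt_sq (norm_nonneg z)
  rw [h2, Real.sqrt_sq hn.le] at h1
  have h3 := HasDerivAt.comp_hasFDerivAt (h₂ := b) y hb h1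
  have h4 : (fun z : Plane => b ‖z‖) = b ∘ fun z => ‖z‖ := rfl
  rw [h4, h3.fderiv]
  simp only [_root_.smul_apply, smul_eq_mul, innerSL_apply_apply, nsmul_eq_mul]
  have h5 : inner ℝ y (stdVec i) = y i := by simp [EuclideanSpace.inner_single_right]
  rw [h5]
  field_simp
  norm_num

variable {S : Type*} [MetricSpace S] [ChartedSpace (EuclideanSpace ℝ (Fin 2)) S]
  [RiemannianBundle (fun x : S => TangentSpace (𝓡 2) x)]

/-- The integrand `∂_n ψ ds / dθ` of the circulation around `Φ (|z| = r)`, at the point `Φ z`. -/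
def circulationDensity (ψ : S → ℝ) (Φ : ℂ → S) (z : ℂ) : ℝ :=
  directionalDeriv ψ (Φ z)
      (unitNormal
        (mfderiv 𝓘(ℝ, ℂ) (𝓡 2) Φ z (Complex.I * z))
        (mfderiv 𝓘(ℝ, ℂ) (𝓡 2) Φ z (-z))) *
      ‖mfderiv 𝓘(ℝ, ℂ) (𝓡 2) Φ z (Complex.I * z)‖

theorem circulation_eq_integral (ψ : S → ℝ) (Φ : ℂ → S) (r : ℝ) :
    circulation ψ Φ r =
      ∫ θ in (0 : ℝ)..(2 * Real.pi), circulationDensity ψ Φ (circleMap 0 r θ) := rfl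

variable [IsManifold (𝓡 2) ∞ S]
  [IsContMDiffRiemannianBundle (𝓡 2) ∞ (EuclideanSpace ℝ (Fin 2))
    (fun x : S => TangentSpace (𝓡 2) x)]
  {Φ : ℂ → S} {R : ℝ} {β u : S → ℝ} {b : ℝ → ℝ}

theorem IsAnnularChart.comp_planeToComplex {a b : ℝ} (hΦ : IsAnnularChart Φ a b) :
    IsOpenSmoothEmbeddingOn Plane Plane (Φ ∘ planeToComplex) (planeToComplex ⁻¹' annulus a b) :=
  hΦ.isOpenSmoothEmbeddingOn.comp
    (isOpenSmoothEmbeddingOn_planeToComplex _ (isOpen_annulus a b)) fun _ h => h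

/-- In an annular chart, the inner product of the gradient of `u` with the gradient of a function
of the radius is, up to sign, the radial derivative times the integrand of the circulation. -/
theorem IsAnnularChart.norm_mul_gradInner (hΦ : IsAnnularChart Φ 1 R) {y : Plane}
    (hy : planeToComplex y ∈ annulus 1 R) {b' : ℝ} (hb : HasDerivAt b b' ‖y‖)
    (hβ : ∀ z ∈ annulus 1 R, β (Φ z) = b ‖z‖)
    (hβd : MDifferentiableAt (𝓡 2) 𝓘(ℝ, ℝ) β (Φ (planeToComplex y)))
    (hud : MDifferentiableAt (𝓡 2) 𝓘(ℝ, ℝ) u (Φ (planeToComplex y))) :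
    ‖y‖ * (areaDensity (Φ ∘ planeToComplex) y * gradInner β u (Φ (planeToComplex y))) =
      -b' * circulationDensity u Φ (planeToComplex y) := by
  have he := hΦ.comp_planeToComplex
  set e := Φ ∘ planeToComplex with hedef
  set z := planeToComplex y with hz
  have hyU : y ∈ planeToComplex ⁻¹' annulus 1 R := hy
  have hny : ‖y‖ = ‖z‖ := (planeToComplex.norm_map y).symm
  have hy1 : 1 < ‖y‖ := by rw [hny]; exact hy.1
  have hy0 : y ≠ 0 := norm_pos_iff.1 (zero_lt_one.trans hy1)
  have hsq : ‖y‖ ^ 2 = y 0 ^ 2 + y 1 ^ 2 := by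
    rw [EuclideanSpace.norm_sq_eq, Fin.sum_univ_two, Real.norm_eq_abs, Real.norm_eq_abs, sq_abs,
      sq_abs]
  have hΦz : MDifferentiableAt 𝓘(ℝ, ℂ) (𝓡 2) Φ z :=
    hΦ.isOpenSmoothEmbeddingOn.mdifferentiableAt hy
  -- the frame of the coordinates `e`
  let T : ℂ →L[ℝ] Plane := mfderiv 𝓘(ℝ, ℂ) (𝓡 2) Φ z
  let l : Plane →L[ℝ] ℝ := mfderiv (𝓡 2) 𝓘(ℝ, ℝ) u (Φ z)
  have hT : ∀ v, coordDeriv e y v = T (planeToComplex v) := by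
    intro v
    have h1 := mfderiv_comp (I' := 𝓘(ℝ, ℂ)) y hΦz
      (planeToComplex.differentiableAt.mdifferentiableAt)
    rw [mfderiv_eq_fderiv] at h1
    have h2 : fderiv ℝ planeToComplex y = (planeToComplex : Plane →L[ℝ] ℂ) :=
      planeToComplex.toContinuousLinearEquiv.hasFDerivAt.fderiv
    rw [h2] at h1
    exact DFunLike.congr_fun h1 v
  set A := coordDeriv e y (stdVec 0) with hA
  set B := coordDeriv e y (stdVec 1) with hB
  have hTv : ∀ p q : ℝ, T (p + q * Complex.I) = p • A + q • B := by
    intro p q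
    have h1 : (p + q * Complex.I : ℂ) =
        p • planeToComplex (stdVec 0) + q • planeToComplex (stdVec 1) := by
      simp [planeToComplex_apply]
    rw [h1, map_add, map_smul, map_smul, hA, hB, hT, hT]
  have ha : T (Complex.I * z) = (-y 1) • A + y 0 • B := by
    rw [← hTv]; congr 1
    rw [hz, planeToComplex_apply]
    push_cast
    linear_combination (y 1 : ℂ) * Complex.I_mul_I
  have hbv : T (-z) = (-y 0) • A + (-y 1) • B := by
    rw [← hTv]; congr 1
    rw [hz, planeToComplex_apply]
    push_cast
    ring
  have hl : ∀ v, fderiv ℝ (u ∘ e) y v = l (coordDeriv e y v) := by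
    intro v
    have h1 := mfderiv_comp (I' := 𝓡 2) y hud (he.mdifferentiableAt hyU)
    rw [mfderiv_eq_fderiv] at h1
    exact DFunLike.congr_fun h1 v
  have hβe : β ∘ e =ᶠ[𝓝 y] fun w => b ‖w‖ := by
    filter_upwards [he.isOpen.mem_nhds hyU] with w hw
    rw [← planeToComplex.norm_map w]
    exact hβ _ hw
  have hdet := he.pullbackMetric_det_pos hyU
  have hE : pullbackMetric e y 0 0 = metricAt (Φ z) A A := rfl
  have hF : pullbackMetric e y 0 1 = metricAt (Φ z) A B := rfl
  have hF' : pullbackMetric e y 1 0 = metricAt (Φ z) A B := pullbackMetric_symm e y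
  have hG : pullbackMetric e y 1 1 = metricAt (Φ z) B B := rfl
  have hBA : metricAt (Φ z) B A = metricAt (Φ z) A B := metricAt_comm _ _ _
  have hdet2 : (pullbackMetric e y).det =
      metricAt (Φ z) A A * metricAt (Φ z) B B - metricAt (Φ z) A B * metricAt (Φ z) A B := by
    rw [Matrix.det_fin_two, hE, hF, hF', hG]
  have hgram : metricAt (Φ z) (T (Complex.I * z)) (T (Complex.I * z)) *
      metricAt (Φ z) (T (-z)) (T (-z)) -
      metricAt (Φ z) (T (Complex.I * z)) (T (-z)) * metricAt (Φ z) (T (Complex.I * z)) (T (-z)) =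
      (‖y‖ ^ 2) ^ 2 * (pullbackMetric e y).det := by
    rw [hdet2, ha, hbv, hsq]
    simp only [metricAt_add_left, metricAt_add_right, metricAt_smul_left, metricAt_smul_right, hBA]
    ring
  have hcirc : circulationDensity u Φ z =
      (metricAt (Φ z) (T (Complex.I * z)) (T (Complex.I * z)) * l (T (-z)) -
        metricAt (Φ z) (T (Complex.I * z)) (T (-z)) * l (T (Complex.I * z))) /
      Real.sqrt ((‖y‖ ^ 2) ^ 2 * (pullbackMetric e y).det) := by
    rw [← hgram]
    exact apply_unitNormal_mul_norm (V := TangentSpace (𝓡 2) (Φ z))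
      (a := mfderiv 𝓘(ℝ, ℂ) (𝓡 2) Φ z (Complex.I * z)) (b := mfderiv 𝓘(ℝ, ℂ) (𝓡 2) Φ z (-z))
      (by
        change 0 < metricAt (Φ z) (T (Complex.I * z)) (T (Complex.I * z)) *
          metricAt (Φ z) (T (-z)) (T (-z)) -
          metricAt (Φ z) (T (Complex.I * z)) (T (-z)) *
          metricAt (Φ z) (T (Complex.I * z)) (T (-z))
        rw [hgram]; positivity) l.toLinearMap
  have hgi := he.areaDensity_mul_gradInner (φ := β) (u := u) hyU hβd hud
  have hgi' : areaDensity e y * gradInner β u (Φ z) =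
      gradInnerDensity (pullbackMetric e) (β ∘ e) (u ∘ e) y := hgi
  rw [hgi', hcirc, gradInnerDensity, Fin.sum_univ_two, gradDensity_zero hdet,
    gradDensity_one hdet, hβe.fderiv_eq, fderiv_comp_norm hy0 hb, fderiv_comp_norm hy0 hb, hl, hl,
    ← hA, ← hB, Real.sqrt_mul (by positivity), Real.sqrt_sq (by positivity), hE, hF, hF', hG,
    ha, hbv]
  simp only [metricAt_add_left, metricAt_add_right, metricAt_smul_left, metricAt_smul_right, hBA,
    map_add, map_smul, smul_eq_mul]
  have h1 : Real.sqrt (pullbackMetric e y).det ≠ 0 := (Real.sqrt_pos.2 hdet).ne'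
  have h2 : ‖y‖ ≠ 0 := norm_ne_zero_iff.2 hy0
  rw [hsq]
  have h3 : y 0 ^ 2 + y 1 ^ 2 ≠ 0 := by rw [← hsq]; positivity
  field_simp
  ring

end Flux

section FluxIntegral

/-- Integration in polar coordinates of a function supported in a compact annulus. -/
theorem integral_eq_integral_circleMap {H : ℂ → ℝ} (hH : Continuous H) {r₁ r₂ : ℝ} (h₁ : 0 < r₁)
    (h₁₂ : r₁ ≤ r₂) (h : ∀ z, ‖z‖ ∉ Icc r₁ r₂ → H z = 0) :
    ∫ z, H z = ∫ r in r₁..r₂, ∫ θ in (0 : ℝ)..(2 * Real.pi), r * H (circleMap 0 r θ) := by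
  have hpi := Real.pi_pos
  set F : ℝ × ℝ → ℝ := fun p => p.1 * H (circleMap 0 p.1 p.2) with hF
  have hFc : Continuous F := by
    have : Continuous fun p : ℝ × ℝ => circleMap 0 p.1 p.2 := by unfold circleMap; fun_prop
    exact continuous_fst.mul (hH.comp this)
  have h0 : ∀ r θ : ℝ, 0 < r → r ∉ Icc r₁ r₂ → F (r, θ) = 0 := by
    intro r θ hr hr'
    have : ‖circleMap 0 r θ‖ = r := by simp [abs_of_pos hr]
    rw [hF]
    simp only
    rw [h _ (by rwa [this]), mul_zero]
  have hpolar : ∀ p : ℝ × ℝ, p.1 • H (Complex.polarCoord.symm p) = F p := by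
    intro p
    rw [Complex.polarCoord_symm_apply, hF, smul_eq_mul]
    simp [circleMap, Complex.exp_mul_I]
  have hinner : ∀ r : ℝ, ∫ θ in Ioo (-Real.pi) Real.pi, F (r, θ) =
      ∫ θ in (0 : ℝ)..(2 * Real.pi), F (r, θ) := by
    intro r
    have hper : Function.Periodic (fun θ => F (r, θ)) (2 * Real.pi) := fun θ => by
      simp only [hF]
      rw [periodic_circleMap 0 r θ]
    have := hper.intervalIntegral_add_eq (-Real.pi) 0
    rw [show -Real.pi + 2 * Real.pi = Real.pi by ring, zero_add] at this
    rw [← this, intervalIntegral.integral_of_le (by linarith), integral_Ioc_eq_integral_Ioo]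
  rw [← Complex.integral_comp_polarCoord_symm]
  simp_rw [hpolar]
  rw [polarCoord_target]
  have hsub : Icc r₁ r₂ ×ˢ Ioo (-Real.pi) Real.pi ⊆ Ioi (0 : ℝ) ×ˢ Ioo (-Real.pi) Real.pi :=
    prod_mono (fun r hr => h₁.trans_le hr.1) subset_rfl
  rw [setIntegral_eq_of_subset_of_forall_sdiff_eq_zero
    (measurableSet_Ioi.prod measurableSet_Ioo) hsub ?_, Measure.volume_eq_prod, setIntegral_prod]
  · simp_rw [hinner]
    rw [integral_Icc_eq_integral_Ioc, ← intervalIntegral.integral_of_le h₁₂]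
  · rw [← Measure.volume_eq_prod]
    exact (hFc.continuousOn.integrableOn_compact
      (isCompact_Icc.prod (isCompact_Icc (a := -Real.pi) (b := Real.pi)))).mono_set
        (prod_mono subset_rfl Ioo_subset_Icc_self)
  · rintro ⟨r, θ⟩ ⟨hr, hr'⟩
    exact h0 r θ hr.1 fun hmem => hr' ⟨hmem, hr.2⟩

variable {S : Type*} [MetricSpace S] [ChartedSpace (EuclideanSpace ℝ (Fin 2)) S]
  [RiemannianBundle (fun x : S => TangentSpace (𝓡 2) x)] [IsManifold (𝓡 2) ∞ S]
  [IsContMDiffRiemannianBundle (𝓡 2) ∞ (EuclideanSpace ℝ (Fin 2))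
    (fun x : S => TangentSpace (𝓡 2) x)] [MeasurableSpace S] [BorelSpace S]
  {Φ : ℂ → S} {R r₁ r₂ γ : ℝ} {β u : S → ℝ} {b b' : ℝ → ℝ} {W : Set S} {μ : Measure S}

/-- If the circulation of `u` is `γ` on every circle of a collar, and `β` decreases from `1` to `0`
across the collar, then the inner product of the gradients of `β` and `u` integrates to `γ`. -/
theorem IsAreaMeasure.setIntegral_gradInner_eq (hμ : IsAreaMeasure μ) (hΦ : IsAnnularChart Φ 1 R)
    (hW : IsOpen W) (hΦW : Φ '' annulus 1 R ⊆ W)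
    (hβ : ContMDiffOn (𝓡 2) 𝓘(ℝ, ℝ) 1 β W) (hu : ContMDiffOn (𝓡 2) 𝓘(ℝ, ℝ) 2 u W)
    (h1 : 1 < r₁) (h12 : r₁ ≤ r₂) (h2 : r₂ < R) (hb : ∀ t, HasDerivAt b (b' t) t)
    (hb'c : Continuous b') (hb' : ∀ t, t ∉ Icc r₁ r₂ → b' t = 0) (hb1 : b r₁ = 1) (hb2 : b r₂ = 0)
    (hβb : ∀ z ∈ annulus 1 R, β (Φ z) = b ‖z‖)
    (hγ : ∀ r, 1 < r → r < R → circulation u Φ r = γ) :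
    ∫ x in Φ '' annulus 1 R, gradInner β u x ∂μ = γ := by
  have he := hΦ.comp_planeToComplex
  have himage : (Φ ∘ planeToComplex) '' (planeToComplex ⁻¹' annulus 1 R) = Φ '' annulus 1 R := by
    rw [image_comp, image_preimage_eq _ planeToComplex.surjective]
  have hcont : ContinuousOn (gradInner β u) (Φ '' annulus 1 R) :=
    (continuousOn_gradInner hW hβ hu).mono hΦW
  have hL : Continuous (planeToComplex.symm : ℂ → Plane) := planeToComplex.symm.continuous
  set H : ℂ → ℝ := (annulus 1 R).indicator fun z =>
    areaDensity (Φ ∘ planeToComplex) (planeToComplex.symm z) * gradInner β u (Φ z) with hH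
  -- the integrand in polar coordinates
  have hkey : ∀ z ∈ annulus 1 R, ‖z‖ * H z = -b' ‖z‖ * circulationDensity u Φ z := by
    intro z hz
    have hΦz : W ∈ 𝓝 (Φ z) := hW.mem_nhds (hΦW (mem_image_of_mem Φ hz))
    have hzz : planeToComplex (planeToComplex.symm z) = z := planeToComplex.apply_symm_apply z
    have hn : ‖planeToComplex.symm z‖ = ‖z‖ := planeToComplex.symm.norm_map z
    have := hΦ.norm_mul_gradInner (y := planeToComplex.symm z) (u := u) (by rwa [hzz])
      (hb ‖planeToComplex.symm z‖) hβb
      (by rw [hzz]; exact (hβ.contMDiffAt hΦz).mdifferentiableAt (by simp))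
      (by rw [hzz]; exact (hu.contMDiffAt hΦz).mdifferentiableAt (by simp))
    rw [hzz, hn] at this
    rw [hH, indicator_of_mem hz]
    exact this
  have hzero : ∀ z, ‖z‖ ∉ Icc r₁ r₂ → H z = 0 := by
    intro z hz
    by_cases hzA : z ∈ annulus 1 R
    · have h3 := hkey z hzA
      rw [hb' _ hz, neg_zero, zero_mul] at h3
      exact (mul_eq_zero.1 h3).resolve_left (zero_lt_one.trans hzA.1).ne'
    · exact indicator_of_notMem hzA _
  have hHc : Continuous H := by
    refine ContinuousOn.continuous_of_eq_zero (A := annulus 1 R) (K := {z | ‖z‖ ∈ Icc r₁ r₂}) ?_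
      (isOpen_annulus 1 R) (isClosed_Icc.preimage continuous_norm)
      (fun z hz => ⟨h1.trans_le hz.1, hz.2.trans_lt h2⟩) hzero
    refine ContinuousOn.congr (f := fun z => areaDensity (Φ ∘ planeToComplex)
      (planeToComplex.symm z) * gradInner β u (Φ z)) ?_ fun z hz => indicator_of_mem hz _
    refine (he.continuousOn_areaDensity.comp hL.continuousOn fun z hz => ?_).mul
      (hcont.comp hΦ.smooth.continuousOn fun z hz => mem_image_of_mem Φ hz)
    rw [mem_preimage, planeToComplex.apply_symm_apply]
    exact hz
  calc ∫ x in Φ '' annulus 1 R, gradInner β u x ∂μ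
      = ∫ y in planeToComplex ⁻¹' annulus 1 R, areaDensity (Φ ∘ planeToComplex) y *
          gradInner β u ((Φ ∘ planeToComplex) y) := by
        rw [← himage]
        exact hμ.setIntegral_image he (himage ▸ hcont)
    _ = ∫ y, H (planeToComplex y) := by
        rw [← integral_indicator he.isOpen.measurableSet]
        congr 1
        ext y
        by_cases hy : planeToComplex y ∈ annulus 1 R
        · rw [indicator_of_mem (mem_preimage.2 hy), hH, indicator_of_mem hy,
            planeToComplex.symm_apply_apply]
          rfl
        · rw [hH, indicator_of_notMem hy]
          exact indicator_of_notMem (s := planeToComplex ⁻¹' annulus 1 R) hy _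
    _ = ∫ z, H z := planeToComplex.measurePreserving.integral_comp
        planeToComplex.toHomeomorph.measurableEmbedding H
    _ = ∫ r in r₁..r₂, ∫ θ in (0 : ℝ)..(2 * Real.pi), r * H (circleMap 0 r θ) :=
        integral_eq_integral_circleMap hHc (by linarith) h12 hzero
    _ = ∫ r in r₁..r₂, -b' r * γ := by
        refine intervalIntegral.integral_congr fun r hr => ?_
        rw [uIcc_of_le h12] at hr
        have hr1 : 1 < r := h1.trans_le hr.1
        have hrR : r < R := hr.2.trans_lt h2
        have hrn : ∀ θ, ‖circleMap 0 r θ‖ = r := fun θ => by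
          simp [abs_of_pos (zero_lt_one.trans hr1)]
        have hint : ∀ θ, r * H (circleMap 0 r θ) =
            -b' r * circulationDensity u Φ (circleMap 0 r θ) := fun θ => by
          have := hkey _ (circleMap_mem_annulus zero_le_one hr1 hrR θ)
          rwa [hrn] at this
        simp_rw [hint]
        rw [intervalIntegral.integral_const_mul, ← circulation_eq_integral, hγ r hr1 hrR]
    _ = γ := by
        rw [intervalIntegral.integral_mul_const, intervalIntegral.integral_neg,
          intervalIntegral.integral_eq_sub_of_hasDerivAt (fun t _ => hb t)
            (hb'c.intervalIntegrable _ _), hb1, hb2]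
        ring

end FluxIntegral

/-! ### Cutoff functions at the boundary components and Green's formula -/

section Cutoff

/-- A nondecreasing `C¹` function that is `0` on `(-∞, a]` and `1` on `[b, ∞)`. -/
theorem exists_smoothStep {a b : ℝ} (hab : a < b) :
    ∃ η η' : ℝ → ℝ, (∀ t, HasDerivAt η (η' t) t) ∧ Continuous η' ∧ (∀ t, 0 ≤ η' t) ∧
      (∀ t ≤ a, η t = 0) ∧ (∀ t, b ≤ t → η t = 1) ∧ ∀ t, t ∉ Icc a b → η' t = 0 := by
  set η : ℝ → ℝ := fun t => Real.smoothTransition ((t - a) / (b - a)) with hη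
  have hba : 0 < b - a := sub_pos.2 hab
  have hsm : ContDiff ℝ 1 η := by
    have h : ContDiff ℝ 1 Real.smoothTransition := Real.smoothTransition.contDiff (n := 1)
    exact h.comp ((contDiff_id.sub contDiff_const).div_const _)
  have hmono : Monotone η := fun s t hst =>
    Real.smoothTransition.monotone (div_le_div_of_nonneg_right (by linarith) hba.le)
  have h0 : ∀ t ≤ a, η t = 0 := fun t ht => Real.smoothTransition.zero_of_nonpos
    (div_nonpos_of_nonpos_of_nonneg (by linarith) hba.le)
  have h1 : ∀ t, b ≤ t → η t = 1 := fun t ht => Real.smoothTransition.one_of_one_le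
    ((one_le_div hba).2 (by linarith))
  refine ⟨η, deriv η, fun t => (hsm.differentiable (by simp) t).hasDerivAt,
    hsm.continuous_deriv le_rfl, fun t => hmono.deriv_nonneg, h0, h1, fun t ht => ?_⟩
  rw [mem_Icc, not_and_or, not_le, not_le] at ht
  rcases ht with ht | ht
  · have : η =ᶠ[𝓝 t] fun _ => 0 := by
      filter_upwards [Iio_mem_nhds ht] with s hs using h0 s (le_of_lt hs)
    rw [this.deriv_eq, deriv_const]
  · have : η =ᶠ[𝓝 t] fun _ => 1 := by
      filter_upwards [Ioi_mem_nhds ht] with s hs using h1 s (le_of_lt hs)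
    rw [this.deriv_eq, deriv_const]

theorem contDiff_one_of_hasDerivAt {η η' : ℝ → ℝ} (h : ∀ t, HasDerivAt η (η' t) t)
    (hc : Continuous η') : ContDiff ℝ 1 η := by
  refine contDiff_one_iff_deriv.2 ⟨fun t => (h t).differentiableAt, ?_⟩
  rwa [show deriv η = η' from funext fun t => (h t).deriv]

/-- A property that holds near the boundary component holds near every nearby point of `D`. -/
theorem eventually_eventually_nhds_endFilter {X : Type*} [TopologicalSpace X] {D C : Set X}
    (hD : IsOpen D) {p : X → Prop} (h : ∀ᶠ x in endFilter D C, p x) :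
    ∀ᶠ x in endFilter D C, ∀ᶠ z in 𝓝 x, p z := by
  rw [endFilter, eventually_inf_principal] at h ⊢
  filter_upwards [eventually_nhdsSet_iff_forall.2 fun x hx =>
    eventually_eventually_nhds.2 (eventually_nhdsSet_iff_forall.1 h x hx)] with x hx hxD
  filter_upwards [hx, hD.mem_nhds hxD] with z hz hzD using hz hzD

variable {S : Type*} [MetricSpace S] [ChartedSpace (EuclideanSpace ℝ (Fin 2)) S]
  [RiemannianBundle (fun x : S => TangentSpace (𝓡 2) x)] [IsManifold (𝓡 2) ∞ S]
  [IsContMDiffRiemannianBundle (𝓡 2) ∞ (EuclideanSpace ℝ (Fin 2))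
    (fun x : S => TangentSpace (𝓡 2) x)] [MeasurableSpace S] [BorelSpace S]
  {D : Set S} {s₀ : S} {μ : Measure S}

/-- Every boundary component has a collar that stays away from a given point of the domain. -/
theorem IsJordanDomain.exists_collar_notMem (hD : IsJordanDomain D) (C : boundaryComponents D)
    (hs₀ : s₀ ∈ D) : ∃ (Φ : ℂ → S) (R : ℝ), IsAnnularChart Φ (1 / 2) 2 ∧
      Φ '' Metric.sphere (0 : ℂ) 1 = C ∧ (∀ z ∈ annulus (1 / 2) 2, (Φ z ∈ D ↔ 1 < ‖z‖)) ∧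
      R ≤ 2 ∧ IsCollar D (C : Set S) Φ R ∧ s₀ ∉ Φ '' annulus 1 R := by
  obtain ⟨Φ, h1, h2, h3⟩ := hD.circle C C.2
  by_cases h : s₀ ∈ Φ '' annulus 1 2
  · obtain ⟨z₀, hz₀, rfl⟩ := h
    refine ⟨Φ, ‖z₀‖, h1, h2, h3, hz₀.2.le, h1.isCollar h2 h3 hz₀.1 hz₀.2.le, ?_⟩
    rintro ⟨z, hz, hzz⟩
    have := h1.inj ⟨by linarith [hz.1], hz.2.trans hz₀.2⟩ ⟨by linarith [hz₀.1], hz₀.2⟩ hzz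
    exact hz.2.ne (by rw [this])
  · exact ⟨Φ, 2, h1, h2, h3, le_rfl, h1.isCollar h2 h3 one_lt_two le_rfl, h⟩

/-- A cutoff function of the boundary component `C`, whose gradient pairs with the gradient of a
function to the circulation of that function around `C`. -/
theorem IsJordanDomain.exists_collarCutoff (hμ : IsAreaMeasure μ) (hD : IsJordanDomain D)
    (C : boundaryComponents D) (hs₀ : s₀ ∈ D) :
    ∃ β : S → ℝ, ContMDiffOn (𝓡 2) 𝓘(ℝ, ℝ) 1 β D ∧
      (∀ᶠ s in endFilter D (C : Set S), β s = 1) ∧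
      (∀ C' : boundaryComponents D, C' ≠ C → ∀ᶠ s in endFilter D (C' : Set S), β s = 0) ∧
      (∀ᶠ s in 𝓝 s₀, β s = 0) ∧
      ∀ (u : S → ℝ) (γ : ℝ), ContMDiffOn (𝓡 2) 𝓘(ℝ, ℝ) 2 u (D \ {s₀}) →
        (∀ (Φ : ℂ → S) (R : ℝ), IsCollar D (C : Set S) Φ R → s₀ ∉ Φ '' annulus 1 R →
          ∀ r : ℝ, 1 < r → r < R → circulation u Φ r = γ) →
        ∫ x in D \ {s₀}, gradInner β u x ∂μ = γ := by
  classical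
  obtain ⟨Φ, R, hΦ, hsph, hside, hR2, hcol, hs₀Φ⟩ := hD.exists_collar_notMem C hs₀
  have hR := hcol.one_lt
  -- the cutoff function is `1` for `‖z‖ ≤ r₁` and `0` for `‖z‖ ≥ r₂`, where `1 < r₁ < r₂ < R`
  set r₁ := 1 + (R - 1) / 3 with hr₁
  set r₂ := 1 + 2 * (R - 1) / 3 with hr₂
  have h1 : 1 < r₁ := by rw [hr₁]; linarith
  have h12 : r₁ < r₂ := by rw [hr₁, hr₂]; linarith
  have h2 : r₂ < R := by rw [hr₂]; linarith
  obtain ⟨η, η', hη, hηc, -, hη0, hη1, hη'⟩ := exists_smoothStep h12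
  have hηsm := contDiff_one_of_hasDerivAt hη hηc
  have hemb := hcol.chart.isOpenSmoothEmbeddingOn
  set g := Function.invFunOn Φ (annulus 1 R) with hg
  have hgl : LeftInvOn g Φ (annulus 1 R) := hcol.chart.inj.leftInvOn_invFunOn
  set A := Φ '' annulus 1 R with hA
  have hAo : IsOpen A := hemb.isOpen_image hemb.isOpen subset_rfl
  have hAD : A ⊆ D := by rintro _ ⟨z, hz, rfl⟩; exact hcol.mapsTo hz
  set β : S → ℝ := fun s => if s ∈ A then 1 - η ‖g s‖ else 0 with hβ
  have hβΦ : ∀ z ∈ annulus 1 R, β (Φ z) = 1 - η ‖z‖ := by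
    intro z hz
    change (if Φ z ∈ A then 1 - η ‖g (Φ z)‖ else 0) = 1 - η ‖z‖
    rw [if_pos (mem_image_of_mem Φ hz), hgl hz]
  -- the support of the cutoff function
  set Z : Set ℂ := {z | ‖z‖ ∈ Icc 1 r₂} with hZ
  have hZsub : Z ⊆ annulus (1 / 2) 2 := fun z hz =>
    ⟨by linarith [hz.1], hz.2.trans_lt (h2.trans_le hR2)⟩
  have hZc : IsCompact Z :=
    Metric.isCompact_of_isClosed_isBounded (isClosed_Icc.preimage continuous_norm)
      ((Metric.isBounded_closedBall (x := (0 : ℂ)) (r := r₂)).subset fun z hz => by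
        rw [mem_closedBall_zero_iff]; exact hz.2)
  set K := Φ '' Z with hK
  have hKc : IsClosed K := (hZc.image_of_continuousOn (hΦ.smooth.continuousOn.mono hZsub)).isClosed
  have hKD : K ∩ D ⊆ A := by
    rintro _ ⟨⟨z, hz, rfl⟩, hzD⟩
    exact ⟨z, ⟨(hside z (hZsub hz)).1 hzD, hz.2.trans_lt h2⟩, rfl⟩
  have hβK : ∀ s ∉ K, β s = 0 := by
    intro s hs
    by_cases hsA : s ∈ A
    · obtain ⟨z, hz, rfl⟩ := hsA
      have : r₂ ≤ ‖z‖ := by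
        by_contra hlt
        exact hs ⟨z, ⟨hz.1.le, (not_le.1 hlt).le⟩, rfl⟩
      rw [hβΦ z hz, hη1 _ this, sub_self]
    · simp only [hβ, if_neg hsA]
  have hβK' : ∀ s ∉ K, ∀ᶠ z in 𝓝 s, β z = 0 := fun s hs => by
    filter_upwards [hKc.isOpen_compl.mem_nhds hs] with z hz using hβK z hz
  have hsm : ContMDiffOn (𝓡 2) 𝓘(ℝ, ℝ) 1 β D := by
    intro s hs
    refine ContMDiffAt.contMDiffWithinAt ?_
    by_cases hsK : s ∈ K
    · obtain ⟨z, hz, rfl⟩ := hKD ⟨hsK, hs⟩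
      have hz0 : z ≠ 0 := norm_pos_iff.1 (zero_lt_one.trans hz.1)
      have hgs : ContMDiffAt (𝓡 2) 𝓘(ℝ, ℂ) 1 g (Φ z) :=
        (hemb.contMDiffAt_of_leftInvOn hgl hz).of_le (by simp)
      have hF : ContDiffAt ℝ 1 (fun w : ℂ => 1 - η ‖w‖) (g (Φ z)) := by
        rw [hgl hz]
        exact contDiffAt_const.sub (hηsm.contDiffAt.comp z (contDiffAt_norm ℝ hz0))
      have hcomp : ContMDiffAt (𝓡 2) 𝓘(ℝ, ℝ) 1 (fun s => 1 - η ‖g s‖) (Φ z) :=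
        hF.contMDiffAt.comp (Φ z) hgs
      refine hcomp.congr_of_eventuallyEq ?_
      filter_upwards [hAo.mem_nhds (mem_image_of_mem Φ hz)] with w hw
      simp only [hβ, if_pos hw]
    · exact contMDiffAt_const.congr_of_eventuallyEq (hβK' s hsK)
  have hs₀K : s₀ ∉ K := fun h => hs₀Φ (hKD ⟨h, hs₀⟩)
  refine ⟨β, hsm, ?_, ?_, hβK' s₀ hs₀K, ?_⟩
  · rw [endFilter, ← hcol.map_end, eventually_map,
      ((nhdsGT_basis (1 : ℝ)).comap _).eventually_iff]
    refine ⟨r₁, h1, fun z hz => ?_⟩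
    rw [hβΦ z ⟨hz.1, hz.2.trans (h12.trans h2)⟩, hη0 _ (le_of_lt hz.2), sub_zero]
  · intro C' hC'
    have hC'K : (C' : Set S) ⊆ Kᶜ := by
      intro x hx hxK
      have hxD : x ∉ D := by
        have := boundaryComponent_subset C'.2 hx
        rw [hD.isOpen.frontier_eq] at this
        exact this.2
      obtain ⟨z, hz, rfl⟩ := hxK
      have hz1 : ‖z‖ = 1 :=
        le_antisymm (not_lt.1 fun h => hxD ((hside z (hZsub hz)).2 h)) hz.1
      have hzC : Φ z ∈ (C : Set S) := by
        rw [← hsph]; exact mem_image_of_mem Φ (mem_sphere_zero_iff_norm.2 hz1)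
      exact hC' (Subtype.ext (boundaryComponents_eq_of_mem C'.2 C.2 hx hzC))
    refine mem_inf_of_left ?_
    filter_upwards [hKc.isOpen_compl.mem_nhdsSet.2 hC'K] with s hs using hβK s hs
  · intro u γ hu hγ
    have hW : IsOpen (D \ {s₀}) := hD.isOpen.sdiff isClosed_singleton
    have hAW : A ⊆ D \ {s₀} := fun s hs => ⟨hAD hs, fun h => hs₀Φ (h ▸ hs)⟩
    rw [setIntegral_eq_of_subset_of_forall_sdiff_eq_zero hW.measurableSet hAW fun x hx =>
      gradInner_of_eventually_const (hβK' x fun hxK => hx.2 (hKD ⟨hxK, hx.1.1⟩))]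
    refine hμ.setIntegral_gradInner_eq (b := fun t => 1 - η t) (b' := fun t => -η' t)
      hcol.chart hW hAW (hsm.mono sdiff_subset) hu h1 h12.le h2
      (fun t => (hη t).const_sub 1) hηc.neg (fun t ht => ?_) ?_ ?_ hβΦ (hγ Φ R hcol hs₀Φ)
    · simp only [hη' t ht, neg_zero]
    · simp only [hη0 r₁ le_rfl, sub_zero]
    · simp only [hη1 r₂ le_rfl, sub_self]

end Cutoff

/-! ### Uniqueness of the hydrodynamical Green function -/

section Uniqueness

variable {S : Type*} [MetricSpace S] [CompactSpace S] [ChartedSpace (EuclideanSpace ℝ (Fin 2)) S]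
  [RiemannianBundle (fun x : S => TangentSpace (𝓡 2) x)] [IsManifold (𝓡 2) ∞ S]
  [IsContMDiffRiemannianBundle (𝓡 2) ∞ (EuclideanSpace ℝ (Fin 2))
    (fun x : S => TangentSpace (𝓡 2) x)] [MeasurableSpace S] [BorelSpace S]
  {D : Set S} {s₀ : S} {μ : Measure S} {u w : S → ℝ} {k γ : boundaryComponents D → ℝ}

/-- A function on `D` that vanishes near the boundary of `D` and near `s₀` vanishes off a compact
subset of `D \ {s₀}`. -/
theorem exists_isCompact_eq_zero {F : S → ℝ}
    (hF : ∀ C : boundaryComponents D, ∀ᶠ s in endFilter D (C : Set S), F s = 0)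
    (hF₀ : ∀ᶠ s in 𝓝 s₀, F s = 0) :
    ∃ K ⊆ D \ {s₀}, IsCompact K ∧ ∀ s ∈ D, s ∉ K → F s = 0 := by
  obtain ⟨K, hKD, hK, hsub⟩ := exists_isCompact_of_mem_endFilter (O := {s | F s = 0}) hF
  obtain ⟨V, hV, hVo, hs₀⟩ := eventually_nhds_iff.1 hF₀
  refine ⟨K \ V, fun s hs => ⟨hKD hs.1, fun h => hs.2 ?_⟩, hK.diff hVo, fun s hs hsK => ?_⟩
  · rw [mem_singleton_iff.1 h]; exact hs₀
  · by_contra h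
    exact hsK ⟨hsub ⟨hs, h⟩, fun hsV => h (hV s hsV)⟩

/-- The gradient of `w` vanishes off a compact subset of `D \ {s₀}`, on which the integrand is
continuous; the behaviour of `u` at `s₀` and at the boundary does not matter. -/
theorem IsAreaMeasure.integrableOn_gradInner (hμ : IsAreaMeasure μ) (hD : IsOpen D)
    (hw : ContMDiffOn (𝓡 2) 𝓘(ℝ, ℝ) 1 w D)
    (hwk : ∀ C : boundaryComponents D, ∀ᶠ s in endFilter D (C : Set S), w s = k C)
    (hw₀ : ∀ᶠ s in 𝓝 s₀, w s = 0) (hu : ContMDiffOn (𝓡 2) 𝓘(ℝ, ℝ) 2 u (D \ {s₀})) :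
    IntegrableOn (gradInner w u) (D \ {s₀}) μ := by
  have hfin := hμ.isLocallyFiniteMeasure
  have hW : IsOpen (D \ {s₀}) := hD.sdiff isClosed_singleton
  obtain ⟨K, hKW, hK, hK0⟩ := exists_isCompact_eq_zero (D := D) (s₀ := s₀) (F := gradInner w u)
    (fun C => (eventually_eventually_nhds_endFilter hD (hwk C)).mono fun s hs =>
      gradInner_of_eventually_const hs)
    ((eventually_eventually_nhds.2 hw₀).mono fun s hs => gradInner_of_eventually_const hs)
  have hc := continuousOn_gradInner hW (hw.mono sdiff_subset) hu
  refine IntegrableOn.of_forall_sdiff_eq_zero ((hc.mono hKW).integrableOn_compact hK)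
    hW.measurableSet fun s hs => hK0 s hs.1.1 hs.2

/-- Green's formula: if `w` is constant near each boundary component and vanishes near `s₀`, then
its gradient pairs with the gradient of a harmonic function on `D \ {s₀}` to the sum of the
boundary values of `w` times the circulations. -/
theorem IsJordanDomain.integral_gradInner_eq [Fintype (boundaryComponents D)]
    (hμ : IsAreaMeasure μ) (hD : IsJordanDomain D) (hs₀ : s₀ ∈ D)
    (hw : ContMDiffOn (𝓡 2) 𝓘(ℝ, ℝ) 1 w D)
    (hwk : ∀ C : boundaryComponents D, ∀ᶠ s in endFilter D (C : Set S), w s = k C)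
    (hw₀ : ∀ᶠ s in 𝓝 s₀, w s = 0) (hu : IsHarmonicOn u (D \ {s₀}))
    (hγ : ∀ (C : boundaryComponents D) (Φ : ℂ → S) (R : ℝ), IsCollar D (C : Set S) Φ R →
      s₀ ∉ Φ '' annulus 1 R → ∀ r : ℝ, 1 < r → r < R → circulation u Φ r = γ C) :
    ∫ x in D \ {s₀}, gradInner w u x ∂μ = ∑ C, k C * γ C := by
  classical
  have hW : IsOpen (D \ {s₀}) := hD.isOpen.sdiff isClosed_singleton
  choose β hβ hβ1 hβ0 hβs₀ hβγ using fun C => hD.exists_collarCutoff hμ C hs₀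
  -- subtracting the cutoff functions leaves a test function
  set ψ : S → ℝ := fun s => w s + ∑ C, -k C * β C s with hψ
  have hψend : ∀ C : boundaryComponents D, ∀ᶠ s in endFilter D (C : Set S), ψ s = 0 := by
    intro C
    have h1 : ∀ᶠ s in endFilter D (C : Set S), ∀ C', C' ≠ C → β C' s = 0 := by
      rw [eventually_all]
      intro C'
      by_cases h : C' = C
      · exact Eventually.of_forall fun s hne => absurd h hne
      · filter_upwards [hβ0 C' C (Ne.symm h)] with s hs _ using hs
    filter_upwards [hwk C, hβ1 C, h1] with s h2 h3 h4
    rw [hψ]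
    simp only
    rw [Finset.sum_eq_single C (fun C' _ hne => by rw [h4 C' hne, mul_zero]) (by simp), h2, h3]
    ring
  have hψs₀ : ∀ᶠ s in 𝓝 s₀, ψ s = 0 := by
    have h1 : ∀ᶠ s in 𝓝 s₀, ∀ C, β C s = 0 := eventually_all.2 hβs₀
    filter_upwards [hw₀, h1] with s h2 h3
    rw [hψ]
    simp [h2, h3]
  obtain ⟨K, hKW, hK, hK0⟩ := exists_isCompact_eq_zero hψend hψs₀
  set φ : S → ℝ := D.indicator ψ with hφdef
  have hφK : ∀ s ∉ K, φ s = 0 := by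
    intro s hs
    by_cases hsD : s ∈ D
    · rw [hφdef, indicator_of_mem hsD, hK0 s hsD hs]
    · exact indicator_of_notMem hsD _
  have hφD : ∀ s ∈ D, φ =ᶠ[𝓝 s] ψ := fun s hs => by
    filter_upwards [hD.isOpen.mem_nhds hs] with z hz using indicator_of_mem hz _
  have hψsm : ContMDiffOn (𝓡 2) 𝓘(ℝ, ℝ) 1 ψ D :=
    hw.add (contMDiffOn_finsetSum fun C _ => contMDiffOn_const.mul (hβ C))
  have hφsm : ContMDiff (𝓡 2) 𝓘(ℝ, ℝ) 1 φ := by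
    intro s
    by_cases hs : s ∈ D
    · exact (hψsm.contMDiffAt (hD.isOpen.mem_nhds hs)).congr_of_eventuallyEq (hφD s hs)
    · refine (contMDiffAt_const (c := (0 : ℝ))).congr_of_eventuallyEq ?_
      filter_upwards [hK.isClosed.isOpen_compl.mem_nhds fun h => hs (hKW h).1] with z hz
        using hφK z hz
  have hsupp : tsupport φ ⊆ D \ {s₀} :=
    (closure_minimal (fun s (hs : φ s ≠ 0) => by_contra fun h => hs (hφK s h))
      hK.isClosed).trans hKW
  have hzero := hμ.integral_gradInner_eq_zero hW hu hφsm hsupp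
  rw [← setIntegral_eq_integral_of_forall_compl_eq_zero (s := D \ {s₀}) fun x hx =>
    gradInner_eq_zero_of_notMem_tsupport fun h => hx (hsupp h)] at hzero
  have hexp : EqOn (gradInner φ u)
      (fun x => gradInner w u x + ∑ C, -k C * gradInner (β C) u x) (D \ {s₀}) := by
    intro x hx
    have hxD := hD.isOpen.mem_nhds hx.1
    have h1 : MDifferentiableAt (𝓡 2) 𝓘(ℝ, ℝ) w x :=
      (hw.contMDiffAt hxD).mdifferentiableAt (by simp)
    have h2 : ∀ C, MDifferentiableAt (𝓡 2) 𝓘(ℝ, ℝ) (β C) x := fun C =>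
      ((hβ C).contMDiffAt hxD).mdifferentiableAt (by simp)
    have h3 : ∀ C, MDifferentiableAt (𝓡 2) 𝓘(ℝ, ℝ) (fun s => -k C * β C s) x := fun C =>
      ((contMDiffAt_const (c := -k C)).mul ((hβ C).contMDiffAt hxD)).mdifferentiableAt (by simp)
    have h4 : MDifferentiableAt (𝓡 2) 𝓘(ℝ, ℝ) (fun s => ∑ C, -k C * β C s) x :=
      (ContMDiffAt.sum (n := 1) fun C _ => (contMDiffAt_const (c := -k C)).mul
        ((hβ C).contMDiffAt hxD)).mdifferentiableAt (by simp)
    rw [gradInner_congr (hφD x hx.1) EventuallyEq.rfl, hψ, gradInner_add_left h1 h4,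
      gradInner_sum_left _ fun C _ => h3 C]
    simp only [gradInner_const_mul_left _ (h2 _)]
  have hint : ∀ C, IntegrableOn (gradInner (β C) u) (D \ {s₀}) μ := fun C =>
    hμ.integrableOn_gradInner hD.isOpen (k := fun C' => if C' = C then 1 else 0) (hβ C)
      (fun C' => by
        by_cases h : C' = C
        · subst h; simpa using hβ1 C'
        · simpa [h] using hβ0 C C' h) (hβs₀ C) hu.1
  rw [setIntegral_congr_fun hW.measurableSet hexp,
    integral_add (hμ.integrableOn_gradInner hD.isOpen hw hwk hw₀ hu.1)
      (integrable_finsetSum _ fun C _ => (hint C).const_mul _),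
    integral_finsetSum _ fun C _ => (hint C).const_mul _] at hzero
  simp_rw [integral_const_mul, hβγ _ u _ hu.1 (hγ _), neg_mul] at hzero
  rw [Finset.sum_neg_distrib] at hzero
  linarith

theorem mfderiv_eq_zero_of_gradInner_self {x : S} (hu : MDifferentiableAt (𝓡 2) 𝓘(ℝ, ℝ) u x)
    (h : gradInner u u x = 0) : mfderiv (𝓡 2) 𝓘(ℝ, ℝ) u x = 0 := by
  rw [hu.mfderiv]
  have h1 := fderiv_eq_zero_of_gradInner_self h
  rw [← fderivWithin_univ] at h1
  simpa [writtenInExtChartAt] using! h1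

/-- A function with vanishing derivative on a connected open set is constant. -/
theorem eq_of_mfderiv_eq_zero (hD : IsOpen D) (hDc : IsPreconnected D)
    (hu : ContMDiffOn (𝓡 2) 𝓘(ℝ, ℝ) 1 u D) (h : ∀ x ∈ D, mfderiv (𝓡 2) 𝓘(ℝ, ℝ) u x = 0)
    {p q : S} (hp : p ∈ D) (hq : q ∈ D) : u p = u q := by
  refine hDc.induction₂ (fun x y => u x = u y) (fun x hx => ?_) 
    (fun _ _ _ _ _ _ => Eq.trans) (fun _ _ _ _ => Eq.symm) hp hq
  have he := isOpenSmoothEmbeddingOn_extChartAt_symm (E := Plane) (M := S) x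
  set e := (extChartAt (𝓡 2) x).symm with hedef
  have hO := he.isOpen_inter_preimage hD
  set O := (extChartAt (𝓡 2) x).target ∩ e ⁻¹' D with hOdef
  have hxO : extChartAt (𝓡 2) x x ∈ O :=
    ⟨mem_extChartAt_target x, by rw [mem_preimage, hedef, extChartAt_to_inv]; exact hx⟩
  obtain ⟨r, hr, hball⟩ := Metric.isOpen_iff.1 hO _ hxO
  have hd : ∀ y ∈ O, MDifferentiableAt (𝓡 2) 𝓘(ℝ, ℝ) u (e y) := fun y hy =>
    (hu.contMDiffAt (hD.mem_nhds hy.2)).mdifferentiableAt (by simp)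
  have hconst : ∀ y ∈ Metric.ball (extChartAt (𝓡 2) x x) r,
      (u ∘ e) y = (u ∘ e) (extChartAt (𝓡 2) x x) := fun y hy =>
    Metric.isOpen_ball.is_const_of_fderiv_eq_zero (𝕜 := ℝ)
      (convex_ball _ _).isPreconnected
      (fun z hz => (he.differentiableAt_comp (hball hz).1 (hd z (hball hz))).differentiableWithinAt)
      (fun z hz => by
        have h1 := mfderiv_comp (I' := 𝓡 2) z (hd z (hball hz)) (he.mdifferentiableAt (hball hz).1)
        rw [mfderiv_eq_fderiv, h _ (hball hz).2] at h1
        rw [h1]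
        ext v
        rfl) hy (Metric.mem_ball_self hr)
  have hnhds : e '' Metric.ball (extChartAt (𝓡 2) x x) r ∈ 𝓝 x :=
    (he.isOpen_image Metric.isOpen_ball (hball.trans inter_subset_left)).mem_nhds
      ⟨_, Metric.mem_ball_self hr, extChartAt_to_inv x⟩
  filter_upwards [nhdsWithin_le_nhds hnhds]
  rintro _ ⟨y, hy, rfl⟩
  have := hconst y hy
  simp only [Function.comp_apply, hedef, extChartAt_to_inv] at this
  exact this.symm

end Uniqueness

section GreenUniqueness

variable {S : Type*} [MetricSpace S] [CompactSpace S] [ChartedSpace (EuclideanSpace ℝ (Fin 2)) S]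
  [RiemannianBundle (fun x : S => TangentSpace (𝓡 2) x)] [IsManifold (𝓡 2) ∞ S]
  [IsContMDiffRiemannianBundle (𝓡 2) ∞ (EuclideanSpace ℝ (Fin 2))
    (fun x : S => TangentSpace (𝓡 2) x)] [MeasurableSpace S] [BorelSpace S]
  {D : Set S} {s₀ : S} {μ : Measure S} {u : S → ℝ} {γ c : boundaryComponents D → ℝ} {a : ℝ}

/-- A function whose gradient is orthogonal to the gradient of every `w` that is constant near the
boundary components and near `s₀` is constant, provided that it has limits at the boundary
components and at `s₀`. The functions `w = η ∘ u` suffice, where `η` is a smooth step between two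
values of `u`, and the step avoids the finitely many limits. -/
theorem IsJordanDomain.eq_of_forall_integral_gradInner_eq_zero (hμ : IsAreaMeasure μ)
    (hD : IsJordanDomain D) (hs₀ : s₀ ∈ D) (hu : ContMDiffOn (𝓡 2) 𝓘(ℝ, ℝ) 2 u (D \ {s₀}))
    (ha : Tendsto u (𝓝[≠] s₀) (𝓝 a))
    (hc : ∀ C : boundaryComponents D, Tendsto u (endFilter D (C : Set S)) (𝓝 (c C)))
    (hint : ∀ (w : S → ℝ) (k : boundaryComponents D → ℝ), ContMDiffOn (𝓡 2) 𝓘(ℝ, ℝ) 1 w D →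
      (∀ C : boundaryComponents D, ∀ᶠ s in endFilter D (C : Set S), w s = k C) →
      (∀ᶠ s in 𝓝 s₀, w s = 0) → ∫ x in D \ {s₀}, gradInner w u x ∂μ = 0)
    {p q : S} (hp : p ∈ D \ {s₀}) (hq : q ∈ D \ {s₀}) : u p ≤ u q := by
  classical
  by_contra! hlt
  have hpos := hμ.isOpenPosMeasure
  have hW : IsOpen (D \ {s₀}) := hD.isOpen.sdiff isClosed_singleton
  have : Finite (boundaryComponents D) := hD.finite
  -- an interval of values of `u` that avoids the limits of `u`
  set F : Set ℝ := insert a (range c) with hF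
  have hFfin : F.Finite := (finite_range c).insert a
  obtain ⟨m, hm, hmF⟩ := (Ioo_infinite hlt).exists_notMem_finite hFfin
  obtain ⟨ε, hε, hball⟩ := Metric.nhds_basis_closedBall.mem_iff.1
    ((isOpen_Ioo.inter hFfin.isClosed.isOpen_compl).mem_nhds ⟨hm, hmF⟩)
  rw [Real.closedBall_eq_Icc] at hball
  obtain ⟨η, η', hη, hηc, hη'0, hη0, hη1, -⟩ := exists_smoothStep (show m - ε < m + ε by linarith)
  have hηloc : ∀ t ∈ F, ∀ᶠ t' in 𝓝 t, η t' = η t := by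
    intro t ht
    by_cases h : t < m - ε
    · filter_upwards [Iio_mem_nhds h] with t' ht'
      rw [hη0 t' (le_of_lt ht'), hη0 t h.le]
    · have h2 : m + ε < t := by
        by_contra h3
        exact (hball ⟨not_lt.1 h, not_lt.1 h3⟩).2 ht
      filter_upwards [Ioi_mem_nhds h2] with t' ht'
      rw [hη1 t' (le_of_lt ht'), hη1 t h2.le]
  -- `w = η ∘ u - η a`, extended by its limit at `s₀`
  set η₀ : ℝ → ℝ := fun t => η t - η a with hη₀
  have hη₀d : ∀ t, HasDerivAt η₀ (η' t) t := fun t => (hη t).sub_const (η a)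
  have hη₀sm := contDiff_one_of_hasDerivAt hη₀d hηc
  set w : S → ℝ := fun s => if s = s₀ then 0 else η₀ (u s) with hw
  have hweq : ∀ s ∈ D \ {s₀}, w =ᶠ[𝓝 s] fun z => η₀ (u z) := fun s hs => by
    filter_upwards [hW.mem_nhds hs] with z hz
    exact if_neg hz.2
  have hws₀ : ∀ᶠ s in 𝓝 s₀, w s = 0 := by
    have h1 := ha.eventually (hηloc a (mem_insert _ _))
    rw [eventually_nhdsWithin_iff] at h1
    filter_upwards [h1] with s hs
    by_cases h : s = s₀
    · exact if_pos h
    · have h2 : w s = η₀ (u s) := if_neg h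
      rw [h2, hη₀]
      simp only [hs h, sub_self]
  have hwC : ∀ C : boundaryComponents D,
      ∀ᶠ s in endFilter D (C : Set S), w s = η₀ (c C) := by
    intro C
    filter_upwards [(hc C).eventually (hηloc (c C) (mem_insert_of_mem _ (mem_range_self C))),
      hD.compl_mem_endFilter isCompact_singleton (singleton_subset_iff.2 hs₀) C] with s h1 h2
    have h3 : w s = η₀ (u s) := if_neg h2
    rw [h3, hη₀]
    simp only [h1]
  have hwsm : ContMDiffOn (𝓡 2) 𝓘(ℝ, ℝ) 1 w D := by
    intro s hs
    refine ContMDiffAt.contMDiffWithinAt ?_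
    by_cases h : s = s₀
    · rw [h]
      exact contMDiffAt_const.congr_of_eventuallyEq hws₀
    · have h1 := (hu.contMDiffAt (hW.mem_nhds ⟨hs, h⟩)).of_le (m := 1) (by norm_num)
      exact (hη₀sm.contDiffAt.contMDiffAt.comp s h1).congr_of_eventuallyEq (hweq s ⟨hs, h⟩)
  have hud : ∀ s ∈ D \ {s₀}, MDifferentiableAt (𝓡 2) 𝓘(ℝ, ℝ) u s := fun s hs =>
    (hu.contMDiffAt (hW.mem_nhds hs)).mdifferentiableAt (by simp)
  have hgrad : ∀ s ∈ D \ {s₀}, gradInner w u s = η' (u s) * gradInner u u s := fun s hs => by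
    rw [gradInner_congr (hweq s hs) EventuallyEq.rfl, gradInner_comp_left (hη₀d _) (hud s hs)]
  -- the integrand is nonnegative and continuous, and so vanishes
  have hnonneg : 0 ≤ᵐ[μ.restrict (D \ {s₀})] gradInner w u := by
    refine (ae_restrict_iff' hW.measurableSet).2 (Eventually.of_forall fun s hs => ?_)
    rw [hgrad s hs]
    exact mul_nonneg (hη'0 _) (gradInner_self_nonneg u s)
  have hae := (setIntegral_eq_zero_iff_of_nonneg_ae hnonneg
    (hμ.integrableOn_gradInner hD.isOpen hwsm hwC hws₀ hu)).1 (hint w _ hwsm hwC hws₀)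
  have hzero : EqOn (gradInner w u) 0 (D \ {s₀}) :=
    Measure.eqOn_open_of_ae_eq hae hW (continuousOn_gradInner hW (hwsm.mono sdiff_subset) hu)
      continuousOn_const
  have hmf : ∀ s ∈ D, mfderiv (𝓡 2) 𝓘(ℝ, ℝ) w s = 0 := by
    intro s hs
    by_cases h : s = s₀
    · rw [h, EventuallyEq.mfderiv_eq (f := fun _ => (0 : ℝ)) hws₀]
      exact mfderiv_const
    · have hsW : s ∈ D \ {s₀} := ⟨hs, h⟩
      have h1 := hzero hsW
      rw [hgrad s hsW] at h1
      have h2 := ((hη₀d (u s)).hasFDerivAt.hasMFDerivAt.comp s (hud s hsW).hasMFDerivAt).mfderiv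
      have h3 : mfderiv (𝓡 2) 𝓘(ℝ, ℝ) w s = mfderiv (𝓡 2) 𝓘(ℝ, ℝ) (η₀ ∘ u) s :=
        (hweq s hsW).mfderiv_eq
      rw [h3, h2]
      rcases mul_eq_zero.1 h1 with h4 | h4
      · rw [h4, ContinuousLinearMap.toSpanSingleton_zero]
        exact ContinuousLinearMap.zero_comp _
      · rw [mfderiv_eq_zero_of_gradInner_self (hud s hsW) h4]
        exact ContinuousLinearMap.comp_zero _
  have hpq := eq_of_mfderiv_eq_zero hD.isOpen hD.isConnected.isPreconnected hwsm hmf hp.1 hq.1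
  have hp' : w p = η₀ (u p) := if_neg hp.2
  have hq' : w q = η₀ (u q) := if_neg hq.2
  have hmp := (hball ⟨by linarith, le_rfl⟩ : m + ε ∈ _).1.2
  have hmq := (hball ⟨le_rfl, by linarith⟩ : m - ε ∈ _).1.1
  rw [hp', hq', hη₀] at hpq
  simp only [hη1 _ hmp.le, hη0 _ hmq.le] at hpq
  linarith

/-- Two hydrodynamical Green functions with the same circulations differ by a constant. -/
theorem IsHydrodynamicalGreen.exists_sub_eq_const (hμ : IsAreaMeasure μ) (hD : IsJordanDomain D)
    {G₁ G₂ : S → S → ℝ} (h₁ : IsHydrodynamicalGreen D γ G₁) (h₂ : IsHydrodynamicalGreen D γ G₂) :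
    ∃ b : ℝ, ∀ s ∈ D, ∀ s₀ ∈ D, s ≠ s₀ → G₁ s s₀ - G₂ s s₀ = b := by
  have hfin : Finite (boundaryComponents D) := hD.finite
  have := Fintype.ofFinite (boundaryComponents D)
  have hle : ∀ s₀ ∈ D, ∀ p ∈ D \ {s₀}, ∀ q ∈ D \ {s₀},
      G₁ p s₀ - G₂ p s₀ ≤ G₁ q s₀ - G₂ q s₀ := by
    intro s₀ hs₀ p hp q hq
    have hW : IsOpen (D \ {s₀}) := hD.isOpen.sdiff isClosed_singleton
    obtain ⟨ρ₁, hρ₁⟩ := h₁.singularity s₀ hs₀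
    obtain ⟨ρ₂, hρ₂⟩ := h₂.singularity s₀ hs₀
    choose b₁ hb₁ using h₁.boundary s₀ hs₀
    choose b₂ hb₂ using h₂.boundary s₀ hs₀
    refine hD.eq_of_forall_integral_gradInner_eq_zero (u := fun s => G₁ s s₀ - G₂ s s₀) hμ hs₀
      ((h₁.harmonic s₀ hs₀).1.sub (h₂.harmonic s₀ hs₀).1) ((hρ₁.sub hρ₂).congr fun s => ?_)
      (fun C => (hasBoundaryValue_iff.1 (hb₁ C)).sub (hasBoundaryValue_iff.1 (hb₂ C))) ?_ hp hq
    · simp only [subtractedGreen]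
      ring
    · intro w k hw hwk hw₀
      have hsub : EqOn (gradInner w fun s => G₁ s s₀ - G₂ s s₀)
          (fun x => gradInner w (fun s => G₁ s s₀) x - gradInner w (fun s => G₂ s s₀) x)
          (D \ {s₀}) := fun x hx =>
        gradInner_sub_right ((h₁.harmonic s₀ hs₀).mdifferentiableAt hW hx)
          ((h₂.harmonic s₀ hs₀).mdifferentiableAt hW hx)
      rw [setIntegral_congr_fun hW.measurableSet hsub, integral_sub
        (hμ.integrableOn_gradInner hD.isOpen hw hwk hw₀ (h₁.harmonic s₀ hs₀).1)
        (hμ.integrableOn_gradInner hD.isOpen hw hwk hw₀ (h₂.harmonic s₀ hs₀).1),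
        hD.integral_gradInner_eq hμ hs₀ hw hwk hw₀ (h₁.harmonic s₀ hs₀)
          (h₁.circulation_eq s₀ hs₀),
        hD.integral_gradInner_eq hμ hs₀ hw hwk hw₀ (h₂.harmonic s₀ hs₀)
          (h₂.circulation_eq s₀ hs₀), sub_self]
  have heq : ∀ s₀ ∈ D, ∀ p ∈ D \ {s₀}, ∀ q ∈ D \ {s₀},
      G₁ p s₀ - G₂ p s₀ = G₁ q s₀ - G₂ q s₀ := fun s₀ hs₀ p hp q hq =>
    le_antisymm (hle s₀ hs₀ p hp q hq) (hle s₀ hs₀ q hq p hp)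
  by_cases hex : ∃ s ∈ D, ∃ s₀ ∈ D, s ≠ s₀
  · obtain ⟨p, hp, q, hq, hpq⟩ := hex
    refine ⟨G₁ p q - G₂ p q, fun s hs s₀ hs₀ hne => ?_⟩
    -- by symmetry, the constant for the pole `s₀` and that for the pole `q` agree
    have hsymm : ∀ x ∈ D, ∀ y ∈ D, x ≠ y → G₁ x y - G₂ x y = G₁ y x - G₂ y x :=
      fun x hx y hy hxy => by rw [h₁.symmetric x hx y hy hxy, h₂.symmetric x hx y hy hxy]
    by_cases h : s₀ = q
    · subst h
      exact heq s₀ hs₀ s ⟨hs, hne⟩ p ⟨hp, hpq⟩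
    · rw [heq s₀ hs₀ s ⟨hs, hne⟩ q ⟨hq, Ne.symm h⟩, hsymm q hq s₀ hs₀ (Ne.symm h)]
      exact heq q hq s₀ ⟨hs₀, h⟩ p ⟨hp, hpq⟩
  · push Not at hex
    exact ⟨0, fun s hs s₀ hs₀ hne => absurd (hex s hs s₀ hs₀) hne⟩

/-- A hydrodynamical Green function is determined by its circulations and by one boundary value. -/
theorem IsHydrodynamicalGreen.eq_of_boundaryValue_eq (hμ : IsAreaMeasure μ)
    (hD : IsJordanDomain D) {G₁ G₂ : S → S → ℝ} (h₁ : IsHydrodynamicalGreen D γ G₁)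
    (h₂ : IsHydrodynamicalGreen D γ G₂) {s₁ : S} (hs₁ : s₁ ∈ D) {C : boundaryComponents D} {b : ℝ}
    (hb₁ : HasBoundaryValue D (fun s => G₁ s s₁) C b)
    (hb₂ : HasBoundaryValue D (fun s => G₂ s s₁) C b) {s s₀ : S} (hs : s ∈ D) (hs₀ : s₀ ∈ D)
    (hne : s ≠ s₀) : G₁ s s₀ = G₂ s s₀ := by
  obtain ⟨t, ht⟩ := h₁.exists_sub_eq_const hμ hD h₂
  have := endFilter_neBot C.2
  have h1 := (hasBoundaryValue_iff.1 hb₁).sub (hasBoundaryValue_iff.1 hb₂)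
  have h2 : Tendsto (fun s => G₁ s s₁ - G₂ s s₁) (endFilter D (C : Set S)) (𝓝 t) := by
    refine tendsto_const_nhds.congr' ?_
    filter_upwards [mem_endFilter_self,
      hD.compl_mem_endFilter isCompact_singleton (singleton_subset_iff.2 hs₁) C] with s h3 h4
    exact (ht s h3 s₁ hs₁ h4).symm
  have h3 := tendsto_nhds_unique h1 h2
  linarith [ht s hs s₀ hs₀ hne]

end GreenUniqueness

end

/-! ### Hydrodynamical Green functions of conformally equivalent domains -/

theorem mainTheorem6
    {S : Type*} [MetricSpace S] [CompactSpace S]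
    [ChartedSpace (EuclideanSpace ℝ (Fin 2)) S] [IsManifold (𝓡 2) ∞ S]
    [RiemannianBundle (fun x : S => TangentSpace (𝓡 2) x)]
    [IsContMDiffRiemannianBundle (𝓡 2) ∞ (EuclideanSpace ℝ (Fin 2))
      (fun x : S => TangentSpace (𝓡 2) x)]
    [IsRiemannianManifold (𝓡 2) S]
    {S' : Type*} [MetricSpace S'] [CompactSpace S']
    [ChartedSpace (EuclideanSpace ℝ (Fin 2)) S'] [IsManifold (𝓡 2) ∞ S']
    [RiemannianBundle (fun x : S' => TangentSpace (𝓡 2) x)]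
    [IsContMDiffRiemannianBundle (𝓡 2) ∞ (EuclideanSpace ℝ (Fin 2))
      (fun x : S' => TangentSpace (𝓡 2) x)]
    [IsRiemannianManifold (𝓡 2) S']
    (D : Set S) (hD : IsJordanDomain D) (D' : Set S') (hD' : IsJordanDomain D')
    (f : S → S') (h : S → ℝ) (hf : IsConformalBetween f D D' h) :
    ∃ σ : boundaryComponents D ≃ boundaryComponents D',
      (∀ C : boundaryComponents D, Tendsto f (𝓝ˢ (C : Set S) ⊓ 𝓟 D) (𝓝ˢ (σ C : Set S'))) ∧
      ∀ γ : boundaryComponents D → ℝ,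
        (∀ G' : S' → S' → ℝ,
          IsHydrodynamicalGreen D' (fun C' => γ (σ.symm C')) G' ↔
            IsHydrodynamicalGreen D γ (fun s s₀ => G' (f s) (f s₀))) ∧
        (∀ (G : S → S → ℝ) (G' : S' → S' → ℝ),
          IsHydrodynamicalGreen D γ G →
          IsHydrodynamicalGreen D' (fun C' => γ (σ.symm C')) G' →
          (∃ s₁ ∈ D, ∃ (C : boundaryComponents D) (b : ℝ),
            HasBoundaryValue D (fun s => G s s₁) C b ∧
            HasBoundaryValue D' (fun s' => G' s' (f s₁)) (σ C) b) →
          (∀ s ∈ D, ∀ s₀ ∈ D, s ≠ s₀ → G' (f s) (f s₀) = G s s₀) ∧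
          (∀ s₀ ∈ D, regularizedGreen G' (f s₀) =
            regularizedGreen G s₀ - Real.log (h s₀) / (2 * Real.pi))) := by
  -- the area measure enters only through the uniqueness of Green functions on `D`
  borelize S
  obtain ⟨p₀, hp₀⟩ := hD.isConnected.nonempty
  have : Nonempty S := ⟨p₀⟩
  obtain ⟨μ, hμ⟩ := exists_isAreaMeasure (S := S)
  set g := Function.invFunOn f D with hg
  have hgf : LeftInvOn g f D := hf.bijOn.injOn.leftInvOn_invFunOn
  have hfg : LeftInvOn f g D' := hf.bijOn.surjOn.rightInvOn_invFunOn
  have hgc := hf.inverse hD.isOpen hgf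
  obtain ⟨σ, hσ, hσ'⟩ := hD.exists_boundary_equiv hD' hf.smooth.continuousOn
    hgc.smooth.continuousOn hf.bijOn.mapsTo hgc.bijOn.mapsTo hgf hfg
  have hpull : ∀ (γ : boundaryComponents D → ℝ) (G' : S' → S' → ℝ),
      IsHydrodynamicalGreen D' (fun C' => γ (σ.symm C')) G' →
        IsHydrodynamicalGreen D γ (fun s s₀ => G' (f s) (f s₀)) := by
    intro γ G' hG'
    have := hG'.comp_conformal hf hD.isOpen hfg σ hσ hσ'
    simpa only [Equiv.symm_apply_apply] using this
  refine ⟨σ, fun C => (hσ C).mono_right inf_le_left, fun γ => ⟨fun G' => ⟨hpull γ G', ?_⟩, ?_⟩⟩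
  · intro hG
    have h1 := hG.comp_conformal hgc hD'.isOpen hgf σ.symm hσ' (by simpa using hσ)
    refine h1.congr hD'.isOpen fun s hs s₀ hs₀ => ?_
    simp only [hfg hs, hfg hs₀]
  · rintro G G' hG hG' ⟨s₁, hs₁, C, b, hb, hb'⟩
    have hb₁ : HasBoundaryValue D (fun s => G' (f s) (f s₁)) C b :=
      hasBoundaryValue_iff.2 ((hasBoundaryValue_iff.1 hb').comp (hσ C))
    have heq : ∀ s ∈ D, ∀ s₀ ∈ D, s ≠ s₀ → G' (f s) (f s₀) = G s s₀ := fun s hs s₀ hs₀ hne =>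
      (hpull γ G' hG').eq_of_boundaryValue_eq hμ hD hG hs₁ hb₁ hb hs hs₀ hne
    refine ⟨heq, fun s₀ hs₀ => ?_⟩
    obtain ⟨ρ, hρ⟩ := hG'.singularity (f s₀) (hf.bijOn.mapsTo hs₀)
    have h1 : Tendsto (subtractedGreen G s₀) (𝓝[≠] s₀)
        (𝓝 (ρ + Real.log (h s₀) / (2 * Real.pi))) := by
      refine (hf.tendsto_subtractedGreen hD.isOpen hs₀ hρ).congr' ?_
      filter_upwards [nhdsWithin_le_nhds (hD.isOpen.mem_nhds hs₀), self_mem_nhdsWithin]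
        with s hs hne
      simp only [subtractedGreen, heq s hs s₀ hs₀ hne]
    have := neBot_nhdsNE s₀
    have := neBot_nhdsNE (f s₀)
    rw [regularizedGreen, regularizedGreen, hρ.limUnder_eq, h1.limUnder_eq]
    ring
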